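/- **Setting.** Fix dimensions $d\ge 1$, $d'$, $p$, $p'$ with $p+p'\ge1$, a horizon $H\ge 1$, cost matrices $Q_h\succ0$, $R_h\succ0$ ($1\le h<H$), $Q_H\succeq 0$, a state space $\mathcal X\subset\mathbb R^d$, a closed action space $\mathcal U\subset\mathbb R^{d'}$, an initial state $x_1\in\mathcal X$, and a distribution $\mu$ of contexts $(C,D)\in\mathbb R^{p\times d}\times\mathbb R^{p'\times d'}$. For $\Theta\in\mathbb R^{d\times(p+p')}$ put $M_{\Theta,C,D}=\Theta\begin{bmatrix}C&0\\0&D\end{bmatrix}=[A,B]$. In the LQR game $M=[A,B]$ the state evolves by $x_{h+1}=Ax_h+Bu_h+w_{h+1}$, with independent noise vectors $w_2,\dots,w_H$ (whose laws do not depend on the episode), and the cost is $\sum_{h<H}(x_h^\top Q_hx_h+u_h^\top R_hu_h)+x_H^\top Q_Hx_H$. A policy maps the past states and actions in $\mathcal X\times\mathcal U$ and the present state in $\mathcal X$ to an action in $\mathcal U$; $J_1^\pi(M,x_1)$ is its expected total cost and $J_1^*(M,x_1)=\inf_\pi J_1^\pi(M,x_1)$. For $M=[A,B]$ let $P_H(M)=Q_H$,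 and for $h<H$, with $P=P_{h+1}(M)$, $$P_h(M)=Q_h+A^\top PA-A^\top PB(R_h+B^\top PB)^{-1}B^\top PA,\qquad K_h(M)=-(R_h+B^\top PB)^{-1}B^\top PA,$$ and let $C_H(M)=0$, $C_h(M)=C_{h+1}(M)+\mathbb E[w_{h+1}^\top P_{h+1}(M)w_{h+1}]$. **Assumptions** (for an unknown $\Theta_*$ and parameters $c_q,c_x,c_\Theta,c_w>0$). For all $(C,D)\in\operatorname{supp}\mu$, $x\in\mathcal X$, $u\in\mathcal U$: $\|P_h(M_{\Theta_*,C,D})\|_2\le c_q$ for $1\le h\le H$; $\|\Theta_*\|_F\le c_\Theta$; $\mathbb E\,w_h=0$, $\mathbb E\,w_hw_h^\top=I_d$, and $\mathbb E\exp(\gamma w_{h,i})\le\exp(\gamma^2c_w^2/2)$ for all $\gamma\in\mathbb R$, $i\le d$, $2\le h\le H$; $\|Cx\|_2^2+\|Du\|_2^2\le c_x^2$ and $\|x\|_2^2+\|u\|_2^2\le c_x^2$; $K_h(M_{\Theta_*,C,D})x\in\mathcal U$ for $h<H$; and $M_{\Theta_*,C,D}\begin{bmatrix}x\\u\end{bmatrix}+w_{h+1}\in\mathcal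 X$ almost surely for $h<H$. **Algorithm** (input $\delta\in(0,1)$, $K$). In episode $k=1,\dots,K$ a context $(C^{(k)},D^{(k)})\sim\mu$ is observed, independent of the other episodes and of the noise. Let $V^{(k)}=I+\sum_{k'<k}\sum_{h<H}z_h^{(k')}z_h^{(k')\top}$, $\Theta^{(k)}=\big((V^{(k)})^{-1}\sum_{k'<k}\sum_{h<H}z_h^{(k')}x_{h+1}^{(k')\top}\big)^\top$, where $z_h^{(k)}=\begin{bmatrix}C^{(k)}x^{(k)}_h\\D^{(k)}u^{(k)}_h\end{bmatrix}$, and with $n=p+p'$ $$\beta^{(k)}=\Big(c_\Theta+c_w\sqrt{2d\big(\log d+\tfrac n2\log(1+kHc_x^2/n)+\log\delta^{-1}\big)}\Big)^2,$$ $$\mathcal C^{(k)}=\Big\{\Theta:\operatorname{tr}\big[(\Theta-\Theta^{(k)})V^{(k)}(\Theta-\Theta^{(k)})^\top\big]\le\beta^{(k)},\ \|P_h(M_{\Theta,C,D})\|_2\le c_q\ \ \forall h\le H,\ (C,D)\in\operatorname{supp}\mu\Big\}.$$ On the basis of the past episodes and the present context the algorithm chooses $\widetilde\Theta^{(k)}\in\arg\min_{\Theta\in\mathcal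 C^{(k)}}\big(x_1^\top P_1(M_{\Theta,C^{(k)},D^{(k)}})x_1+C_1(M_{\Theta,C^{(k)},D^{(k)}})\big)$ (an arbitrary decoder if $\mathcal C^{(k)}=\emptyset$) and plays one trajectory from $x_1$ of the policy $\widetilde\pi^{(k)}_h(x)=K_h(M_{\widetilde\Theta^{(k)},C^{(k)},D^{(k)}})x$ in the game $M_{\Theta_*,C^{(k)},D^{(k)}}$. These are policies of the game, that is, almost surely they map $\mathcal X$ into $\mathcal U$. **Claim.** There is a polynomial in five variables, the same for all such problems, whose value $c_H'$ at $(H,c_q,c_x,c_\Theta,c_w)$ satisfies: for every $K$ and $\delta\in(0,1)$, with probability at least $1-\delta$ the costs below are finite and $$\mathrm{Regret}(KH)=\sum_{k=1}^K\Big(J_1^{\widetilde\pi^{(k)}}(M_{\Theta_*,C^{(k)},D^{(k)}},x_1)-J_1^*(M_{\Theta_*,C^{(k)},D^{(k)}},x_1)\Big)\le c_H'\,d^{1/2}(p+p')\log^{3/2}\!\big(dKHc_x\delta^{-1}\big)\sqrt{KH}.$$ -/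

import Mathlib

open MeasureTheory ProbabilityTheory
open scoped Matrix ENNReal

noncomputable section

namespace ContextualLQR

/-- Real matrices carry the product (equivalently, Borel) measurable structure. -/
instance instMeasurableSpaceMatrix (m n : Type*) : MeasurableSpace (Matrix m n ℝ) :=
  inferInstanceAs (MeasurableSpace (m → n → ℝ))

/-- Coordinate vectors. The squared Euclidean norm of `v` is `v ⬝ᵥ v`. -/
abbrev Vec (n : ℕ) := Fin n → ℝ

/-- A representation `[A, B]` of a linear system with state dimension `d` and action dimension `m`. -/
abbrev System (d m : ℕ) := Matrix (Fin d) (Fin d ⊕ Fin m) ℝ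

/-- A decoding matrix, acting on contexts with `p` and `q` rows. -/
abbrev Decoder (d p q : ℕ) := Matrix (Fin d) (Fin p ⊕ Fin q) ℝ

/-- A context: a pair `(C, D)`. -/
abbrev Context (d m p q : ℕ) := Matrix (Fin p) (Fin d) ℝ × Matrix (Fin q) (Fin m) ℝ

/-- The block matrix `[[C, 0], [0, D]]`. -/
def blockContext {d m p q : ℕ} (c : Context d m p q) :
    Matrix (Fin p ⊕ Fin q) (Fin d ⊕ Fin m) ℝ :=
  Matrix.fromBlocks c.1 0 0 c.2

/-- The system `M_{Θ,C,D} = Θ * [[C, 0], [0, D]]` decoded from a context. -/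
def decode {d m p q : ℕ} (Θ : Decoder d p q) (c : Context d m p q) : System d m :=
  Θ * blockContext c

/-- The spectral norm of a square matrix (operator norm for the Euclidean norm). -/
def spectralNorm {n : ℕ} (P : Matrix (Fin n) (Fin n) ℝ) : ℝ :=
  ‖Matrix.toEuclideanCLM (𝕜 := ℝ) P‖

/-- The Frobenius norm. -/
def frobeniusNorm {m n : Type*} [Fintype m] [Fintype n] (A : Matrix m n ℝ) : ℝ :=
  Real.sqrt (∑ i, ∑ j, A i j ^ 2)

/-- The data of a family of finite-horizon LQR games decoded from contexts. The `H` stages are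
numbered `0, …, H - 1`; an action is played at every stage `h` with `h + 1 < H`, and stage `H - 1`
is terminal. -/
structure Model (d m p q H : ℕ) where
  /-- state cost matrices (`Q (H - 1)` is the terminal one) -/
  Q : ℕ → Matrix (Fin d) (Fin d) ℝ
  /-- action cost matrices -/
  R : ℕ → Matrix (Fin m) (Fin m) ℝ
  /-- state space -/
  X : Set (Vec d)
  /-- action space -/
  U : Set (Vec m)
  /-- initial state -/
  xinit : Vec d
  /-- `noiseLaw h` is the law of the noise that enters the transition from stage `h` to `h + 1` -/
  noiseLaw : Fin (H - 1) → Measure (Vec d)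
  /-- law of the contexts -/
  contextLaw : Measure (Context d m p q)
  /-- the true decoding matrix -/
  Θstar : Decoder d p q

/-- A (history-dependent) policy: it maps the stage `h`, the past state-action pairs and the
present state to an action. -/
abbrev Policy (d m : ℕ) := (h : ℕ) → (Fin h → Vec d × Vec m) → Vec d → Vec m

/-- The past state-action pairs and the present state at stage `h`, when `π` is played from `x₁`
in the system `M = [A, B]` with noise `w`: the next state is `A x + B u + w h`. -/
def rollout {d m : ℕ} (M : System d m) (π : Policy d m) (x₁ : Vec d) (w : ℕ → Vec d) :
    (h : ℕ) → (Fin h → Vec d × Vec m) × Vec d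
  | 0 => (Fin.elim0, x₁)
  | h + 1 =>
    let past := (rollout M π x₁ w h).1
    let x := (rollout M π x₁ w h).2
    let u := π h past x
    (Fin.snoc past (x, u), M *ᵥ Sum.elim x u + w h)

/-- The state at stage `h`. -/
def stateAt {d m : ℕ} (M : System d m) (π : Policy d m) (x₁ : Vec d) (w : ℕ → Vec d) (h : ℕ) :
    Vec d :=
  (rollout M π x₁ w h).2

/-- The action at stage `h`. -/
def actionAt {d m : ℕ} (M : System d m) (π : Policy d m) (x₁ : Vec d) (w : ℕ → Vec d) (h : ℕ) :
    Vec m :=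
  π h (rollout M π x₁ w h).1 (rollout M π x₁ w h).2

/-- Indexing the `H - 1` noise vectors of an episode by all natural numbers (only the indices
below `H - 1` are ever used). -/
def extendNoise {d H : ℕ} (w : Fin (H - 1) → Vec d) (h : ℕ) : Vec d :=
  if hh : h < H - 1 then w ⟨h, hh⟩ else 0

namespace Model

variable {d m p q H : ℕ} (S : Model d m p q H)

/-- The Riccati matrices `P_h(M)`. -/
def riccati (M : System d m) (h : ℕ) : Matrix (Fin d) (Fin d) ℝ :=
  if h + 1 < H then
    let A := M.toCols₁
    let B := M.toCols₂
    let P := riccati M (h + 1)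
    S.Q h + Aᵀ * P * A - Aᵀ * P * B * (S.R h + Bᵀ * P * B)⁻¹ * Bᵀ * P * A
  else S.Q (H - 1)
termination_by H - h

/-- The constants `C_h(M)`. -/
def riccatiConst (M : System d m) (h : ℕ) : ℝ :=
  if hh : h + 1 < H then
    riccatiConst M (h + 1) +
      ∫ w, w ⬝ᵥ (S.riccati M (h + 1) *ᵥ w) ∂(S.noiseLaw ⟨h, by omega⟩)
  else 0
termination_by H - h

/-- The feedback matrices `K_h(M)`. -/
def gain (M : System d m) (h : ℕ) : Matrix (Fin m) (Fin d) ℝ :=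
  let A := M.toCols₁
  let B := M.toCols₂
  let P := S.riccati M (h + 1);
  -((S.R h + Bᵀ * P * B)⁻¹ * Bᵀ * P * A)

/-- The linear policy `x ↦ K_h(M) x`. -/
def linearPolicy (M : System d m) : Policy d m := fun h _ x => S.gain M h *ᵥ x

/-- The optimal value given by the Riccati recursion, `xᵀ P_h(M) x + C_h(M)`. -/
def riccatiValue (M : System d m) (h : ℕ) (x : Vec d) : ℝ :=
  x ⬝ᵥ (S.riccati M h *ᵥ x) + S.riccatiConst M h

/-- Total cost of one trajectory. -/
def trajectoryCost (M : System d m) (π : Policy d m) (x₁ : Vec d) (w : ℕ → Vec d) : ℝ :=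
  (∑ h ∈ Finset.range (H - 1),
    (stateAt M π x₁ w h ⬝ᵥ (S.Q h *ᵥ stateAt M π x₁ w h) +
      actionAt M π x₁ w h ⬝ᵥ (S.R h *ᵥ actionAt M π x₁ w h))) +
    stateAt M π x₁ w (H - 1) ⬝ᵥ (S.Q (H - 1) *ᵥ stateAt M π x₁ w (H - 1))

/-- The expected total cost `J₁^π(M, x₁)`, the noise vectors of the different stages being
independent. Costs are nonnegative, so the expectation exists in `[0, ∞]`. -/
def policyCost (M : System d m) (π : Policy d m) (x₁ : Vec d) : ℝ≥0∞ :=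
  ∫⁻ w, ENNReal.ofReal (S.trajectoryCost M π x₁ (extendNoise w)) ∂(Measure.pi S.noiseLaw)

/-- `π` is a policy of the game: it is measurable, and it takes its values in the action space on
histories made of states in the state space and actions in the action space. -/
structure IsPolicy (π : Policy d m) : Prop where
  measurable : ∀ h, h + 1 < H →
    Measurable fun a : (Fin h → Vec d × Vec m) × Vec d => π h a.1 a.2
  mapsTo : ∀ h, h + 1 < H → ∀ past : Fin h → Vec d × Vec m,
    (∀ i, (past i).1 ∈ S.X ∧ (past i).2 ∈ S.U) → ∀ x ∈ S.X, π h past x ∈ S.U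

/-- The optimal expected total cost `J₁^*(M, x₁)`, an infimum over all policies of the game. -/
def optimalCost (M : System d m) (x₁ : Vec d) : ℝ≥0∞ :=
  ⨅ (π : Policy d m) (_ : S.IsPolicy π), S.policyCost M π x₁

/-- The standing assumptions, with parameters `cq`, `cx`, `cΘ`, `cw`. -/
structure Assumptions (cq cx cΘ cw : ℝ) : Prop where
  Q_posDef : ∀ h, h + 1 < H → (S.Q h).PosDef
  Q_terminal : (S.Q (H - 1)).PosSemidef
  R_posDef : ∀ h, h + 1 < H → (S.R h).PosDef
  measurableSet_X : MeasurableSet S.X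
  isClosed_U : IsClosed S.U
  xinit_mem : S.xinit ∈ S.X
  prob_context : IsProbabilityMeasure S.contextLaw
  prob_noise : ∀ h, IsProbabilityMeasure (S.noiseLaw h)
  /-- the noise has mean zero and covariance the identity -/
  noise_mean : ∀ h i, ∫ w, w i ∂(S.noiseLaw h) = 0
  noise_cov : ∀ h i j, ∫ w, w i * w j ∂(S.noiseLaw h) = if i = j then 1 else 0
  /-- every coordinate of the noise is sub-Gaussian: `E exp (γ wᵢ) ≤ exp (γ² cw² / 2)` -/
  noise_subGaussian : ∀ h i,
    HasSubgaussianMGF (fun w : Vec d => w i) (Real.toNNReal (cw ^ 2)) (S.noiseLaw h)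
  /-- the state space is a state space: playing an action leads to a state, almost surely -/
  state_mem : ∀ c ∈ S.contextLaw.support, ∀ x ∈ S.X, ∀ u ∈ S.U, ∀ h,
    ∀ᵐ w ∂(S.noiseLaw h), decode S.Θstar c *ᵥ Sum.elim x u + w ∈ S.X
  riccati_le : ∀ c ∈ S.contextLaw.support, ∀ h, h < H →
    spectralNorm (S.riccati (decode S.Θstar c) h) ≤ cq
  Θstar_le : frobeniusNorm S.Θstar ≤ cΘ
  context_le : ∀ c ∈ S.contextLaw.support, ∀ x ∈ S.X, ∀ u ∈ S.U,
    (c.1 *ᵥ x) ⬝ᵥ (c.1 *ᵥ x) + (c.2 *ᵥ u) ⬝ᵥ (c.2 *ᵥ u) ≤ cx ^ 2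
  state_action_le : ∀ x ∈ S.X, ∀ u ∈ S.U, x ⬝ᵥ x + u ⬝ᵥ u ≤ cx ^ 2
  gain_mem : ∀ c ∈ S.contextLaw.support, ∀ x ∈ S.X, ∀ h, h + 1 < H →
    S.gain (decode S.Θstar c) h *ᵥ x ∈ S.U

end Model

/-- The random objects of a run: in episode `k = 0, 1, …`, the context `ctx k`, the noise vectors
`noise k`, and the optimistic decoder `Θopt k`. -/
structure Run (d m p q H : ℕ) (Ω : Type*) where
  ctx : ℕ → Ω → Context d m p q
  noise : ℕ → Ω → Fin (H - 1) → Vec d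
  Θopt : ℕ → Ω → Decoder d p q

namespace Run

variable {d m p q H : ℕ} {Ω : Type*} (r : Run d m p q H Ω) (S : Model d m p q H)

/-- The policy `x ↦ K_h(M_{Θopt k, C, D}) x` played in episode `k`. -/
def policy (k : ℕ) (ω : Ω) : Policy d m := S.linearPolicy (decode (r.Θopt k ω) (r.ctx k ω))

/-- The true system of episode `k`. -/
def system (k : ℕ) (ω : Ω) : System d m := decode S.Θstar (r.ctx k ω)

/-- The state at stage `h` of episode `k`. -/
def state (k h : ℕ) (ω : Ω) : Vec d :=
  stateAt (r.system S k ω) (r.policy S k ω) S.xinit (extendNoise (r.noise k ω)) h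

/-- The action at stage `h` of episode `k`. -/
def action (k h : ℕ) (ω : Ω) : Vec m :=
  actionAt (r.system S k ω) (r.policy S k ω) S.xinit (extendNoise (r.noise k ω)) h

/-- The observation `z = (C x, D u)` at stage `h` of episode `k`. -/
def obs (k h : ℕ) (ω : Ω) : Fin p ⊕ Fin q → ℝ :=
  Sum.elim ((r.ctx k ω).1 *ᵥ r.state S k h ω) ((r.ctx k ω).2 *ᵥ r.action S k h ω)

/-- `V = I + ∑ z zᵀ` over all stages of the episodes before `k`. -/
def V (k : ℕ) (ω : Ω) : Matrix (Fin p ⊕ Fin q) (Fin p ⊕ Fin q) ℝ :=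
  1 + ∑ j ∈ Finset.range k, ∑ h ∈ Finset.range (H - 1),
    Matrix.vecMulVec (r.obs S j h ω) (r.obs S j h ω)

/-- `W = ∑ z x'ᵀ`, with `x'` the next state, over all stages of the episodes before `k`. -/
def W (k : ℕ) (ω : Ω) : Matrix (Fin p ⊕ Fin q) (Fin d) ℝ :=
  ∑ j ∈ Finset.range k, ∑ h ∈ Finset.range (H - 1),
    Matrix.vecMulVec (r.obs S j h ω) (r.state S j (h + 1) ω)

/-- The ridge regression estimate `(V⁻¹ W)ᵀ` available at the start of episode `k`. -/
def ridge (k : ℕ) (ω : Ω) : Decoder d p q := ((r.V S k ω)⁻¹ * r.W S k ω)ᵀ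

end Run

/-- The squared radius of the confidence ellipsoid in episode `k = 0, 1, …` (the `(k + 1)`-st
episode); `n` is the number of rows of a context. -/
def radius (d n H : ℕ) (cx cΘ cw δ : ℝ) (k : ℕ) : ℝ :=
  (cΘ + cw * Real.sqrt (2 * d * (Real.log d +
    n * Real.log (1 + (k + 1) * H * cx ^ 2 / n) / 2 + Real.log δ⁻¹))) ^ 2

namespace Run

variable {d m p q H : ℕ} {Ω : Type*} (r : Run d m p q H Ω) (S : Model d m p q H)

/-- The confidence set of episode `k`. -/
def confidenceSet (cq cx cΘ cw δ : ℝ) (k : ℕ) (ω : Ω) : Set (Decoder d p q) :=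
  {Θ | ((Θ - r.ridge S k ω) * r.V S k ω * (Θ - r.ridge S k ω)ᵀ).trace ≤
        radius d (p + q) H cx cΘ cw δ k ∧
      ∀ h, h < H → ∀ c ∈ S.contextLaw.support, spectralNorm (S.riccati (decode Θ c) h) ≤ cq}

variable [MeasurableSpace Ω]

/-- What is known when the decoder of episode `k` is chosen: the earlier episodes and the context
of episode `k`. -/
@[reducible] def knowledge (k : ℕ) : MeasurableSpace Ω :=
  (⨆ j ∈ Finset.range k,
    (MeasurableSpace.comap (fun ω => (r.ctx j ω, r.noise j ω)) inferInstance)) ⊔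
    MeasurableSpace.comap (r.ctx k) inferInstance

/-- `r` is a run of the optimistic algorithm for `K` episodes, on the probability space `(Ω, Pr)`. -/
structure IsAlgorithmRun (cq cx cΘ cw δ : ℝ) (K : ℕ) (Pr : Measure Ω) : Prop where
  measurable_ctx : ∀ k < K, Measurable (r.ctx k)
  measurable_noise : ∀ k < K, Measurable (r.noise k)
  /-- in every episode the context has law `contextLaw`, and the noise vectors are independent of
  it and of each other, with the prescribed laws -/
  law : ∀ k < K, Pr.map (fun ω => (r.ctx k ω, r.noise k ω)) =
    S.contextLaw.prod (Measure.pi S.noiseLaw)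
  /-- the episodes are independent -/
  indep : iIndepFun (fun (k : Fin K) ω => (r.ctx k ω, r.noise k ω)) Pr
  /-- the decoder is chosen on the basis of the past and the present context -/
  nonanticipating : ∀ k < K, Measurable[r.knowledge k] (r.Θopt k)
  /-- the decoder minimizes the optimal cost over the confidence set (there is nothing to minimize
  over in the exceptional case that this set is empty) -/
  optimistic : ∀ k < K, ∀ᵐ ω ∂Pr, (r.confidenceSet S cq cx cΘ cw δ k ω).Nonempty →
    r.Θopt k ω ∈ r.confidenceSet S cq cx cΘ cw δ k ω ∧
    ∀ Θ ∈ r.confidenceSet S cq cx cΘ cw δ k ω,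
      S.riccatiValue (decode (r.Θopt k ω) (r.ctx k ω)) 0 S.xinit ≤
        S.riccatiValue (decode Θ (r.ctx k ω)) 0 S.xinit
  /-- what is played is a policy of the game: its actions lie in the action space -/
  isPolicy : ∀ k < K, ∀ᵐ ω ∂Pr, S.IsPolicy (r.policy S k ω)

/-- The regret over `K` episodes: the sum of `J₁^π(M, x₁) - J₁^*(M, x₁)` over the episodes, where
`π` is the policy played and `M` the true system of the episode. -/
def regret (K : ℕ) (ω : Ω) : ℝ :=
  ∑ k ∈ Finset.range K,
    ((S.policyCost (r.system S k ω) (r.policy S k ω) S.xinit).toReal -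
      (S.optimalCost (r.system S k ω) S.xinit).toReal)

end Run

end ContextualLQR

end

/-! The proof is optimism in the face of uncertainty, run once per episode.

Completing the square in the action (`cost_add_eq`) turns the Riccati recursion into an exact
accounting: for every comparison system `M`, the cost of a policy in the true game is the value
function of `M` at the initial state plus the expected one-step excesses along the trajectory
(`policyCost_eq`). With `M` the true system the excesses are nonnegative, so the Riccati value
bounds the optimal cost from below, over all history-dependent policies
(`riccatiValue_le_optimalCost`). With `M` the optimistic system, whose value is at most the true
one, the regret of the episode is at most the sum of the excesses. For the linear policy of `M` such
an excess is a difference of two values of the form `P_{h+1}(M)`, at the next mean states of the two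
systems; it is at most `2 cq cx` times the length of `(Θ⋆ - Θ) z` (`excess_gain_le`). If both
decoders lie in the ellipsoid of radius `B`, that length is at most `2 B` times the square root of
`z ⬝ᵥ V⁻¹ z`. The root is removed by `2 √a ≤ t a + 1 / t` with one `t` for the whole run
(`episode_regret_le`), so only the sum of the expected widths of the episodes is needed.

Three probabilistic or determinantal facts supply it. The true decoder stays in the confidence sets:
a one-dimensional Gaussian mixture, combined with the Sherman–Morrison formula and the matrix
determinant lemma, makes the exponential of the self-normalized noise sum divided by `√(det V)` a
supermartingale (`lintegral_expSelfNormalized_le`), and Ville's inequality is applied to the sum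
over the `d` coordinates. Expected widths are at most twice the realized ones plus a logarithmic
term, by a second exponential supermartingale (`lintegral_exp_neg_width_le`). Realized widths sum to
a logarithm of `det V`, although `V` is frozen during an episode (`sum_width_le`).

The radius allows for failure probability `δ` of the first event alone. It also counts `(k + 1) H`
observations where only `k (H - 1)` have been made, and this excess pays for the second event
(`slack_mul_pow_le`). -/

namespace ContextualLQR

/-! ### Quadratic forms, rank-one updates and determinants. -/

section LinearAlgebra

variable {n : Type*} [Fintype n]

lemma _root_.Matrix.PosSemidef.dot_nonneg {V : Matrix n n ℝ} (hV : V.PosSemidef) (x : n → ℝ) :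
    0 ≤ x ⬝ᵥ (V *ᵥ x) := by
  simpa using hV.dotProduct_mulVec_nonneg x

lemma _root_.Matrix.IsHermitian.dot_comm {V : Matrix n n ℝ} (hV : V.IsHermitian) (x y : n → ℝ) :
    x ⬝ᵥ (V *ᵥ y) = y ⬝ᵥ (V *ᵥ x) := by
  have h : Vᵀ = V := by simpa [Matrix.IsHermitian] using hV
  rw [Matrix.dotProduct_mulVec, ← Matrix.mulVec_transpose, h, dotProduct_comm]

lemma posSemidef_of_dot {V : Matrix n n ℝ} (h1 : Vᵀ = V) (h2 : ∀ x, 0 ≤ x ⬝ᵥ (V *ᵥ x)) :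
    V.PosSemidef :=
  Matrix.PosSemidef.of_dotProduct_mulVec_nonneg (by simpa [Matrix.IsHermitian] using h1)
    (by simpa using h2)

lemma posSemidef_vecMulVec (z : n → ℝ) : (Matrix.vecMulVec z z).PosSemidef := by
  simpa using Matrix.posSemidef_vecMulVec_self_star (R := ℝ) z

lemma trace_mul_mul_transpose {k : Type*} [Fintype k] (Δ : Matrix k n ℝ) (V : Matrix n n ℝ) :
    (Δ * V * Δᵀ).trace = ∑ i, Δ i ⬝ᵥ (V *ᵥ Δ i) := by
  simp only [Matrix.trace, Matrix.diag_apply, Matrix.mul_apply, Matrix.transpose_apply, dotProduct,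
    Matrix.mulVec, Finset.mul_sum, Finset.sum_mul]
  refine Finset.sum_congr rfl fun i _ => ?_
  rw [Finset.sum_comm]
  exact Finset.sum_congr rfl fun x _ => Finset.sum_congr rfl fun y _ => by ring

/-- Expand the form at `t • x + y` and divide by `t`. The free weight `t` lets sums of such
inequalities recover the triangle inequality for the trace norm. -/
lemma dot_sub_le {V : Matrix n n ℝ} (hV : V.PosSemidef) {t : ℝ} (ht : 0 < t) (x y : n → ℝ) :
    (x - y) ⬝ᵥ (V *ᵥ (x - y)) ≤ (1 + t) * (x ⬝ᵥ (V *ᵥ x)) + (1 + t⁻¹) * (y ⬝ᵥ (V *ᵥ y)) := by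
  have h := hV.dot_nonneg (t • x + y)
  have hc := hV.isHermitian.dot_comm x y
  simp only [Matrix.mulVec_sub, Matrix.mulVec_add, Matrix.mulVec_smul, dotProduct_sub,
    dotProduct_add, sub_dotProduct, add_dotProduct, smul_dotProduct, dotProduct_smul,
    smul_eq_mul] at h ⊢
  rw [hc] at h ⊢
  have : 0 ≤ t⁻¹ * (t * (t * (x ⬝ᵥ V *ᵥ x) + y ⬝ᵥ V *ᵥ x) + (t * (y ⬝ᵥ V *ᵥ x) + y ⬝ᵥ V *ᵥ y)) := by
    have := inv_pos.2 ht
    refine mul_nonneg this.le (by linarith)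
  have e : t⁻¹ * (t * (t * (x ⬝ᵥ V *ᵥ x) + y ⬝ᵥ V *ᵥ x) + (t * (y ⬝ᵥ V *ᵥ x) + y ⬝ᵥ V *ᵥ y)) =
      t * (x ⬝ᵥ V *ᵥ x) + 2 * (y ⬝ᵥ V *ᵥ x) + t⁻¹ * (y ⬝ᵥ V *ᵥ y) := by
    field_simp; ring
  rw [e] at this
  linarith

variable [DecidableEq n]

lemma _root_.Matrix.PosDef.mulVec_inv_mulVec {V : Matrix n n ℝ} (hV : V.PosDef) (x : n → ℝ) :
    V *ᵥ (V⁻¹ *ᵥ x) = x := by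
  rw [Matrix.mulVec_mulVec, Matrix.mul_nonsing_inv _ ((Matrix.isUnit_iff_isUnit_det _).1 hV.isUnit),
    Matrix.one_mulVec]

lemma _root_.Matrix.PosDef.inv_mulVec_mulVec {V : Matrix n n ℝ} (hV : V.PosDef) (x : n → ℝ) :
    V⁻¹ *ᵥ (V *ᵥ x) = x := by
  rw [Matrix.mulVec_mulVec, Matrix.nonsing_inv_mul _ ((Matrix.isUnit_iff_isUnit_det _).1 hV.isUnit),
    Matrix.one_mulVec]

/-- The Sherman–Morrison formula, for quadratic forms. -/
lemma dot_inv_add_vecMulVec {V : Matrix n n ℝ} (hV : V.PosDef) (z s : n → ℝ) :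
    s ⬝ᵥ ((V + Matrix.vecMulVec z z)⁻¹ *ᵥ s) =
      s ⬝ᵥ (V⁻¹ *ᵥ s) - (z ⬝ᵥ (V⁻¹ *ᵥ s)) ^ 2 / (1 + z ⬝ᵥ (V⁻¹ *ᵥ z)) := by
  have hV' : (V + Matrix.vecMulVec z z).PosDef := hV.add_posSemidef (posSemidef_vecMulVec z)
  have ha : 0 ≤ z ⬝ᵥ (V⁻¹ *ᵥ z) := hV.inv.posSemidef.dot_nonneg z
  have hc := hV.inv.isHermitian.dot_comm s z
  set a := z ⬝ᵥ (V⁻¹ *ᵥ z)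
  set b := z ⬝ᵥ (V⁻¹ *ᵥ s)
  -- The updated matrix is never inverted: the solution of the updated linear system is exhibited
  -- and checked.
  have key : (V + Matrix.vecMulVec z z) *ᵥ (V⁻¹ *ᵥ s - (b / (1 + a)) • (V⁻¹ *ᵥ z)) = s := by
    rw [Matrix.mulVec_sub, Matrix.mulVec_smul, Matrix.add_mulVec, Matrix.add_mulVec,
      hV.mulVec_inv_mulVec, hV.mulVec_inv_mulVec, Matrix.vecMulVec_mulVec, Matrix.vecMulVec_mulVec]
    have h1 : b - b / (1 + a) * (1 + a) = 0 := by field_simp; ring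
    ext i
    simp only [Pi.add_apply, Pi.sub_apply, Pi.smul_apply, smul_eq_mul, MulOpposite.smul_eq_mul_unop,
      MulOpposite.unop_op]
    change s i + z i * b - (b / (1 + a)) * (z i + z i * a) = s i
    linear_combination z i * h1
  have : (V + Matrix.vecMulVec z z)⁻¹ *ᵥ s = V⁻¹ *ᵥ s - (b / (1 + a)) • (V⁻¹ *ᵥ z) := by
    conv_lhs => rw [← key]
    exact hV'.inv_mulVec_mulVec _
  rw [this, dotProduct_sub, dotProduct_smul, hc, smul_eq_mul]
  ring

lemma det_add_vecMulVec {V : Matrix n n ℝ} (hV : V.PosDef) (z : n → ℝ) :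
    (V + Matrix.vecMulVec z z).det = V.det * (1 + z ⬝ᵥ (V⁻¹ *ᵥ z)) := by
  have hu : IsUnit V.det := (Matrix.isUnit_iff_isUnit_det _).1 hV.isUnit
  have h : Matrix.vecMulVec z z = Matrix.replicateCol Unit z * Matrix.replicateRow Unit z := by
    ext i j
    simp [Matrix.vecMulVec_apply, Matrix.mul_apply]
  rw [h, Matrix.det_add_replicateCol_mul_replicateRow hu,
    Matrix.det_unique (1 + _ : Matrix Unit Unit ℝ)]
  simp only [Matrix.add_apply, Matrix.one_apply_eq, Matrix.mul_assoc]
  rfl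

lemma one_add_sum_le_prod_one_add {ι : Type*} (s : Finset ι) {f : ι → ℝ} (hf : ∀ i, 0 ≤ f i) :
    1 + ∑ i ∈ s, f i ≤ ∏ i ∈ s, (1 + f i) := by
  classical
  induction s using Finset.induction_on with
  | empty => simp
  | insert a s ha ih =>
    rw [Finset.sum_insert ha, Finset.prod_insert ha]
    nlinarith [hf a, mul_nonneg (hf a) (Finset.sum_nonneg fun i (_ : i ∈ s) => hf i)]

/-- The eigenvalues of `1 + N` are at least `1`, so their product dominates the linear part of its
expansion around `1`. -/
lemma one_add_trace_le_det_one_add {N : Matrix n n ℝ} (hN : N.PosSemidef) :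
    1 + N.trace ≤ (1 + N).det := by
  have hH : (1 + N).IsHermitian := (Matrix.PosDef.one.add_posSemidef hN).isHermitian
  have h1 : ∀ i, 1 ≤ hH.eigenvalues i := by
    intro i
    have hv : (hH.eigenvectorBasis i : n → ℝ) ⬝ᵥ (hH.eigenvectorBasis i : n → ℝ) = 1 := by
      have h := EuclideanSpace.real_norm_sq_eq (hH.eigenvectorBasis i)
      rw [hH.eigenvectorBasis.orthonormal.1 i] at h
      simp only [dotProduct, ← sq]
      rw [← h]; norm_num
    have h := hH.eigenvalues_eq i
    have h2 := hN.dot_nonneg (hH.eigenvectorBasis i)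
    simp only [Matrix.add_mulVec, Matrix.one_mulVec, dotProduct_add, star_trivial, RCLike.re_to_real]
      at h
    rw [h, hv]
    linarith
  have hd : (1 + N).det = ∏ i, hH.eigenvalues i := by
    simpa using hH.det_eq_prod_eigenvalues
  have ht : (1 + N).trace = ∑ i, hH.eigenvalues i := by
    simpa using hH.trace_eq_sum_eigenvalues
  have h := one_add_sum_le_prod_one_add Finset.univ (f := fun i => hH.eigenvalues i - 1)
    (fun i => sub_nonneg.2 (h1 i))
  simp only [add_sub_cancel, Finset.sum_sub_distrib, ← ht, ← hd] at h
  simp only [Matrix.trace_add, Matrix.trace_one, Finset.sum_const, Finset.card_univ,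
    nsmul_eq_mul, mul_one] at h
  linarith

/-- The inequality of arithmetic and geometric means for the eigenvalues. -/
lemma det_le_trace_div_pow [Nonempty n] {V : Matrix n n ℝ} (hV : V.PosSemidef) :
    V.det ≤ (V.trace / Fintype.card n) ^ Fintype.card n := by
  have hd : V.det = ∏ i, hV.isHermitian.eigenvalues i := by
    simpa using hV.isHermitian.det_eq_prod_eigenvalues
  have ht : V.trace = ∑ i, hV.isHermitian.eigenvalues i := by
    simpa using hV.isHermitian.trace_eq_sum_eigenvalues
  have h := Real.geom_mean_le_arith_mean Finset.univ (fun _ : n => (1 : ℝ))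
    hV.isHermitian.eigenvalues (by simp) (by simp [Fintype.card_pos])
    (fun i _ => hV.eigenvalues_nonneg i)
  simp only [Real.rpow_one, Finset.sum_const, Finset.card_univ, nsmul_eq_mul, mul_one, one_mul,
    ← hd, ← ht] at h
  have h0 : 0 ≤ V.det := by
    rw [hd]; exact Finset.prod_nonneg fun i _ => hV.eigenvalues_nonneg i
  calc V.det = (V.det ^ ((Fintype.card n : ℝ)⁻¹)) ^ Fintype.card n :=
        (Real.rpow_inv_natCast_pow h0 Fintype.card_ne_zero).symm
    _ ≤ _ := pow_le_pow_left₀ (Real.rpow_nonneg h0 _) h _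

/-- The determinant of a matrix grows at least linearly in the total size of the added rank-one
matrices. -/
lemma det_mul_one_add_sum_le {V : Matrix n n ℝ} (hV : V.PosDef) {k : ℕ} (z : Fin k → n → ℝ) :
    V.det * (1 + ∑ i, z i ⬝ᵥ (V⁻¹ *ᵥ z i)) ≤ (V + ∑ i, Matrix.vecMulVec (z i) (z i)).det := by
  have hu : IsUnit V.det := (Matrix.isUnit_iff_isUnit_det _).1 hV.isUnit
  let Z : Matrix (Fin k) n ℝ := Matrix.of z
  have h : ∑ i, Matrix.vecMulVec (z i) (z i) = Zᵀ * Z := by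
    ext i j
    simp [Matrix.vecMulVec_apply, Matrix.mul_apply, Matrix.sum_apply, Z]
  have hN : (Z * V⁻¹ * Zᵀ).PosSemidef := by
    simpa using hV.inv.posSemidef.mul_mul_conjTranspose_same Z
  have ht : (Z * V⁻¹ * Zᵀ).trace = ∑ i, z i ⬝ᵥ (V⁻¹ *ᵥ z i) := by
    refine Finset.sum_congr rfl fun i _ => ?_
    rw [Matrix.diag_apply, Matrix.mul_assoc]
    rw [Matrix.mul_apply]
    rfl
  -- With the vectors as rows of `Z`, `det (V + Zᵀ Z) = det V * det (1 + Z V⁻¹ Zᵀ)`.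
  rw [h, Matrix.det_add_mul _ _ hu, ← ht]
  exact mul_le_mul_of_nonneg_left (one_add_trace_le_det_one_add hN) hV.posSemidef.det_nonneg

/-- The Cauchy–Schwarz inequality for the norms given by `V` and by its inverse. -/
lemma dot_sq_le_mul_inv {V : Matrix n n ℝ} (hV : V.PosDef) (a z : n → ℝ) :
    (a ⬝ᵥ z) ^ 2 ≤ (a ⬝ᵥ (V *ᵥ a)) * (z ⬝ᵥ (V⁻¹ *ᵥ z)) := by
  -- This is the form `V` at `t • a + V⁻¹ z`; its discriminant in `t` is the claim.
  have h : ∀ t : ℝ, 0 ≤ (a ⬝ᵥ (V *ᵥ a)) * (t * t) + (2 * (a ⬝ᵥ z)) * t + z ⬝ᵥ (V⁻¹ *ᵥ z) := by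
    intro t
    have := hV.posSemidef.dot_nonneg (t • a + V⁻¹ *ᵥ z)
    rw [Matrix.mulVec_add, Matrix.mulVec_smul, hV.mulVec_inv_mulVec] at this
    have hc := hV.isHermitian.dot_comm (V⁻¹ *ᵥ z) a
    rw [hV.mulVec_inv_mulVec] at hc
    simp only [add_dotProduct, dotProduct_add, smul_dotProduct, dotProduct_smul, smul_eq_mul] at this
    rw [hc, dotProduct_comm (V⁻¹ *ᵥ z) z] at this
    linarith
  have := discrim_le_zero h
  rw [discrim] at this
  nlinarith

/-- Inversion reverses the order `1 ≤ V`: with `y = V⁻¹ z` one has `y ⬝ᵥ y ≤ z ⬝ᵥ y`, and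
Cauchy–Schwarz bounds `z ⬝ᵥ y`. -/
lemma dot_inv_le_dot {V : Matrix n n ℝ} (hV : V.PosDef) (h1 : ∀ x, x ⬝ᵥ x ≤ x ⬝ᵥ (V *ᵥ x))
    (z : n → ℝ) : z ⬝ᵥ (V⁻¹ *ᵥ z) ≤ z ⬝ᵥ z := by
  have h := h1 (V⁻¹ *ᵥ z)
  rw [hV.mulVec_inv_mulVec, dotProduct_comm _ z] at h
  have hcs := dot_sq_le_mul_inv (V := (1 : Matrix n n ℝ)) Matrix.PosDef.one z (V⁻¹ *ᵥ z)
  simp only [inv_one, Matrix.one_mulVec] at hcs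
  have h0 := hV.inv.posSemidef.dot_nonneg z
  have hz : 0 ≤ z ⬝ᵥ z := by simpa using Matrix.PosSemidef.one.dot_nonneg z
  by_contra! hlt
  nlinarith

/-- Cauchy–Schwarz row by row. This converts membership in the confidence ellipsoid into a
prediction error at `z`. -/
lemma mulVec_dot_le_trace_mul {k : Type*} [Fintype k] (Δ : Matrix k n ℝ) {V : Matrix n n ℝ}
    (hV : V.PosDef) (z : n → ℝ) :
    (Δ *ᵥ z) ⬝ᵥ (Δ *ᵥ z) ≤ (Δ * V * Δᵀ).trace * (z ⬝ᵥ (V⁻¹ *ᵥ z)) := by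
  rw [trace_mul_mul_transpose, Finset.sum_mul]
  refine Finset.sum_le_sum fun i _ => ?_
  rw [← sq]
  exact dot_sq_le_mul_inv hV (Δ i) z

lemma abs_dot_mulVec_le_spectralNorm {k : ℕ} (P : Matrix (Fin k) (Fin k) ℝ) (x : Vec k) :
    |x ⬝ᵥ (P *ᵥ x)| ≤ spectralNorm P * (x ⬝ᵥ x) := by
  have h1 : x ⬝ᵥ (P *ᵥ x) = inner ℝ (WithLp.toLp 2 x) (Matrix.toEuclideanCLM (𝕜 := ℝ) P (WithLp.toLp 2 x)) := by
    simp [PiLp.inner_apply, dotProduct, mul_comm]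
  have h2 : x ⬝ᵥ x = ‖(WithLp.toLp 2 x : EuclideanSpace ℝ (Fin k))‖ ^ 2 := by
    rw [EuclideanSpace.real_norm_sq_eq]; simp [dotProduct, sq]
  rw [h1, h2]
  calc _ ≤ ‖(WithLp.toLp 2 x : EuclideanSpace ℝ (Fin k))‖ * ‖Matrix.toEuclideanCLM (𝕜 := ℝ) P (WithLp.toLp 2 x)‖ :=
        abs_real_inner_le_norm _ _
    _ ≤ ‖(WithLp.toLp 2 x : EuclideanSpace ℝ (Fin k))‖ * (spectralNorm P * ‖(WithLp.toLp 2 x : EuclideanSpace ℝ (Fin k))‖) := by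
        gcongr
        exact ContinuousLinearMap.le_opNorm _ _
    _ = _ := by ring

end LinearAlgebra

end ContextualLQR

namespace ContextualLQR

/-! ### The Riccati recursion and the one-step excess. -/

namespace Model

variable {d m p q H : ℕ} {S : Model d m p q H}

lemma riccati_of_lt (M : System d m) {h : ℕ} (hh : h + 1 < H) :
    S.riccati M h = S.Q h + M.toCols₁ᵀ * S.riccati M (h + 1) * M.toCols₁ -
      M.toCols₁ᵀ * S.riccati M (h + 1) * M.toCols₂ *
        (S.R h + M.toCols₂ᵀ * S.riccati M (h + 1) * M.toCols₂)⁻¹ * M.toCols₂ᵀ *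
          S.riccati M (h + 1) * M.toCols₁ := by
  conv_lhs => rw [riccati]
  rw [if_pos hh]

lemma riccati_terminal (M : System d m) : S.riccati M (H - 1) = S.Q (H - 1) := by
  rw [riccati, if_neg (by omega)]

lemma riccatiConst_of_lt (M : System d m) {h : ℕ} (hh : h + 1 < H) :
    S.riccatiConst M h = S.riccatiConst M (h + 1) +
      ∫ w, w ⬝ᵥ (S.riccati M (h + 1) *ᵥ w) ∂(S.noiseLaw ⟨h, by omega⟩) := by
  conv_lhs => rw [riccatiConst]
  rw [dif_pos hh]

lemma riccatiConst_terminal (M : System d m) : S.riccatiConst M (H - 1) = 0 := by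
  rw [riccatiConst, dif_neg (by omega)]

/-- The matrix `R_h + Bᵀ P_{h+1} B` of the quadratic form of the action. -/
noncomputable def actionForm (S : Model d m p q H) (M : System d m) (h : ℕ) : Matrix (Fin m) (Fin m) ℝ :=
  S.R h + M.toCols₂ᵀ * S.riccati M (h + 1) * M.toCols₂

lemma mulVec_sumElim (M : System d m) (x : Vec d) (u : Vec m) :
    M *ᵥ Sum.elim x u = M.toCols₁ *ᵥ x + M.toCols₂ *ᵥ u := by
  conv_lhs => rw [← Matrix.fromCols_toCols M]
  rw [Matrix.fromCols_mulVec]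
  simp

lemma dot_transpose_mul_mul_mulVec {a b c : ℕ} (A : Matrix (Fin a) (Fin b) ℝ)
    (P : Matrix (Fin a) (Fin a) ℝ) (B : Matrix (Fin a) (Fin c) ℝ) (x : Vec b) (y : Vec c) :
    x ⬝ᵥ ((Aᵀ * P * B) *ᵥ y) = (A *ᵥ x) ⬝ᵥ (P *ᵥ (B *ᵥ y)) := by
  rw [← Matrix.mulVec_mulVec, ← Matrix.mulVec_mulVec, Matrix.dotProduct_mulVec,
    Matrix.vecMul_transpose]

/-- Completing the square in the action. -/
lemma cost_add_eq (M : System d m) {h : ℕ} (hh : h + 1 < H)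
    (hP : (S.riccati M (h + 1)).PosSemidef) (hG : (S.actionForm M h).PosDef)
    (x : Vec d) (u : Vec m) :
    x ⬝ᵥ (S.Q h *ᵥ x) + u ⬝ᵥ (S.R h *ᵥ u) +
      (M *ᵥ Sum.elim x u) ⬝ᵥ (S.riccati M (h + 1) *ᵥ (M *ᵥ Sum.elim x u)) =
    x ⬝ᵥ (S.riccati M h *ᵥ x) +
      (u - S.gain M h *ᵥ x) ⬝ᵥ (S.actionForm M h *ᵥ (u - S.gain M h *ᵥ x)) := by
  rw [mulVec_sumElim, riccati_of_lt M hh]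
  unfold gain
  set P := S.riccati M (h + 1)
  set A := M.toCols₁
  set B := M.toCols₂
  change _ = x ⬝ᵥ ((S.Q h + Aᵀ * P * A - Aᵀ * P * B * (S.actionForm M h)⁻¹ * Bᵀ * P * A) *ᵥ x) +
    (u - -((S.actionForm M h)⁻¹ * Bᵀ * P * A) *ᵥ x) ⬝ᵥ
      (S.actionForm M h *ᵥ (u - -((S.actionForm M h)⁻¹ * Bᵀ * P * A) *ᵥ x))
  have hGdef : S.actionForm M h = S.R h + Bᵀ * P * B := rfl
  set G := S.actionForm M h
  set y := (Bᵀ * P * A) *ᵥ x with hy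
  have hK : u - (-(G⁻¹ * Bᵀ * P * A)) *ᵥ x = u + G⁻¹ *ᵥ y := by
    rw [hy, Matrix.mulVec_mulVec, Matrix.neg_mulVec, sub_neg_eq_add]
    simp only [Matrix.mul_assoc]
  have h1 : x ⬝ᵥ ((Aᵀ * P * B * G⁻¹ * Bᵀ * P * A) *ᵥ x) = y ⬝ᵥ (G⁻¹ *ᵥ y) := by
    have e : Aᵀ * P * B * G⁻¹ * Bᵀ * P * A = Aᵀ * P * B * (G⁻¹ * (Bᵀ * P * A)) := by
      simp only [Matrix.mul_assoc]
    have e2 : (Aᵀ * P * B)ᵀ = Bᵀ * P * A := by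
      have : Pᵀ = P := by simpa [Matrix.IsHermitian] using hP.isHermitian
      simp only [Matrix.transpose_mul, this, Matrix.transpose_transpose, Matrix.mul_assoc]
    rw [e, ← Matrix.mulVec_mulVec x (Aᵀ * P * B), ← Matrix.mulVec_mulVec x G⁻¹,
      Matrix.dotProduct_mulVec, ← Matrix.mulVec_transpose, e2]
  have h2 : u ⬝ᵥ (G *ᵥ u) = u ⬝ᵥ (S.R h *ᵥ u) + (B *ᵥ u) ⬝ᵥ (P *ᵥ (B *ᵥ u)) := by
    rw [hGdef, Matrix.add_mulVec, dotProduct_add, dot_transpose_mul_mul_mulVec]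
  have h3 : u ⬝ᵥ y = (B *ᵥ u) ⬝ᵥ (P *ᵥ (A *ᵥ x)) := by
    rw [hy, dot_transpose_mul_mul_mulVec]
  have h4 := hG.isHermitian.dot_comm (G⁻¹ *ᵥ y) u
  rw [hG.mulVec_inv_mulVec] at h4
  have h5 := hP.isHermitian.dot_comm (A *ᵥ x) (B *ᵥ u)
  rw [hK, Matrix.sub_mulVec, Matrix.add_mulVec, dotProduct_sub, dotProduct_add,
    h1, dot_transpose_mul_mul_mulVec]
  simp only [Matrix.mulVec_add, dotProduct_add, add_dotProduct, hG.mulVec_inv_mulVec]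
  rw [h2, h4, h3, h5, dotProduct_comm (G⁻¹ *ᵥ y) y]
  ring

lemma actionForm_posDef (M : System d m) {h : ℕ} (hR : (S.R h).PosDef)
    (hP : (S.riccati M (h + 1)).PosSemidef) : (S.actionForm M h).PosDef :=
  hR.add_posSemidef (by simpa using hP.conjTranspose_mul_mul_same M.toCols₂)

variable {cq cx cΘ cw : ℝ}

/-- Backward induction: by completing the square, the form `P_h` is the one-step cost of the action
given by the gain, a sum of nonnegative terms. No bound on `M` enters, so this also applies to the
optimistic systems. -/
lemma Assumptions.riccati_posSemidef (hS : S.Assumptions cq cx cΘ cw) (M : System d m) :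
    ∀ h, h < H → (S.riccati M h).PosSemidef := by
  suffices ∀ k h, h + k + 1 = H → (S.riccati M h).PosSemidef from
    fun h hh => this (H - 1 - h) h (by omega)
  intro k
  induction k with
  | zero =>
    intro h hh
    obtain rfl : h = H - 1 := by omega
    rw [riccati_terminal]
    exact hS.Q_terminal
  | succ k ih =>
    intro h hh
    have hlt : h + 1 < H := by omega
    have hP := ih (h + 1) (by omega)
    have hG := actionForm_posDef M (hS.R_posDef h hlt) hP
    have hPt : (S.riccati M (h + 1))ᵀ = S.riccati M (h + 1) := by
      simpa [Matrix.IsHermitian] using hP.isHermitian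
    have hGt : (S.actionForm M h)ᵀ = S.actionForm M h := by
      simpa [Matrix.IsHermitian] using hG.isHermitian
    have hQt : (S.Q h)ᵀ = S.Q h := by
      simpa [Matrix.IsHermitian] using (hS.Q_posDef h hlt).isHermitian
    refine posSemidef_of_dot ?_ fun x => ?_
    · rw [riccati_of_lt M hlt]
      change (_ - _ * (S.actionForm M h)⁻¹ * _ * _ * _)ᵀ = _ - _ * (S.actionForm M h)⁻¹ * _ * _ * _
      simp only [Matrix.transpose_sub, Matrix.transpose_add, Matrix.transpose_mul, hQt, hPt,
        Matrix.transpose_transpose, Matrix.transpose_nonsing_inv, hGt, Matrix.mul_assoc]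
    -- At the minimizing action the completed square vanishes.
    · have hsq := cost_add_eq M hlt hP hG x (S.gain M h *ᵥ x)
      rw [sub_self, zero_dotProduct, add_zero] at hsq
      rw [← hsq]
      have h1 := (hS.Q_posDef _ hlt).posSemidef.dot_nonneg x
      have h2 := (hS.R_posDef _ hlt).posSemidef.dot_nonneg (S.gain M h *ᵥ x)
      have h3 := hP.dot_nonneg (M *ᵥ Sum.elim x (S.gain M h *ᵥ x))
      linarith

/-- The one-step excess `xᵀQx + uᵀRu + (M'z)ᵀ P_{h+1}(M) (M'z) - xᵀ P_h(M) x` of the action `u` in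
the system `M'` over the value function of `M`. -/
noncomputable def excess (S : Model d m p q H) (M' M : System d m) (h : ℕ) (x : Vec d) (u : Vec m) : ℝ :=
  x ⬝ᵥ (S.Q h *ᵥ x) + u ⬝ᵥ (S.R h *ᵥ u) +
    (M' *ᵥ Sum.elim x u) ⬝ᵥ (S.riccati M (h + 1) *ᵥ (M' *ᵥ Sum.elim x u)) -
    x ⬝ᵥ (S.riccati M h *ᵥ x)

lemma Assumptions.excess_self_nonneg (hS : S.Assumptions cq cx cΘ cw) (M : System d m) {h : ℕ}
    (hh : h + 1 < H) (x : Vec d) (u : Vec m) : 0 ≤ S.excess M M h x u := by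
  have hP := hS.riccati_posSemidef M (h + 1) hh
  have hG := actionForm_posDef M (hS.R_posDef h hh) hP
  rw [excess, cost_add_eq M hh hP hG]
  have := hG.posSemidef.dot_nonneg (u - S.gain M h *ᵥ x)
  linarith

/-- The excess of the linear policy of `M` in a system `M'` is controlled by the difference of
the two systems. -/
lemma Assumptions.excess_gain_le (hS : S.Assumptions cq cx cΘ cw) (hcq : 0 ≤ cq) (hcx : 0 ≤ cx)
    (M' M : System d m) {h : ℕ}
    (hh : h + 1 < H) (hM : spectralNorm (S.riccati M h) ≤ cq)
    (hM1 : spectralNorm (S.riccati M (h + 1)) ≤ cq) (x : Vec d) (hx : x ⬝ᵥ x ≤ cx ^ 2)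
    (hx' : (M' *ᵥ Sum.elim x (S.gain M h *ᵥ x)) ⬝ᵥ (M' *ᵥ Sum.elim x (S.gain M h *ᵥ x)) ≤ cx ^ 2) :
    S.excess M' M h x (S.gain M h *ᵥ x) ≤ 2 * cq * cx *
      Real.sqrt (((M' - M) *ᵥ Sum.elim x (S.gain M h *ᵥ x)) ⬝ᵥ
        ((M' - M) *ᵥ Sum.elim x (S.gain M h *ᵥ x))) := by
  have hP := hS.riccati_posSemidef M (h + 1) hh
  have hG := actionForm_posDef M (hS.R_posDef h hh) hP
  have hsq := cost_add_eq M hh hP hG x (S.gain M h *ᵥ x)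
  rw [sub_self, zero_dotProduct, add_zero] at hsq
  have hQ0 := (hS.Q_posDef _ hh).posSemidef.dot_nonneg x
  have hR0 := (hS.R_posDef _ hh).posSemidef.dot_nonneg (S.gain M h *ᵥ x)
  have hxP := (le_abs_self _).trans (abs_dot_mulVec_le_spectralNorm (S.riccati M h) x)
  have hzP := (le_abs_self _).trans (abs_dot_mulVec_le_spectralNorm (S.riccati M (h + 1))
    (M' *ᵥ Sum.elim x (S.gain M h *ᵥ x)))
  have hdP := (le_abs_self _).trans (abs_dot_mulVec_le_spectralNorm (S.riccati M (h + 1))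
    ((M' - M) *ᵥ Sum.elim x (S.gain M h *ᵥ x)))
  unfold excess
  rw [Matrix.sub_mulVec] at hdP ⊢
  set a := M' *ᵥ Sum.elim x (S.gain M h *ᵥ x)
  set b := M *ᵥ Sum.elim x (S.gain M h *ᵥ x)
  set P := S.riccati M (h + 1)
  have dot0 : ∀ v : Vec d, 0 ≤ v ⬝ᵥ v := fun v => by
    simpa using Matrix.PosSemidef.one.dot_nonneg v
  have ha : a ⬝ᵥ (P *ᵥ a) ≤ cq * cx ^ 2 :=
    hzP.trans (mul_le_mul hM1 hx' (dot0 _) hcq)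
  -- The predicted next state `b` need not lie in the state space, so its length is not controlled.
  -- Its `P`-form is nevertheless at most the form of `P_h` at `x`, by the Bellman identity `hsq`.
  have hb : b ⬝ᵥ (P *ᵥ b) ≤ cq * cx ^ 2 := by
    have : x ⬝ᵥ (S.riccati M h *ᵥ x) ≤ cq * cx ^ 2 :=
      hxP.trans (mul_le_mul hM hx (dot0 _) hcq)
    linarith
  have hd : (a - b) ⬝ᵥ (P *ᵥ (a - b)) ≤ cq * ((a - b) ⬝ᵥ (a - b)) :=
    hdP.trans (mul_le_mul_of_nonneg_right hM1 (dot0 _))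
  set D := (a - b) ⬝ᵥ (a - b)
  -- Cauchy–Schwarz for the form `P`
  have hcs : ∀ t : ℝ, 0 ≤ ((a - b) ⬝ᵥ (P *ᵥ (a - b))) * (t * t) +
      (2 * ((a - b) ⬝ᵥ (P *ᵥ (a + b)))) * t + (a + b) ⬝ᵥ (P *ᵥ (a + b)) := by
    intro t
    have h0 := hP.dot_nonneg (t • (a - b) + (a + b))
    have hc := hP.isHermitian.dot_comm (a + b) (a - b)
    rw [Matrix.mulVec_add, Matrix.mulVec_smul, add_dotProduct, dotProduct_add, dotProduct_add,
      smul_dotProduct, smul_dotProduct, dotProduct_smul, dotProduct_smul, hc] at h0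
    simp only [smul_eq_mul] at h0
    linarith
  have hdisc := discrim_le_zero hcs
  rw [discrim] at hdisc
  -- The difference of two squares, to which the Cauchy–Schwarz inequality applies.
  have hab : (a - b) ⬝ᵥ (P *ᵥ (a + b)) = a ⬝ᵥ (P *ᵥ a) - b ⬝ᵥ (P *ᵥ b) := by
    have hc := hP.isHermitian.dot_comm a b
    simp only [Matrix.mulVec_add, sub_dotProduct, dotProduct_add]
    rw [hc]; ring
  have hsum : (a + b) ⬝ᵥ (P *ᵥ (a + b)) ≤ 4 * (cq * cx ^ 2) := by
    have h0 := hP.dot_nonneg (a - b)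
    have hc := hP.isHermitian.dot_comm a b
    simp only [Matrix.mulVec_add, Matrix.mulVec_sub, sub_dotProduct, add_dotProduct,
      dotProduct_add, dotProduct_sub] at h0 ⊢
    linarith
  have h0' := hP.dot_nonneg (a - b)
  have h1' := hP.dot_nonneg (a + b)
  have hD0 : 0 ≤ D := dot0 _
  have hfin : ((a - b) ⬝ᵥ (P *ᵥ (a + b))) ^ 2 ≤ (2 * cq * cx * Real.sqrt D) ^ 2 := by
    rw [mul_pow, Real.sq_sqrt hD0]
    have : ((a - b) ⬝ᵥ (P *ᵥ (a - b))) * ((a + b) ⬝ᵥ (P *ᵥ (a + b))) ≤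
        (cq * D) * (4 * (cq * cx ^ 2)) := mul_le_mul hd hsum h1' (by positivity)
    nlinarith
  have hle := abs_le_of_sq_le_sq' hfin (by positivity)
  linarith [hle.2]

end Model

end ContextualLQR

namespace ContextualLQR

/-! ### Resampling one coordinate of a product measure. -/

section Update

variable {ι : Type*} [Fintype ι] [DecidableEq ι] {E : Type*} [MeasurableSpace E]
  {μ : ι → Measure E} [∀ i, IsProbabilityMeasure (μ i)]

/-- Resampling one coordinate does not change a product law. -/
lemma measurePreserving_update (i : ι) :
    MeasurePreserving (fun a : (ι → E) × E => Function.update a.1 i a.2)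
      ((Measure.pi μ).prod (μ i)) (Measure.pi μ) := by
  have hmeas : Measurable fun a : (ι → E) × E => Function.update a.1 i a.2 := measurable_update'
  refine ⟨hmeas, ?_⟩
  symm
  refine Measure.pi_eq fun s hs => ?_
  rw [Measure.map_apply hmeas (MeasurableSet.univ_pi hs)]
  -- The old `i`-th coordinate is overwritten, hence unconstrained; its factor in the product
  -- measure is `1`.
  have : (fun a : (ι → E) × E => Function.update a.1 i a.2) ⁻¹' (Set.univ.pi s) =
      (Set.univ.pi (Function.update s i Set.univ)) ×ˢ s i := by
    ext ⟨w, y⟩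
    simp only [Set.mem_preimage, Set.mem_pi, Set.mem_univ, true_imp_iff, Set.mem_prod]
    constructor
    · intro h
      refine ⟨fun j => ?_, by simpa using h i⟩
      rcases eq_or_ne j i with rfl | hj
      · simp
      · simpa [hj] using h j
    · rintro ⟨h1, h2⟩ j
      rcases eq_or_ne j i with rfl | hj
      · simpa
      · simpa [hj] using h1 j
  rw [this, Measure.prod_prod, Measure.pi_pi, ← Finset.prod_erase_mul _ _ (Finset.mem_univ i),
    ← Finset.prod_erase_mul Finset.univ (fun j => μ j (s j)) (Finset.mem_univ i)]
  simp only [Function.update_self, measure_univ, mul_one]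
  congr 1
  exact Finset.prod_congr rfl fun j hj => by rw [Function.update_of_ne (Finset.ne_of_mem_erase hj)]

/-- This plays the role of conditioning on all noise vectors but the `i`-th, without splitting the
product space. -/
lemma lintegral_pi_update (i : ι) {f : (ι → E) → ℝ≥0∞} (hf : Measurable f) :
    ∫⁻ w, f w ∂(Measure.pi μ) = ∫⁻ w, ∫⁻ y, f (Function.update w i y) ∂(μ i) ∂(Measure.pi μ) := by
  have h := measurePreserving_update (μ := μ) i
  rw [← h.lintegral_comp hf]
  exact lintegral_prod (fun a : (ι → E) × E => f (Function.update a.1 i a.2))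
    (hf.comp h.measurable).aemeasurable

lemma ae_pi_of_update (i : ι) {p : (ι → E) → Prop} (hp : MeasurableSet {w | p w})
    (h : ∀ᵐ w ∂(Measure.pi μ), ∀ᵐ y ∂(μ i), p (Function.update w i y)) :
    ∀ᵐ w ∂(Measure.pi μ), p w := by
  have hm := measurePreserving_update (μ := μ) i
  rw [← hm.map_eq, ae_map_iff hm.measurable.aemeasurable hp]
  exact (Measure.ae_prod_iff_ae_ae (hm.measurable hp)).2 h

/-- The martingale-difference property: a centered function of one coordinate is orthogonal to
everything that does not depend on that coordinate. -/
lemma integral_pi_mul_eq_zero (i : ι) {f : (ι → E) → ℝ} {g : E → ℝ}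
    (hf : ∀ w y, f (Function.update w i y) = f w) (hg : ∫ y, g y ∂(μ i) = 0)
    (hfg : Integrable (fun w => f w * g (w i)) (Measure.pi μ)) :
    ∫ w, f w * g (w i) ∂(Measure.pi μ) = 0 := by
  have hm := measurePreserving_update (μ := μ) i
  have hi := hm.integrable_comp_of_integrable hfg
  rw [← hm.map_eq, integral_map hm.measurable.aemeasurable
    (hm.map_eq.symm ▸ hfg.aestronglyMeasurable)]
  refine (integral_prod _ hi).trans ?_
  simp [hf, integral_const_mul, hg]

end Update

/-! ### Measurability of matrix operations and of the Riccati recursion. -/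

section Measurability

instance instBorelSpaceMatrix (m n : Type*) [Countable m] [Countable n] :
    BorelSpace (Matrix m n ℝ) :=
  inferInstanceAs (BorelSpace (m → n → ℝ))

instance instSecondCountableMatrix (m n : Type*) [Countable m] [Countable n] :
    SecondCountableTopology (Matrix m n ℝ) :=
  inferInstanceAs (SecondCountableTopology (m → n → ℝ))

lemma measurable_sumElim {α : Type*} [MeasurableSpace α] {k l : Type*} {x : α → k → ℝ} {u : α → l → ℝ} (hx : Measurable x)
    (hu : Measurable u) : Measurable fun a => Sum.elim (x a) (u a) := by
  refine measurable_pi_iff.2 fun i => ?_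
  cases i with
  | inl i => exact (measurable_pi_apply i).comp hx
  | inr i => exact (measurable_pi_apply i).comp hu

variable {α : Type*} [MeasurableSpace α] {k l r : Type*} [Fintype k] [Fintype l] [Fintype r]

lemma measurable_mulVec {A : α → Matrix k l ℝ} {v : α → l → ℝ} (hA : Measurable A)
    (hv : Measurable v) : Measurable fun a => A a *ᵥ v a :=
  (continuous_fst.matrix_mulVec continuous_snd :
    Continuous fun p : Matrix k l ℝ × (l → ℝ) => p.1 *ᵥ p.2).measurable.comp (hA.prodMk hv)

lemma measurable_matrix_mul {A : α → Matrix k l ℝ} {B : α → Matrix l r ℝ} (hA : Measurable A)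
    (hB : Measurable B) : Measurable fun a => A a * B a :=
  (continuous_fst.matrix_mul continuous_snd :
    Continuous fun p : Matrix k l ℝ × Matrix l r ℝ => p.1 * p.2).measurable.comp (hA.prodMk hB)

lemma measurable_vecMulVec {v : α → k → ℝ} {w : α → l → ℝ} (hv : Measurable v)
    (hw : Measurable w) : Measurable fun a => Matrix.vecMulVec (v a) (w a) :=
  (continuous_fst.matrix_vecMulVec continuous_snd :
    Continuous fun p : (k → ℝ) × (l → ℝ) => Matrix.vecMulVec p.1 p.2).measurable.comp
      (hv.prodMk hw)

lemma measurable_dotProduct {v w : α → k → ℝ} (hv : Measurable v)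
    (hw : Measurable w) : Measurable fun a => v a ⬝ᵥ w a :=
  (continuous_fst.dotProduct continuous_snd :
    Continuous fun p : (k → ℝ) × (k → ℝ) => p.1 ⬝ᵥ p.2).measurable.comp (hv.prodMk hw)

lemma measurable_matrix_transpose {A : α → Matrix k l ℝ} (hA : Measurable A) :
    Measurable fun a => (A a)ᵀ :=
  (continuous_id.matrix_transpose : Continuous fun A : Matrix k l ℝ => Aᵀ).measurable.comp hA

lemma measurable_matrix_det [DecidableEq k] {A : α → Matrix k k ℝ} (hA : Measurable A) :
    Measurable fun a => (A a).det :=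
  (continuous_id.matrix_det : Continuous fun A : Matrix k k ℝ => A.det).measurable.comp hA

lemma measurable_matrix_inv [DecidableEq k] {A : α → Matrix k k ℝ} (hA : Measurable A) :
    Measurable fun a => (A a)⁻¹ := by
  -- Inversion is not continuous everywhere, but this formula holds also at singular matrices, where
  -- both sides are zero.
  have : (fun a => (A a)⁻¹) = fun a => ((A a).det)⁻¹ • (A a).adjugate := by
    ext1 a
    rw [Matrix.inv_def, Ring.inverse_eq_inv']
  rw [this]
  exact (measurable_matrix_det hA).inv.smul
    ((continuous_id.matrix_adjugate : Continuous fun A : Matrix k k ℝ => A.adjugate).measurable.comp hA)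

lemma measurable_blockContext {d m p q : ℕ} {c : α → Context d m p q} (hc : Measurable c) :
    Measurable fun a => blockContext (c a) :=
  ((continuous_fst.matrix_fromBlocks continuous_const continuous_const continuous_snd :
    Continuous fun c : Context d m p q => blockContext c)).measurable.comp hc

lemma measurable_decode {d m p q : ℕ} {Θ : α → Decoder d p q} {c : α → Context d m p q}
    (hΘ : Measurable Θ) (hc : Measurable c) : Measurable fun a => decode (Θ a) (c a) :=
  measurable_matrix_mul hΘ (measurable_blockContext hc)

lemma measurable_toCols₁ {M : α → Matrix k (l ⊕ r) ℝ} (hM : Measurable M) :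
    Measurable fun a => (M a).toCols₁ :=
  (show Continuous fun M : Matrix k (l ⊕ r) ℝ => M.toCols₁ from
    continuous_matrix fun i j => continuous_id.matrix_elem i (Sum.inl j)).measurable.comp hM

lemma measurable_toCols₂ {M : α → Matrix k (l ⊕ r) ℝ} (hM : Measurable M) :
    Measurable fun a => (M a).toCols₂ :=
  (show Continuous fun M : Matrix k (l ⊕ r) ℝ => M.toCols₂ from
    continuous_matrix fun i j => continuous_id.matrix_elem i (Sum.inr j)).measurable.comp hM

variable {d m p q H : ℕ} (S : Model d m p q H)

lemma Model.measurable_riccati {M : α → System d m} (hM : Measurable M) :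
    ∀ h, Measurable fun a => S.riccati (M a) h := by
  suffices ∀ k h, H ≤ h + k + 1 → Measurable fun a => S.riccati (M a) h from
    fun h => this H h (by omega)
  intro k
  induction k with
  | zero =>
    intro h hh
    have : (fun a => S.riccati (M a) h) = fun _ => S.Q (H - 1) := by
      ext1 a
      rw [Model.riccati, if_neg (by omega)]
    rw [this]
    exact measurable_const
  | succ k ih =>
    intro h hh
    by_cases hlt : h + 1 < H
    · simp only [Model.riccati_of_lt _ hlt]
      have hP := ih (h + 1) (by omega)
      have hA := measurable_toCols₁ hM
      have hB := measurable_toCols₂ hM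
      have hAP := measurable_matrix_mul (measurable_matrix_transpose hA) hP
      have hBP := measurable_matrix_mul (measurable_matrix_transpose hB) hP
      exact (measurable_const.add (measurable_matrix_mul hAP hA)).sub
        (measurable_matrix_mul (measurable_matrix_mul (measurable_matrix_mul
          (measurable_matrix_mul (measurable_matrix_mul hAP hB)
            (measurable_matrix_inv (measurable_const.add (measurable_matrix_mul hBP hB))))
          (measurable_matrix_transpose hB)) hP) hA)
    · exact ih h (by omega)

lemma Model.measurable_gain {M : α → System d m} (hM : Measurable M) (h : ℕ) :
    Measurable fun a => S.gain (M a) h := by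
  have hP := S.measurable_riccati hM (h + 1)
  have hA := measurable_toCols₁ hM
  have hB := measurable_toCols₂ hM
  have hBt := measurable_matrix_transpose hB
  exact (measurable_matrix_mul (measurable_matrix_mul (measurable_matrix_mul
    (measurable_matrix_inv (measurable_const.add
      (measurable_matrix_mul (measurable_matrix_mul hBt hP) hB))) hBt) hP) hA).neg

end Measurability

/-! ### Trajectories as functions of the noise. -/

section Rollout

variable {d m H : ℕ}

lemma rollout_congr (M : System d m) (π : Policy d m) (x₁ : Vec d) {w w' : ℕ → Vec d} :
    ∀ {h : ℕ}, (∀ j < h, w j = w' j) → rollout M π x₁ w h = rollout M π x₁ w' h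
  | 0, _ => rfl
  | h + 1, hw => by
    simp only [rollout, rollout_congr M π x₁ fun j hj => hw j (Nat.lt_succ_of_lt hj),
      hw h (Nat.lt_succ_self h)]

/-- Causality: noise `i` enters only the transition out of stage `i`, so the case `h = i` is
included. -/
lemma rollout_update (M : System d m) (π : Policy d m) (x₁ : Vec d) (w : Fin (H - 1) → Vec d)
    (i : Fin (H - 1)) (y : Vec d) {h : ℕ} (hh : h ≤ i) :
    rollout M π x₁ (extendNoise (H := H) (Function.update w i y)) h =
      rollout M π x₁ (extendNoise (H := H) w) h := by
  refine rollout_congr M π x₁ fun j hj => ?_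
  unfold extendNoise
  split_ifs with hlt
  · rw [Function.update_of_ne]
    intro e
    have := congrArg Fin.val e
    simp at this
    omega
  · rfl

lemma stateAt_succ (M : System d m) (π : Policy d m) (x₁ : Vec d) (w : ℕ → Vec d) (h : ℕ) :
    stateAt M π x₁ w (h + 1) =
      M *ᵥ Sum.elim (stateAt M π x₁ w h) (actionAt M π x₁ w h) + w h := rfl

lemma extendNoise_of_lt (w : Fin (H - 1) → Vec d) {h : ℕ} (hh : h < H - 1) :
    extendNoise (H := H) w h = w ⟨h, hh⟩ := dif_pos hh

variable {α : Type*} [MeasurableSpace α]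

lemma measurable_extendNoise {w : α → Fin (H - 1) → Vec d} (hw : Measurable w) (h : ℕ) :
    Measurable fun a => extendNoise (H := H) (w a) h := by
  unfold extendNoise
  split_ifs with hlt
  · exact (measurable_pi_apply _).comp hw
  · exact measurable_const

lemma measurable_rollout {M : α → System d m} (hM : Measurable M) {π : α → Policy d m}
    (hπ : ∀ h, h + 1 < H →
      Measurable fun a : α × ((Fin h → Vec d × Vec m) × Vec d) => π a.1 h a.2.1 a.2.2)
    (x₁ : Vec d) {w : α → Fin (H - 1) → Vec d} (hw : Measurable w) :
    ∀ h, h ≤ H - 1 →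
      Measurable fun a => rollout (M a) (π a) x₁ (extendNoise (H := H) (w a)) h
  | 0, _ => measurable_const
  | h + 1, hh => by
    have ih := measurable_rollout hM hπ x₁ hw h (by omega)
    have hu := (hπ h (by omega)).comp (measurable_id.prodMk ih)
    have hx := measurable_snd.comp ih
    refine Measurable.prodMk ?_ ?_
    · refine measurable_pi_iff.2 fun i => ?_
      refine Fin.lastCases ?_ (fun i => ?_) i
      · simp only [Fin.snoc_last]
        exact hx.prodMk hu
      · simp only [Fin.snoc_castSucc]
        exact (measurable_pi_apply i).comp (measurable_fst.comp ih)
    · exact (measurable_mulVec hM (measurable_sumElim hx hu)).add (measurable_extendNoise hw h)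

lemma measurable_stateAt {M : α → System d m} (hM : Measurable M) {π : α → Policy d m}
    (hπ : ∀ h, h + 1 < H →
      Measurable fun a : α × ((Fin h → Vec d × Vec m) × Vec d) => π a.1 h a.2.1 a.2.2)
    (x₁ : Vec d) {w : α → Fin (H - 1) → Vec d} (hw : Measurable w) {h : ℕ} (hh : h ≤ H - 1) :
      Measurable fun a => stateAt (M a) (π a) x₁ (extendNoise (H := H) (w a)) h :=
  measurable_snd.comp (measurable_rollout hM hπ x₁ hw h hh)

lemma measurable_actionAt {M : α → System d m} (hM : Measurable M) {π : α → Policy d m}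
    (hπ : ∀ h, h + 1 < H →
      Measurable fun a : α × ((Fin h → Vec d × Vec m) × Vec d) => π a.1 h a.2.1 a.2.2)
    (x₁ : Vec d) {w : α → Fin (H - 1) → Vec d} (hw : Measurable w) {h : ℕ} (hh : h + 1 < H) :
      Measurable fun a => actionAt (M a) (π a) x₁ (extendNoise (H := H) (w a)) h :=
  (hπ h hh).comp (measurable_id.prodMk (measurable_rollout hM hπ x₁ hw h (by omega)))

end Rollout

end ContextualLQR

namespace ContextualLQR

/-! ### The expected cost of a policy in the true game. -/

lemma dot_self_nonneg' {k : Type*} [Fintype k] (v : k → ℝ) : 0 ≤ v ⬝ᵥ v :=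
  Finset.sum_nonneg fun i _ => mul_self_nonneg (v i)

lemma sq_apply_le_dot {k : Type*} [Fintype k] (v : k → ℝ) (i : k) : v i ^ 2 ≤ v ⬝ᵥ v := by
  rw [sq]
  exact Finset.single_le_sum (f := fun i => v i * v i) (fun i _ => mul_self_nonneg (v i))
    (Finset.mem_univ i)

lemma integrable_quadratic {Ω : Type*} [MeasurableSpace Ω] {μ : Measure Ω} [IsFiniteMeasure μ]
    {k : ℕ} {f : Ω → Vec k} (hf : Measurable f) {C : ℝ} (hC : ∀ᵐ ω ∂μ, f ω ⬝ᵥ f ω ≤ C)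
    (P : Matrix (Fin k) (Fin k) ℝ) : Integrable (fun ω => f ω ⬝ᵥ (P *ᵥ f ω)) μ := by
  refine Integrable.of_bound
    (measurable_dotProduct hf (measurable_mulVec measurable_const hf)).aestronglyMeasurable
    (spectralNorm P * C) ?_
  filter_upwards [hC] with ω hω
  exact (abs_dot_mulVec_le_spectralNorm P (f ω)).trans
    (mul_le_mul_of_nonneg_left hω (norm_nonneg _))

namespace Model

variable {d m p q H : ℕ} {S : Model d m p q H} {cq cx cΘ cw : ℝ}

lemma Assumptions.integrable_noise (hS : S.Assumptions cq cx cΘ cw) (h : Fin (H - 1)) (i : Fin d) :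
    Integrable (fun w : Vec d => w i) (S.noiseLaw h) :=
  (hS.noise_subGaussian h i).integrable

lemma Assumptions.integrable_noise_mul (hS : S.Assumptions cq cx cΘ cw) (h : Fin (H - 1))
    (i j : Fin d) : Integrable (fun w : Vec d => w i * w j) (S.noiseLaw h) :=
  MemLp.integrable_mul (p := 2) (q := 2) (by simpa using (hS.noise_subGaussian h i).memLp 2)
    (by simpa using (hS.noise_subGaussian h j).memLp 2)

lemma Assumptions.integrable_noise_quadratic (hS : S.Assumptions cq cx cΘ cw) (h : Fin (H - 1))
    (P : Matrix (Fin d) (Fin d) ℝ) :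
    Integrable (fun w : Vec d => w ⬝ᵥ (P *ᵥ w)) (S.noiseLaw h) := by
  simp only [dotProduct, Matrix.mulVec, Finset.mul_sum]
  refine integrable_finsetSum _ fun i _ => integrable_finsetSum _ fun j _ => ?_
  exact ((hS.integrable_noise_mul h i j).const_mul (P i j)).congr
    (Filter.Eventually.of_forall fun w => by simp only; ring)

/-- The covariance of the noise forces the mean of the next state, and the dimension, to be
small. -/
lemma Assumptions.dot_add_dim_le (hS : S.Assumptions cq cx cΘ cw) {c : Context d m p q}
    (hc : c ∈ S.contextLaw.support) {x : Vec d} (hx : x ∈ S.X) {u : Vec m} (hu : u ∈ S.U)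
    (h : Fin (H - 1)) :
    (decode S.Θstar c *ᵥ Sum.elim x u) ⬝ᵥ (decode S.Θstar c *ᵥ Sum.elim x u) + d ≤ cx ^ 2 := by
  have := hS.prob_noise h
  set a := decode S.Θstar c *ᵥ Sum.elim x u
  have h1 : ∀ᵐ w ∂(S.noiseLaw h), (a + w) ⬝ᵥ (a + w) ≤ cx ^ 2 := by
    filter_upwards [hS.state_mem c hc x hx u hu h] with w hw
    -- The next state is paired with the old action merely to invoke the bound; only its state part
    -- is kept.
    have := hS.state_action_le _ hw u hu
    have := dot_self_nonneg' u
    linarith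
  have he : ∀ w : Vec d, (a + w) ⬝ᵥ (a + w) = a ⬝ᵥ a + 2 * ∑ i, a i * w i + ∑ i, w i * w i := by
    intro w
    simp only [dotProduct, Pi.add_apply, Finset.mul_sum, ← Finset.sum_add_distrib]
    exact Finset.sum_congr rfl fun i _ => by ring
  simp only [he] at h1
  have i1 : Integrable (fun w : Vec d => ∑ i, a i * w i) (S.noiseLaw h) :=
    integrable_finsetSum _ fun i _ => (hS.integrable_noise h i).const_mul _
  have i2 : Integrable (fun w : Vec d => ∑ i, w i * w i) (S.noiseLaw h) :=
    integrable_finsetSum _ fun i _ => hS.integrable_noise_mul h i i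
  have i3 : Integrable (fun w : Vec d => a ⬝ᵥ a + 2 * ∑ i, a i * w i) (S.noiseLaw h) :=
    (integrable_const _).add (i1.const_mul 2)
  have h2 := integral_mono_ae (i3.add i2) (integrable_const (cx ^ 2)) h1
  have h3 : ∫ w, ((fun w : Vec d => a ⬝ᵥ a + 2 * ∑ i, a i * w i) + fun w : Vec d => ∑ i, w i * w i) w
      ∂(S.noiseLaw h) = a ⬝ᵥ a + d := by
    rw [integral_add' i3 i2, integral_add (integrable_const _) (i1.const_mul 2), integral_const_mul,
      integral_finsetSum _ fun i _ => (hS.integrable_noise h i).const_mul _,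
      integral_finsetSum _ fun i _ => hS.integrable_noise_mul h i i]
    simp [integral_const_mul, hS.noise_mean, hS.noise_cov]
  rw [h3] at h2
  simpa using h2

lemma measurable_policy {π : Policy d m} (hπ : S.IsPolicy π) :
    ∀ h, h + 1 < H → Measurable fun a : (Fin (H - 1) → Vec d) × ((Fin h → Vec d × Vec m) × Vec d) =>
      π h a.2.1 a.2.2 :=
  fun h hh => (hπ.measurable h hh).comp measurable_snd

section Play

variable (hS : S.Assumptions cq cx cΘ cw) {c : Context d m p q} (hc : c ∈ S.contextLaw.support)
  {π : Policy d m} (hπ : S.IsPolicy π)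
include hS hc hπ

/-- States and actions stay in their spaces. -/
lemma Assumptions.ae_mem (hH : 1 ≤ H) : ∀ᵐ w ∂(Measure.pi S.noiseLaw), ∀ h,
    (h < H → stateAt (decode S.Θstar c) π S.xinit (extendNoise (H := H) w) h ∈ S.X) ∧
    (h + 1 < H → actionAt (decode S.Θstar c) π S.xinit (extendNoise (H := H) w) h ∈ S.U) := by
  have := hS.prob_noise
  set M := decode S.Θstar c
  have hmX : ∀ {h}, h < H → Measurable fun w : Fin (H - 1) → Vec d =>
      stateAt M π S.xinit (extendNoise (H := H) w) h := fun hh =>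
    measurable_stateAt (α := Fin (H - 1) → Vec d) measurable_const (measurable_policy hπ) S.xinit
      measurable_id (by omega)
  have hmU : ∀ {h}, h + 1 < H → Measurable fun w : Fin (H - 1) → Vec d =>
      actionAt M π S.xinit (extendNoise (H := H) w) h := fun hh =>
    measurable_actionAt (α := Fin (H - 1) → Vec d) measurable_const (measurable_policy hπ) S.xinit
      measurable_id hh
  -- The exceptional null set of `state_mem` depends on the state and the action. Resampling the
  -- noise of stage `h` keeps these fixed while the next state varies.
  have step : ∀ h, (hh : h + 1 < H) → ∀ᵐ w ∂(Measure.pi S.noiseLaw),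
      (stateAt M π S.xinit (extendNoise (H := H) w) h ∈ S.X ∧
        actionAt M π S.xinit (extendNoise (H := H) w) h ∈ S.U) →
      stateAt M π S.xinit (extendNoise (H := H) w) (h + 1) ∈ S.X := by
    intro h hh
    refine ae_pi_of_update (⟨h, by omega⟩ : Fin (H - 1)) ?_ ?_
    · have h1 := hmX (Nat.lt_of_succ_lt hh) hS.measurableSet_X
      have h2 := hmU hh hS.isClosed_U.measurableSet
      have h3 := hmX hh hS.measurableSet_X
      have := (h1.inter h2).compl.union h3
      convert this using 1
      ext w
      simp only [Set.mem_ofPred_eq, Set.mem_union, Set.mem_compl_iff, Set.mem_inter_iff,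
        Set.mem_preimage]
      tauto
    · filter_upwards with w
      by_cases hw : stateAt M π S.xinit (extendNoise (H := H) w) h ∈ S.X ∧
        actionAt M π S.xinit (extendNoise (H := H) w) h ∈ S.U
      · filter_upwards [hS.state_mem c hc _ hw.1 _ hw.2 ⟨h, by omega⟩] with y hy _
        have hr := rollout_update (H := H) M π S.xinit w ⟨h, by omega⟩ y (h := h) le_rfl
        rw [stateAt_succ, extendNoise_of_lt _ (by omega), Function.update_self]
        rw [stateAt, actionAt, hr]
        exact hy
      · filter_upwards with y hy
        have hr := rollout_update (H := H) M π S.xinit w ⟨h, by omega⟩ y (h := h) le_rfl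
        rw [stateAt, actionAt, hr] at hy
        exact absurd hy hw
  have step' : ∀ᵐ w ∂(Measure.pi S.noiseLaw), ∀ h, h + 1 < H →
      (stateAt M π S.xinit (extendNoise (H := H) w) h ∈ S.X ∧
        actionAt M π S.xinit (extendNoise (H := H) w) h ∈ S.U) →
      stateAt M π S.xinit (extendNoise (H := H) w) (h + 1) ∈ S.X := by
    rw [ae_all_iff]
    intro h
    by_cases hh : h + 1 < H
    · filter_upwards [step h hh] with w hw _ using hw
    · exact Filter.Eventually.of_forall fun w hw => absurd hw hh
  filter_upwards [step'] with w hw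
  -- The induction carries the whole history, since a policy is only required to take values in
  -- `S.U` on histories that lie in the spaces.
  have key : ∀ h, h < H → (∀ i, ((rollout M π S.xinit (extendNoise (H := H) w) h).1 i).1 ∈ S.X ∧
      ((rollout M π S.xinit (extendNoise (H := H) w) h).1 i).2 ∈ S.U) ∧
      stateAt M π S.xinit (extendNoise (H := H) w) h ∈ S.X := by
    intro h
    induction h with
    | zero => exact fun _ => ⟨fun i => i.elim0, hS.xinit_mem⟩
    | succ h ih =>
      intro hh
      obtain ⟨h1, h2⟩ := ih (by omega)
      have hu : actionAt M π S.xinit (extendNoise (H := H) w) h ∈ S.U :=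
        hπ.mapsTo h hh _ h1 _ h2
      refine ⟨fun i => ?_, hw h hh ⟨h2, hu⟩⟩
      refine Fin.lastCases ?_ (fun i => ?_) i
      · simp only [rollout, Fin.snoc_last]
        exact ⟨h2, hu⟩
      · simp only [rollout, Fin.snoc_castSucc]
        exact h1 i
  exact fun h => ⟨fun hh => (key h hh).2, fun hh =>
    hπ.mapsTo h hh _ (key h (by omega)).1 _ (key h (by omega)).2⟩

/-- The excess is integrable along a trajectory of a policy. -/
lemma Assumptions.integrable_excess (hH : 1 ≤ H) (M : System d m) {h : ℕ} (hh : h + 1 < H) :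
    Integrable (fun w => S.excess (decode S.Θstar c) M h
      (stateAt (decode S.Θstar c) π S.xinit (extendNoise (H := H) w) h)
      (actionAt (decode S.Θstar c) π S.xinit (extendNoise (H := H) w) h))
        (Measure.pi S.noiseLaw) := by
  have := hS.prob_noise
  have hae := hS.ae_mem hc hπ hH
  set M' := decode S.Θstar c with hM'
  set x : (Fin (H - 1) → Vec d) → ℕ → Vec d :=
    fun w => stateAt M' π S.xinit (extendNoise (H := H) w) with hx
  set u : (Fin (H - 1) → Vec d) → ℕ → Vec m :=
    fun w => actionAt M' π S.xinit (extendNoise (H := H) w) with hu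
  have hmX : ∀ {h}, h < H → Measurable fun w => x w h := fun hh =>
    measurable_stateAt (α := Fin (H - 1) → Vec d) measurable_const (measurable_policy hπ) S.xinit
      measurable_id (by omega)
  have hmU : ∀ {h}, h + 1 < H → Measurable fun w => u w h := fun hh =>
    measurable_actionAt (α := Fin (H - 1) → Vec d) measurable_const (measurable_policy hπ) S.xinit
      measurable_id hh
  have hmZ : ∀ {h}, h + 1 < H → Measurable fun w => M' *ᵥ Sum.elim (x w h) (u w h) := fun hh =>
    measurable_mulVec measurable_const
      (measurable_sumElim (hmX (Nat.lt_of_succ_lt hh)) (hmU hh))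
  have bX : ∀ᵐ w ∂(Measure.pi S.noiseLaw), x w h ⬝ᵥ x w h ≤ cx ^ 2 := by
    filter_upwards [hae] with w hw
    have := hS.state_action_le _ ((hw h).1 (by omega)) _ ((hw h).2 hh)
    have := dot_self_nonneg' (u w h)
    linarith
  have bU : ∀ᵐ w ∂(Measure.pi S.noiseLaw), u w h ⬝ᵥ u w h ≤ cx ^ 2 := by
    filter_upwards [hae] with w hw
    have := hS.state_action_le _ ((hw h).1 (by omega)) _ ((hw h).2 hh)
    have := dot_self_nonneg' (x w h)
    linarith
  have bZ : ∀ᵐ w ∂(Measure.pi S.noiseLaw),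
      (M' *ᵥ Sum.elim (x w h) (u w h)) ⬝ᵥ (M' *ᵥ Sum.elim (x w h) (u w h)) ≤ cx ^ 2 := by
    filter_upwards [hae] with w hw
    have := hS.dot_add_dim_le hc ((hw h).1 (by omega)) ((hw h).2 hh) ⟨h, by omega⟩
    have h0 : (0 : ℝ) ≤ d := Nat.cast_nonneg d
    linarith
  exact (((integrable_quadratic (hmX (by omega)) bX _).add
    (integrable_quadratic (hmU hh) bU _)).add (integrable_quadratic (hmZ hh) bZ _)).sub
      (integrable_quadratic (hmX (by omega)) bX _)

/-- The cost of a policy in the true game, compared with the value function of any system. -/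
lemma Assumptions.policyCost_eq (hH : 1 ≤ H) (M : System d m) :
    S.policyCost (decode S.Θstar c) π S.xinit =
      ENNReal.ofReal (S.riccatiValue M 0 S.xinit + ∑ h ∈ Finset.range (H - 1),
        ∫ w, S.excess (decode S.Θstar c) M h
          (stateAt (decode S.Θstar c) π S.xinit (extendNoise (H := H) w) h)
          (actionAt (decode S.Θstar c) π S.xinit (extendNoise (H := H) w) h)
            ∂(Measure.pi S.noiseLaw)) := by
  have := hS.prob_noise
  have hae := hS.ae_mem hc hπ hH
  set M' := decode S.Θstar c with hM'
  set x : (Fin (H - 1) → Vec d) → ℕ → Vec d :=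
    fun w => stateAt M' π S.xinit (extendNoise (H := H) w) with hx
  set u : (Fin (H - 1) → Vec d) → ℕ → Vec m :=
    fun w => actionAt M' π S.xinit (extendNoise (H := H) w) with hu
  have hmX : ∀ {h}, h < H → Measurable fun w => x w h := fun hh =>
    measurable_stateAt (α := Fin (H - 1) → Vec d) measurable_const (measurable_policy hπ) S.xinit
      measurable_id (by omega)
  have hmU : ∀ {h}, h + 1 < H → Measurable fun w => u w h := fun hh =>
    measurable_actionAt (α := Fin (H - 1) → Vec d) measurable_const (measurable_policy hπ) S.xinit
      measurable_id hh
  have hmZ : ∀ {h}, h + 1 < H → Measurable fun w => M' *ᵥ Sum.elim (x w h) (u w h) := fun hh =>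
    measurable_mulVec measurable_const
      (measurable_sumElim (hmX (Nat.lt_of_succ_lt hh)) (hmU hh))
  have bZ : ∀ {h}, h + 1 < H → ∀ᵐ w ∂(Measure.pi S.noiseLaw),
      (M' *ᵥ Sum.elim (x w h) (u w h)) ⬝ᵥ (M' *ᵥ Sum.elim (x w h) (u w h)) ≤ cx ^ 2 := by
    intro h hh
    filter_upwards [hae] with w hw
    have := hS.dot_add_dim_le hc ((hw h).1 (by omega)) ((hw h).2 hh) ⟨h, by omega⟩
    have h0 : (0 : ℝ) ≤ d := Nat.cast_nonneg d
    linarith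
  have intE : ∀ {h}, h + 1 < H →
      Integrable (fun w => S.excess M' M h (x w h) (u w h)) (Measure.pi S.noiseLaw) := fun hh =>
    hS.integrable_excess hc hπ hH M hh
  -- the noise terms
  set N : ℕ → (Fin (H - 1) → Vec d) → ℝ := fun h w =>
    (M' *ᵥ Sum.elim (x w h) (u w h)) ⬝ᵥ
      ((S.riccati M (h + 1) + (S.riccati M (h + 1))ᵀ) *ᵥ extendNoise (H := H) w h) with hN
  have hNint : ∀ {h}, h + 1 < H → Integrable (N h) (Measure.pi S.noiseLaw) ∧
      ∫ w, N h w ∂(Measure.pi S.noiseLaw) = 0 := by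
    intro h hh
    set P := S.riccati M (h + 1) + (S.riccati M (h + 1))ᵀ
    have hlt : h < H - 1 := by omega
    set i : Fin (H - 1) := ⟨h, hlt⟩
    have e : N h = fun w => ∑ a, ∑ b, ((M' *ᵥ Sum.elim (x w h) (u w h)) a * P a b) * w i b := by
      ext w
      simp only [hN, dotProduct, Matrix.mulVec, Finset.mul_sum, extendNoise_of_lt _ hlt]
      exact Finset.sum_congr rfl fun a _ => Finset.sum_congr rfl fun b _ => by ring
    have hint : ∀ a b, Integrable
        (fun w : Fin (H - 1) → Vec d => ((M' *ᵥ Sum.elim (x w h) (u w h)) a * P a b) * w i b)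
        (Measure.pi S.noiseLaw) := by
      intro a b
      have h1 : Integrable (fun w : Fin (H - 1) → Vec d => w i b) (Measure.pi S.noiseLaw) :=
        (measurePreserving_eval S.noiseLaw i).integrable_comp_of_integrable
          (hS.integrable_noise i b)
      refine h1.bdd_mul (c := |cx| * |P a b|)
        ((measurable_pi_apply a).comp (hmZ hh) |>.mul_const _).aestronglyMeasurable ?_
      filter_upwards [bZ hh] with w hw
      rw [Real.norm_eq_abs, abs_mul]
      refine mul_le_mul_of_nonneg_right ?_ (abs_nonneg _)
      exact sq_le_sq.1 ((sq_apply_le_dot _ a).trans hw)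
    have hz : ∀ a b, ∫ w : Fin (H - 1) → Vec d,
        ((M' *ᵥ Sum.elim (x w h) (u w h)) a * P a b) * w i b ∂(Measure.pi S.noiseLaw) = 0 := by
      intro a b
      -- The state and the action at stage `h` depend on earlier noise only.
      refine integral_pi_mul_eq_zero i
        (f := fun w => (M' *ᵥ Sum.elim (x w h) (u w h)) a * P a b) (g := fun y => y b) ?_
        (hS.noise_mean i b) (hint a b)
      intro w y
      have hr := rollout_update (H := H) M' π S.xinit w i y (h := h) le_rfl
      simp only [hx, hu, stateAt, actionAt, hr]
    rw [e]
    refine ⟨integrable_finsetSum _ fun a _ => integrable_finsetSum _ fun b _ => hint a b, ?_⟩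
    rw [integral_finsetSum _ fun a _ => integrable_finsetSum _ fun b _ => hint a b]
    refine Finset.sum_eq_zero fun a _ => ?_
    rw [integral_finsetSum _ fun b _ => hint a b]
    exact Finset.sum_eq_zero fun b _ => hz a b
  -- The quadratic noise term is centered by the increment of `riccatiConst`, which is its mean by
  -- definition.
  set G : ℕ → (Fin (H - 1) → Vec d) → ℝ := fun h w =>
    extendNoise (H := H) w h ⬝ᵥ (S.riccati M (h + 1) *ᵥ extendNoise (H := H) w h) -
      (S.riccatiConst M h - S.riccatiConst M (h + 1)) with hGdef
  have hGint : ∀ {h}, h + 1 < H → Integrable (G h) (Measure.pi S.noiseLaw) ∧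
      ∫ w, G h w ∂(Measure.pi S.noiseLaw) = 0 := by
    intro h hh
    have hlt : h < H - 1 := by omega
    have hmp := measurePreserving_eval S.noiseLaw (⟨h, hlt⟩ : Fin (H - 1))
    have i0 := hS.integrable_noise_quadratic ⟨h, hlt⟩ (S.riccati M (h + 1))
    have i1 : Integrable (fun w : Fin (H - 1) → Vec d =>
        w ⟨h, hlt⟩ ⬝ᵥ (S.riccati M (h + 1) *ᵥ w ⟨h, hlt⟩)) (Measure.pi S.noiseLaw) :=
      hmp.integrable_comp_of_integrable i0
    simp only [hGdef, extendNoise_of_lt _ hlt]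
    refine ⟨i1.sub (integrable_const _), ?_⟩
    rw [integral_sub i1 (integrable_const _), riccatiConst_of_lt M hh]
    have e := integral_map (μ := Measure.pi S.noiseLaw) hmp.measurable.aemeasurable
      (f := fun w : Vec d => w ⬝ᵥ (S.riccati M (h + 1) *ᵥ w))
      (hmp.map_eq.symm ▸ i0.aestronglyMeasurable)
    rw [hmp.map_eq] at e
    simp only [Function.eval] at e
    rw [← e]
    simp
  -- the pathwise identity
  have path : ∀ w : Fin (H - 1) → Vec d, S.trajectoryCost M' π S.xinit (extendNoise (H := H) w) =
      S.riccatiValue M 0 S.xinit + ∑ h ∈ Finset.range (H - 1),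
        (S.excess M' M h (x w h) (u w h) + N h w + G h w) := by
    intro w
    -- The value function of `M` telescopes along the trajectory of the system `M'`, and at the last
    -- stage it is the terminal cost.
    have htel := Finset.sum_range_sub (fun h => S.riccatiValue M h (x w h)) (H - 1)
    have hterm : S.riccatiValue M (H - 1) (x w (H - 1)) =
        x w (H - 1) ⬝ᵥ (S.Q (H - 1) *ᵥ x w (H - 1)) := by
      rw [riccatiValue, riccati_terminal, riccatiConst_terminal, add_zero]
    have h0 : x w 0 = S.xinit := rfl
    rw [hterm, h0] at htel
    rw [trajectoryCost]
    change ∑ h ∈ Finset.range (H - 1), (x w h ⬝ᵥ (S.Q h *ᵥ x w h) + u w h ⬝ᵥ (S.R h *ᵥ u w h)) +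
      x w (H - 1) ⬝ᵥ (S.Q (H - 1) *ᵥ x w (H - 1)) = _
    rw [eq_add_of_sub_eq htel.symm, add_comm _ (S.riccatiValue M 0 S.xinit), add_left_comm,
      ← Finset.sum_add_distrib]
    congr 1
    refine Finset.sum_congr rfl fun h hh => ?_
    have hx1 : x w (h + 1) = M' *ᵥ Sum.elim (x w h) (u w h) + extendNoise (H := H) w h := rfl
    simp only [riccatiValue, excess, hN, hGdef, hx1]
    have hsymm : (M' *ᵥ Sum.elim (x w h) (u w h)) ⬝ᵥ
        ((S.riccati M (h + 1))ᵀ *ᵥ extendNoise (H := H) w h) = extendNoise (H := H) w h ⬝ᵥ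
          (S.riccati M (h + 1) *ᵥ (M' *ᵥ Sum.elim (x w h) (u w h))) := by
      rw [Matrix.mulVec_transpose, Matrix.dotProduct_mulVec, dotProduct_comm]
    simp only [Matrix.mulVec_add, Matrix.add_mulVec, dotProduct_add, add_dotProduct, hsymm]
    ring
  have hint : Integrable (fun w : Fin (H - 1) → Vec d =>
      S.trajectoryCost M' π S.xinit (extendNoise (H := H) w)) (Measure.pi S.noiseLaw) := by
    simp only [path]
    refine (integrable_const _).add (integrable_finsetSum _ fun h hh => ?_)
    have hh' : h + 1 < H := by have := Finset.mem_range.1 hh; omega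
    exact ((intE hh').add (hNint hh').1).add (hGint hh').1
  have hnn : ∀ w : Fin (H - 1) → Vec d,
      0 ≤ S.trajectoryCost M' π S.xinit (extendNoise (H := H) w) := by
    intro w
    refine add_nonneg (Finset.sum_nonneg fun h hh => ?_) (hS.Q_terminal.dot_nonneg _)
    have hh' : h + 1 < H := by have := Finset.mem_range.1 hh; omega
    exact add_nonneg ((hS.Q_posDef h hh').posSemidef.dot_nonneg _)
      ((hS.R_posDef h hh').posSemidef.dot_nonneg _)
  rw [policyCost, ← ofReal_integral_eq_lintegral_ofReal hint (Filter.Eventually.of_forall hnn)]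
  congr 1
  simp only [path]
  rw [integral_add (integrable_const _) (integrable_finsetSum _ fun h hh => by
    have hh' : h + 1 < H := by have := Finset.mem_range.1 hh; omega
    exact ((intE hh').add (hNint hh').1).add (hGint hh').1),
    integral_finsetSum _ fun h hh => by
      have hh' : h + 1 < H := by have := Finset.mem_range.1 hh; omega
      exact ((intE hh').add (hNint hh').1).add (hGint hh').1]
  simp only [integral_const, probReal_univ, smul_eq_mul, one_mul]
  congr 1
  refine Finset.sum_congr rfl fun h hh => ?_
  have hh' : h + 1 < H := by have := Finset.mem_range.1 hh; omega
  have e := integral_add ((intE hh').add (hNint hh').1) (hGint hh').1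
  simp only [Pi.add_apply] at e
  rw [e, integral_add (intE hh') (hNint hh').1, (hNint hh').2, (hGint hh').2, add_zero, add_zero]

end Play

end Model

end ContextualLQR

namespace ContextualLQR

/-! ### Widths and the regret of one episode. -/

lemma blockContext_mulVec {d m p q : ℕ} (c : Context d m p q) (x : Vec d) (u : Vec m) :
    blockContext c *ᵥ Sum.elim x u = Sum.elim (c.1 *ᵥ x) (c.2 *ᵥ u) := by
  rw [blockContext, Matrix.fromBlocks_mulVec]
  simp

lemma decode_mulVec {d m p q : ℕ} (Θ : Decoder d p q) (c : Context d m p q) (x : Vec d)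
    (u : Vec m) :
    decode Θ c *ᵥ Sum.elim x u = Θ *ᵥ Sum.elim (c.1 *ᵥ x) (c.2 *ᵥ u) := by
  rw [decode, ← Matrix.mulVec_mulVec, blockContext_mulVec]

lemma decode_sub {d m p q : ℕ} (Θ Θ' : Decoder d p q) (c : Context d m p q) :
    decode Θ c - decode Θ' c = decode (Θ - Θ') c := (Matrix.sub_mul _ _ _).symm

lemma sumElim_dotProduct_self {k l : Type*} [Fintype k] [Fintype l] (x : k → ℝ) (u : l → ℝ) :
    Sum.elim x u ⬝ᵥ Sum.elim x u = x ⬝ᵥ x + u ⬝ᵥ u := by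
  simp [dotProduct]

namespace Model

variable {d m p q H : ℕ} (S : Model d m p q H)

/-- The observation at stage `h` when the linear policy decoded with `Θ` is played. -/
noncomputable def obsAt (Θ : Decoder d p q) (c : Context d m p q) (w : Fin (H - 1) → Vec d)
    (h : ℕ) : Fin p ⊕ Fin q → ℝ :=
  Sum.elim
    (c.1 *ᵥ stateAt (decode S.Θstar c) (S.linearPolicy (decode Θ c)) S.xinit
      (extendNoise (H := H) w) h)
    (c.2 *ᵥ actionAt (decode S.Θstar c) (S.linearPolicy (decode Θ c)) S.xinit
      (extendNoise (H := H) w) h)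

/-- The sum over an episode of the squared norms of the observations, in the norm given by the
inverse of `V`. -/
noncomputable def width (V : Matrix (Fin p ⊕ Fin q) (Fin p ⊕ Fin q) ℝ) (Θ : Decoder d p q)
    (c : Context d m p q) (w : Fin (H - 1) → Vec d) : ℝ :=
  ∑ h ∈ Finset.range (H - 1), S.obsAt Θ c w h ⬝ᵥ (V⁻¹ *ᵥ S.obsAt Θ c w h)

/-- The expectation of `width` over the noise of the episode. -/
noncomputable def meanWidth (V : Matrix (Fin p ⊕ Fin q) (Fin p ⊕ Fin q) ℝ) (Θ : Decoder d p q)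
    (c : Context d m p q) : ℝ :=
  ∫ w, S.width V Θ c w ∂(Measure.pi S.noiseLaw)

variable {S}

section Measurability

variable {α : Type*} [MeasurableSpace α] {Θ : α → Decoder d p q} (hΘ : Measurable Θ)
  {c : α → Context d m p q} (hc : Measurable c) {w : α → Fin (H - 1) → Vec d} (hw : Measurable w)
include hΘ hc hw

lemma measurable_obsAt {h : ℕ} (hh : h + 1 < H) :
    Measurable fun a => S.obsAt (Θ a) (c a) (w a) h := by
  have hM : Measurable fun a => decode S.Θstar (c a) := measurable_decode measurable_const hc
  have hπ : ∀ h, h + 1 < H → Measurable fun a : α × ((Fin h → Vec d × Vec m) × Vec d) =>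
      S.linearPolicy (decode (Θ a.1) (c a.1)) h a.2.1 a.2.2 := fun h _ =>
    measurable_mulVec (S.measurable_gain
      (measurable_decode (hΘ.comp measurable_fst) (hc.comp measurable_fst)) h)
      (measurable_snd.comp measurable_snd)
  exact measurable_sumElim
    (measurable_mulVec (measurable_fst.comp hc)
      (measurable_stateAt hM hπ S.xinit hw (by omega)))
    (measurable_mulVec (measurable_snd.comp hc) (measurable_actionAt hM hπ S.xinit hw hh))

lemma measurable_width {V : α → Matrix (Fin p ⊕ Fin q) (Fin p ⊕ Fin q) ℝ} (hV : Measurable V) :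
    Measurable fun a => S.width (V a) (Θ a) (c a) (w a) := by
  refine Finset.measurable_sum _ fun h hh => ?_
  have hh' : h + 1 < H := by have := Finset.mem_range.1 hh; omega
  exact measurable_dotProduct (measurable_obsAt hΘ hc hw hh')
    (measurable_mulVec (measurable_matrix_inv hV) (measurable_obsAt hΘ hc hw hh'))

end Measurability

/-- Measurability of an integral in its parameters, needed for the adaptedness of `expWidth`. -/
lemma measurable_meanWidth {α : Type*} [MeasurableSpace α] (hS : ∀ h, IsProbabilityMeasure (S.noiseLaw h))
    {Θ : α → Decoder d p q} (hΘ : Measurable Θ)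
    {c : α → Context d m p q} (hc : Measurable c)
    {V : α → Matrix (Fin p ⊕ Fin q) (Fin p ⊕ Fin q) ℝ} (hV : Measurable V) :
    Measurable fun a => S.meanWidth (V a) (Θ a) (c a) := by
  have h : Measurable fun a : α × (Fin (H - 1) → Vec d) => S.width (V a.1) (Θ a.1) (c a.1) a.2 :=
    measurable_width (hΘ.comp measurable_fst) (hc.comp measurable_fst) measurable_snd
      (hV.comp measurable_fst)
  exact (h.stronglyMeasurable.integral_prod_right (ν := Measure.pi S.noiseLaw)).measurable

lemma width_nonneg {V : Matrix (Fin p ⊕ Fin q) (Fin p ⊕ Fin q) ℝ} (hV : V.PosDef)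
    (Θ : Decoder d p q) (c : Context d m p q) (w : Fin (H - 1) → Vec d) :
    0 ≤ S.width V Θ c w :=
  Finset.sum_nonneg fun _ _ => hV.inv.posSemidef.dot_nonneg _

variable {cq cx cΘ cw : ℝ}

/-- Compared with the true system itself, every action of every policy has nonnegative excess.
Attainment of the infimum is never needed. -/
lemma Assumptions.riccatiValue_le_optimalCost (hS : S.Assumptions cq cx cΘ cw) (hH : 1 ≤ H)
    {c : Context d m p q} (hc : c ∈ S.contextLaw.support) :
    ENNReal.ofReal (S.riccatiValue (decode S.Θstar c) 0 S.xinit) ≤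
      S.optimalCost (decode S.Θstar c) S.xinit := by
  refine le_iInf₂ fun π hπ => ?_
  rw [hS.policyCost_eq hc hπ hH (decode S.Θstar c)]
  refine ENNReal.ofReal_le_ofReal (le_add_of_nonneg_right (Finset.sum_nonneg fun h hh => ?_))
  have hh' : h + 1 < H := by have := Finset.mem_range.1 hh; omega
  exact integral_nonneg fun w => hS.excess_self_nonneg _ hh' _ _

section Episode

variable (hS : S.Assumptions cq cx cΘ cw) {c : Context d m p q} (hc : c ∈ S.contextLaw.support)
  {Θ : Decoder d p q} (hπ : S.IsPolicy (S.linearPolicy (decode Θ c)))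
include hS hc hπ

/-- Any comparison system yields a finite expression for the cost; the zero system will do. -/
lemma Assumptions.policyCost_ne_top (hH : 1 ≤ H) :
    S.policyCost (decode S.Θstar c) (S.linearPolicy (decode Θ c)) S.xinit ≠ ⊤ := by
  rw [hS.policyCost_eq hc hπ hH 0]
  exact ENNReal.ofReal_ne_top

lemma Assumptions.optimalCost_ne_top (hH : 1 ≤ H) :
    S.optimalCost (decode S.Θstar c) S.xinit ≠ ⊤ :=
  ne_top_of_le_ne_top (hS.policyCost_ne_top hc hπ hH) (iInf₂_le _ hπ)

lemma Assumptions.ae_obsAt_le (hH : 1 ≤ H) : ∀ᵐ w ∂(Measure.pi S.noiseLaw), ∀ h, h + 1 < H →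
    S.obsAt Θ c w h ⬝ᵥ S.obsAt Θ c w h ≤ cx ^ 2 := by
  filter_upwards [hS.ae_mem hc hπ hH] with w hw h hh
  rw [obsAt, sumElim_dotProduct_self]
  exact hS.context_le c hc _ ((hw h).1 (by omega)) _ ((hw h).2 hh)

lemma Assumptions.integrable_obsAt (hH : 1 ≤ H) {V : Matrix (Fin p ⊕ Fin q) (Fin p ⊕ Fin q) ℝ}
    (hV : V.PosDef) (hV1 : ∀ z, z ⬝ᵥ z ≤ z ⬝ᵥ (V *ᵥ z)) {h : ℕ} (hh : h + 1 < H) :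
    Integrable (fun w => S.obsAt Θ c w h ⬝ᵥ (V⁻¹ *ᵥ S.obsAt Θ c w h)) (Measure.pi S.noiseLaw) := by
  have := hS.prob_noise
  have hm := measurable_obsAt (S := S) (α := Fin (H - 1) → Vec d) (measurable_const (a := Θ))
    (measurable_const (a := c)) measurable_id hh
  refine Integrable.of_bound (measurable_dotProduct hm
    (measurable_mulVec measurable_const hm)).aestronglyMeasurable (cx ^ 2) ?_
  filter_upwards [hS.ae_obsAt_le hc hπ hH] with w hw
  rw [Real.norm_of_nonneg (hV.inv.posSemidef.dot_nonneg _)]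
  exact (dot_inv_le_dot hV hV1 _).trans (hw h hh)

lemma Assumptions.ae_width_le (hH : 1 ≤ H) {V : Matrix (Fin p ⊕ Fin q) (Fin p ⊕ Fin q) ℝ}
    (hV : V.PosDef) (hV1 : ∀ z, z ⬝ᵥ z ≤ z ⬝ᵥ (V *ᵥ z)) :
    ∀ᵐ w ∂(Measure.pi S.noiseLaw), S.width V Θ c w ≤ H * cx ^ 2 := by
  filter_upwards [hS.ae_obsAt_le hc hπ hH] with w hw
  calc S.width V Θ c w ≤ ∑ h ∈ Finset.range (H - 1), cx ^ 2 := by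
        refine Finset.sum_le_sum fun h hh => ?_
        have hh' : h + 1 < H := by have := Finset.mem_range.1 hh; omega
        exact (dot_inv_le_dot hV hV1 _).trans (hw h hh')
    _ = ((H - 1 : ℕ) : ℝ) * cx ^ 2 := by simp
    _ ≤ H * cx ^ 2 := by
        gcongr
        omega

/-- The regret of one episode. -/
lemma Assumptions.episode_regret_le (hH : 1 ≤ H) (hcq : 0 ≤ cq) (hcx : 0 ≤ cx)
    {V : Matrix (Fin p ⊕ Fin q) (Fin p ⊕ Fin q) ℝ}
    (hV : V.PosDef) (hV1 : ∀ z, z ⬝ᵥ z ≤ z ⬝ᵥ (V *ᵥ z))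
    (hΘ : ∀ h, h < H → spectralNorm (S.riccati (decode Θ c) h) ≤ cq)
    (hopt : S.riccatiValue (decode Θ c) 0 S.xinit ≤
      S.riccatiValue (decode S.Θstar c) 0 S.xinit)
    {B : ℝ} (hB0 : 0 ≤ B)
    (hB : ((S.Θstar - Θ) * V * (S.Θstar - Θ)ᵀ).trace ≤ B ^ 2) {t : ℝ} (ht : 0 < t) :
    (S.policyCost (decode S.Θstar c) (S.linearPolicy (decode Θ c)) S.xinit).toReal -
      (S.optimalCost (decode S.Θstar c) S.xinit).toReal ≤
        cq * cx * B * (t * S.meanWidth V Θ c + H * t⁻¹) := by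
  have := hS.prob_noise
  set M' := decode S.Θstar c with hM'
  set M := decode Θ c with hM
  set π := S.linearPolicy M with hπdef
  have hae := hS.ae_mem hc hπ hH
  have hint := fun {h} (hh : h + 1 < H) => hS.integrable_obsAt hc hπ hH hV hV1 hh
  have hexc : ∀ h ∈ Finset.range (H - 1), ∫ w, S.excess M' M h
      (stateAt M' π S.xinit (extendNoise (H := H) w) h)
      (actionAt M' π S.xinit (extendNoise (H := H) w) h) ∂(Measure.pi S.noiseLaw) ≤
      cq * cx * B * (t * ∫ w, S.obsAt Θ c w h ⬝ᵥ (V⁻¹ *ᵥ S.obsAt Θ c w h) ∂(Measure.pi S.noiseLaw) +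
        t⁻¹) := by
    intro h hhr
    have hh : h + 1 < H := by have := Finset.mem_range.1 hhr; omega
    have hrhs : ∫ w, cq * cx * B * (t * (S.obsAt Θ c w h ⬝ᵥ (V⁻¹ *ᵥ S.obsAt Θ c w h)) + t⁻¹)
        ∂(Measure.pi S.noiseLaw) = cq * cx * B *
          (t * ∫ w, S.obsAt Θ c w h ⬝ᵥ (V⁻¹ *ᵥ S.obsAt Θ c w h) ∂(Measure.pi S.noiseLaw) + t⁻¹) := by
      rw [integral_const_mul, integral_add ((hint hh).const_mul t) (integrable_const _),
        integral_const_mul]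
      simp
    rw [← hrhs]
    refine integral_mono_ae (hS.integrable_excess hc hπ hH M hh)
      ((((hint hh).const_mul t).add (integrable_const _)).const_mul _) ?_
    filter_upwards [hae] with w hw
    have hx := (hw h).1 (by omega)
    have hu := (hw h).2 hh
    have hxx := hS.state_action_le _ hx _ hu
    have huu := dot_self_nonneg' (actionAt M' π S.xinit (extendNoise (H := H) w) h)
    have hzz := hS.dot_add_dim_le hc hx hu ⟨h, by omega⟩
    have hd : (0 : ℝ) ≤ d := Nat.cast_nonneg d
    have h1 := hS.excess_gain_le hcq hcx M' M hh (hΘ h (by omega)) (hΘ (h + 1) hh) _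
      (by linarith : stateAt M' π S.xinit (extendNoise (H := H) w) h ⬝ᵥ
        stateAt M' π S.xinit (extendNoise (H := H) w) h ≤ cx ^ 2)
      (by
        change (M' *ᵥ Sum.elim _ (actionAt M' π S.xinit (extendNoise (H := H) w) h)) ⬝ᵥ
          (M' *ᵥ Sum.elim _ (actionAt M' π S.xinit (extendNoise (H := H) w) h)) ≤ cx ^ 2
        linarith)
    refine h1.trans ?_
    change 2 * cq * cx * √(((M' - M) *ᵥ
      Sum.elim _ (actionAt M' π S.xinit (extendNoise (H := H) w) h)) ⬝ᵥ
      ((M' - M) *ᵥ Sum.elim _ (actionAt M' π S.xinit (extendNoise (H := H) w) h))) ≤ _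
    rw [hM', hM, decode_sub, decode_mulVec]
    change 2 * cq * cx * √(((S.Θstar - Θ) *ᵥ S.obsAt Θ c w h) ⬝ᵥ
      ((S.Θstar - Θ) *ᵥ S.obsAt Θ c w h)) ≤ _
    have ha0 := hV.inv.posSemidef.dot_nonneg (S.obsAt Θ c w h)
    have h2 := mulVec_dot_le_trace_mul (S.Θstar - Θ) hV (S.obsAt Θ c w h)
    set a := S.obsAt Θ c w h ⬝ᵥ (V⁻¹ *ᵥ S.obsAt Θ c w h)
    have h3 : √(((S.Θstar - Θ) *ᵥ S.obsAt Θ c w h) ⬝ᵥ ((S.Θstar - Θ) *ᵥ S.obsAt Θ c w h)) ≤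
        B * √a := by
      rw [← Real.sqrt_sq hB0, ← Real.sqrt_mul (sq_nonneg B)]
      exact Real.sqrt_le_sqrt (h2.trans (mul_le_mul_of_nonneg_right hB ha0))
    -- This replaces Cauchy–Schwarz over stages, episodes and noise at once; `t` is optimized only
    -- at the end.
    have h4 : 2 * √a ≤ t * a + t⁻¹ := by
      have hs := Real.sq_sqrt ha0
      have : 0 ≤ t⁻¹ * (t * √a - 1) ^ 2 := mul_nonneg (inv_pos.2 ht).le (sq_nonneg _)
      have e : t⁻¹ * (t * √a - 1) ^ 2 = t * (√a) ^ 2 - 2 * √a + t⁻¹ := by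
        field_simp; ring
      rw [e, hs] at this
      linarith
    calc _ ≤ 2 * cq * cx * (B * √a) := by gcongr
      _ = cq * cx * B * (2 * √a) := by ring
      _ ≤ _ := by gcongr
  have hcost := hS.policyCost_eq hc hπ hH M
  have hfin := hS.optimalCost_ne_top hc hπ hH
  have hlow := hS.riccatiValue_le_optimalCost hH hc
  -- Passing to reals uses that the optimal cost is finite, as the played policy is itself a
  -- competitor.
  have hlow' : S.riccatiValue M' 0 S.xinit ≤ (S.optimalCost M' S.xinit).toReal :=
    (ENNReal.ofReal_le_iff_le_toReal hfin).1 hlow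
  have hup := Finset.sum_le_sum hexc
  rw [← Finset.mul_sum, Finset.sum_add_distrib, ← Finset.mul_sum,
    ← integral_finsetSum _ fun h hh => hint (by have := Finset.mem_range.1 hh; omega)] at hup
  change _ ≤ cq * cx * B * (t * S.meanWidth V Θ c + _) at hup
  have hcard : ∑ h ∈ Finset.range (H - 1), t⁻¹ ≤ H * t⁻¹ := by
    rw [Finset.sum_const, Finset.card_range, nsmul_eq_mul]
    have := (inv_pos.2 ht).le
    gcongr
    omega
  have hup' := hup.trans (mul_le_mul_of_nonneg_left (add_le_add_right hcard
    (t * S.meanWidth V Θ c)) (by positivity : 0 ≤ cq * cx * B))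
  have hmean : 0 ≤ S.meanWidth V Θ c := integral_nonneg fun w => width_nonneg hV Θ c w
  rw [hcost, ENNReal.toReal_ofReal']
  have hopt0 : 0 ≤ (S.optimalCost M' S.xinit).toReal := ENNReal.toReal_nonneg
  have hpos : 0 ≤ cq * cx * B * (t * S.meanWidth V Θ c + H * t⁻¹) := by positivity
  -- `toReal` of `ofReal` is a positive part; if it truncates, the left side is at most zero.
  rcases max_cases (S.riccatiValue M 0 S.xinit + ∑ h ∈ Finset.range (H - 1), ∫ w, S.excess M' M h
      (stateAt M' π S.xinit (extendNoise (H := H) w) h)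
      (actionAt M' π S.xinit (extendNoise (H := H) w) h) ∂(Measure.pi S.noiseLaw)) 0 with h | h
  · rw [h.1]; linarith
  · rw [h.1]; linarith

end Episode

end Model

end ContextualLQR

namespace ContextualLQR

/-! ### Gaussian mixtures and self-normalized sums. -/

section Scalar

lemma integral_exp_quadratic {a : ℝ} (ha : 0 < a) (β γ : ℝ) :
    Integrable (fun x : ℝ => Real.exp (γ + β * x - a / 2 * x ^ 2)) ∧
      ∫ x : ℝ, Real.exp (γ + β * x - a / 2 * x ^ 2) =
        Real.exp (γ + β ^ 2 / (2 * a)) * √(2 * Real.pi / a) := by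
  have e : (fun x : ℝ => Real.exp (γ + β * x - a / 2 * x ^ 2)) =
      fun x => Real.exp (γ + β ^ 2 / (2 * a)) *
        (fun y => Real.exp (-(a / 2) * y ^ 2)) (x - β / a) := by
    ext x
    rw [← Real.exp_add]
    congr 1
    field_simp
    ring
  have hi : Integrable (fun y : ℝ => Real.exp (-(a / 2) * y ^ 2)) :=
    integrable_exp_neg_mul_sq (by positivity)
  rw [e]
  refine ⟨(hi.comp_sub_right (β / a)).const_mul _, ?_⟩
  rw [integral_const_mul, integral_sub_right_eq_self (fun y : ℝ => Real.exp (-(a / 2) * y ^ 2)),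
    integral_gaussian]
  congr 2
  field_simp

/-- The method of mixtures with a one-dimensional Gaussian. -/
lemma lintegral_exp_quadratic_le {Ω : Type*} [MeasurableSpace Ω] {ν : Measure Ω} [SFinite ν]
    {X : Ω → ℝ} (hX : Measurable X) {σ : ℝ} (hσ : 0 < σ)
    (hsub : HasSubgaussianMGF X (Real.toNNReal (σ ^ 2)) ν) {a : ℝ} (ha : 0 ≤ a) (b : ℝ) :
    ∫⁻ ω, ENNReal.ofReal (Real.exp ((2 * b * X ω + a * X ω ^ 2 - b ^ 2) /
      (2 * σ ^ 2 * (1 + a)))) ∂ν ≤ ENNReal.ofReal √(1 + a) := by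
  have ha1 : 0 < 1 + a := by linarith
  -- For fixed `g`, the exponential of `l X / σ² - l² / (2 σ²)` has integral at most `1` by
  -- sub-Gaussianity. Integrating over a Gaussian `g` makes the exponent quadratic in `X`; the tilt
  -- `l` is affine in `g` so that center and spread produce the coefficients `b` and `a`.
  set l : ℝ → ℝ := fun g => b + √a * σ * g with hl
  set F : Ω → ℝ → ℝ := fun ω g => Real.exp (l g * X ω / σ ^ 2 - l g ^ 2 / (2 * σ ^ 2) - g ^ 2 / 2)
    with hF
  have hFm : Measurable fun p : Ω × ℝ => ENNReal.ofReal (F p.1 p.2) := by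
    have h1 : Measurable fun p : Ω × ℝ => X p.1 := hX.comp measurable_fst
    simp only [hF, hl]
    fun_prop
  have inner : ∀ ω, ∫⁻ g, ENNReal.ofReal (F ω g) =
      ENNReal.ofReal (Real.exp ((2 * b * X ω + a * X ω ^ 2 - b ^ 2) / (2 * σ ^ 2 * (1 + a)))) *
        ENNReal.ofReal √(2 * Real.pi / (1 + a)) := by
    intro ω
    obtain ⟨h1, h2⟩ := integral_exp_quadratic ha1 (√a * (X ω - b) / σ)
      (b * X ω / σ ^ 2 - b ^ 2 / (2 * σ ^ 2))
    have hs := Real.sq_sqrt ha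
    have e : F ω = fun g => Real.exp (b * X ω / σ ^ 2 - b ^ 2 / (2 * σ ^ 2) +
        √a * (X ω - b) / σ * g - (1 + a) / 2 * g ^ 2) := by
      ext g
      simp only [hF, hl]
      congr 1
      have : (b + √a * σ * g) ^ 2 = b ^ 2 + 2 * b * (√a * σ * g) + a * σ ^ 2 * g ^ 2 := by
        rw [add_sq, mul_pow, mul_pow, hs]
      rw [this]
      field_simp
      ring
    rw [e, ← ofReal_integral_eq_lintegral_ofReal h1
      (Filter.Eventually.of_forall fun _ => (Real.exp_pos _).le), h2,
      ENNReal.ofReal_mul (Real.exp_pos _).le]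
    congr 3
    rw [div_pow, mul_pow, hs]
    field_simp
    ring
  have outer : ∀ g, ∫⁻ ω, ENNReal.ofReal (F ω g) ∂ν ≤ ENNReal.ofReal (Real.exp (-(1 / 2) * g ^ 2)) := by
    intro g
    have hi := hsub.integrable_exp_mul (l g / σ ^ 2)
    have hm := hsub.mgf_le (l g / σ ^ 2)
    rw [mgf, Real.coe_toNNReal _ (sq_nonneg σ)] at hm
    have e : (fun ω => F ω g) = fun ω => Real.exp (- (l g ^ 2 / (2 * σ ^ 2)) - g ^ 2 / 2) *
        Real.exp (l g / σ ^ 2 * X ω) := by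
      ext ω
      rw [← Real.exp_add]
      simp only [hF]
      congr 1
      ring
    have e2 : ∫⁻ ω, ENNReal.ofReal (F ω g) ∂ν = ENNReal.ofReal (∫ ω, F ω g ∂ν) :=
      (ofReal_integral_eq_lintegral_ofReal (by rw [e]; exact hi.const_mul _)
        (Filter.Eventually.of_forall fun _ => (Real.exp_pos _).le)).symm
    rw [e2, e, integral_const_mul]
    refine ENNReal.ofReal_le_ofReal ((mul_le_mul_of_nonneg_left hm (Real.exp_pos _).le).trans ?_)
    rw [← Real.exp_add]
    refine (congrArg Real.exp ?_).le
    field_simp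
    ring
  have hswap := lintegral_lintegral_swap (μ := ν) (ν := volume) (f := fun ω g => ENNReal.ofReal (F ω g))
    hFm.aemeasurable
  simp only [inner] at hswap
  have hc0 : 0 < √(2 * Real.pi / (1 + a)) := Real.sqrt_pos.2 (by positivity)
  rw [lintegral_mul_const' _ _ ENNReal.ofReal_ne_top] at hswap
  have hle : ∫⁻ g, ∫⁻ ω, ENNReal.ofReal (F ω g) ∂ν ≤ ENNReal.ofReal √(2 * Real.pi) := by
    calc _ ≤ ∫⁻ g : ℝ, ENNReal.ofReal (Real.exp (-(1 / 2) * g ^ 2)) := lintegral_mono outer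
      _ = ENNReal.ofReal (∫ g : ℝ, Real.exp (-(1 / 2) * g ^ 2)) :=
        (ofReal_integral_eq_lintegral_ofReal (integrable_exp_neg_mul_sq (by norm_num))
          (Filter.Eventually.of_forall fun _ => (Real.exp_pos _).le)).symm
      _ = _ := by rw [integral_gaussian]; congr 2; ring
  rw [← hswap] at hle
  -- The Gaussian normalizations with variance `1` and `1 / (1 + a)` differ by the factor `√(1 + a)`
  -- of the bound.
  have hsplit : ENNReal.ofReal √(2 * Real.pi) =
      ENNReal.ofReal √(1 + a) * ENNReal.ofReal √(2 * Real.pi / (1 + a)) := by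
    rw [← ENNReal.ofReal_mul (Real.sqrt_nonneg _), ← Real.sqrt_mul ha1.le]
    congr 2
    field_simp
  rw [hsplit] at hle
  exact (ENNReal.mul_le_mul_iff_left (by simpa using hc0) ENNReal.ofReal_ne_top).1 hle

end Scalar

section SelfNormalized

variable {n : Type*} [Fintype n] [DecidableEq n]

/-- The exponential of the self-normalized square of `s`, for the matrix `V` and the noise
level `σ`. -/
noncomputable def expSelfNormalized (σ : ℝ) (V : Matrix n n ℝ) (s : n → ℝ) : ℝ≥0∞ :=
  ENNReal.ofReal (Real.exp (s ⬝ᵥ (V⁻¹ *ᵥ s) / (2 * σ ^ 2)) / √V.det)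

lemma measurable_expSelfNormalized {α : Type*} [MeasurableSpace α] (σ : ℝ) {V : α → Matrix n n ℝ}
    (hV : Measurable V) {s : α → n → ℝ} (hs : Measurable s) :
    Measurable fun a => expSelfNormalized σ (V a) (s a) := by
  have h1 := measurable_dotProduct hs (measurable_mulVec (measurable_matrix_inv hV) hs)
  have h2 := measurable_matrix_det hV
  unfold expSelfNormalized
  fun_prop

/-- One supermartingale step. By Sherman–Morrison the exponent grows by exactly the scalar
expression of `lintegral_exp_quadratic_le`, and the resulting `√(1 + a)` cancels against the growth
of `√(det V)`. -/
lemma lintegral_expSelfNormalized_le {Ω : Type*} [MeasurableSpace Ω] {ν : Measure Ω} [SFinite ν]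
    {X : Ω → ℝ} (hX : Measurable X) {σ : ℝ} (hσ : 0 < σ)
    (hsub : HasSubgaussianMGF X (Real.toNNReal (σ ^ 2)) ν) {V : Matrix n n ℝ} (hV : V.PosDef)
    (z s : n → ℝ) :
    ∫⁻ ω, expSelfNormalized σ (V + Matrix.vecMulVec z z) (s + X ω • z) ∂ν ≤
      expSelfNormalized σ V s := by
  set a := z ⬝ᵥ (V⁻¹ *ᵥ z) with ha
  set b := z ⬝ᵥ (V⁻¹ *ᵥ s) with hb
  have ha0 : 0 ≤ a := hV.inv.posSemidef.dot_nonneg z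
  have ha1 : 0 < 1 + a := by linarith
  have hdet := hV.det_pos
  have hc : s ⬝ᵥ (V⁻¹ *ᵥ z) = b := hV.inv.isHermitian.dot_comm s z
  have e : ∀ ω, expSelfNormalized σ (V + Matrix.vecMulVec z z) (s + X ω • z) =
      ENNReal.ofReal (Real.exp ((2 * b * X ω + a * X ω ^ 2 - b ^ 2) / (2 * σ ^ 2 * (1 + a)))) *
        (expSelfNormalized σ V s * ENNReal.ofReal (√(1 + a))⁻¹) := by
    intro ω
    rw [expSelfNormalized, expSelfNormalized, dot_inv_add_vecMulVec hV, det_add_vecMulVec hV,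
      ← ENNReal.ofReal_mul (by positivity), ← ENNReal.ofReal_mul (by positivity)]
    simp only [Matrix.mulVec_add, Matrix.mulVec_smul, dotProduct_add, add_dotProduct,
      smul_dotProduct, dotProduct_smul, smul_eq_mul, ← ha, ← hb, hc]
    rw [Real.sqrt_mul hdet.le]
    congr 1
    have : (s ⬝ᵥ V⁻¹ *ᵥ s + X ω * b + X ω * (b + X ω * a) - (b + X ω * a) ^ 2 / (1 + a)) /
        (2 * σ ^ 2) = (2 * b * X ω + a * X ω ^ 2 - b ^ 2) / (2 * σ ^ 2 * (1 + a)) +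
          s ⬝ᵥ V⁻¹ *ᵥ s / (2 * σ ^ 2) := by
      field_simp
      ring
    have h2 := (Real.sqrt_pos.2 ha1).ne'
    have h3 := (Real.sqrt_pos.2 hdet).ne'
    rw [this, Real.exp_add]; field_simp
  have hne : expSelfNormalized σ V s * ENNReal.ofReal (√(1 + a))⁻¹ ≠ ⊤ :=
    ENNReal.mul_ne_top ENNReal.ofReal_ne_top ENNReal.ofReal_ne_top
  simp only [e]
  rw [lintegral_mul_const' _ _ hne]
  refine (mul_le_mul_left (lintegral_exp_quadratic_le hX hσ hsub ha0 b) _).trans ?_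
  rw [mul_left_comm, ← ENNReal.ofReal_mul (Real.sqrt_nonneg _),
    mul_inv_cancel₀ (Real.sqrt_pos.2 ha1).ne', ENNReal.ofReal_one, mul_one]

end SelfNormalized

end ContextualLQR

namespace ContextualLQR

/-! ### Independence and the maximal inequality. -/

section Independence

variable {Ω A B C : Type*} {mΩ : MeasurableSpace Ω} {mA : MeasurableSpace A}
  {mB : MeasurableSpace B} {mC : MeasurableSpace C} {P : Measure Ω}

lemma indepFun_prodMk_left [IsProbabilityMeasure P] {f : Ω → A} {g : Ω → B} {h : Ω → C}
    (hf : Measurable f) (hg : Measurable g) (hh : Measurable h)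
    (h1 : IndepFun f (fun ω => (g ω, h ω)) P) (h2 : IndepFun g h P) :
    IndepFun (fun ω => (f ω, g ω)) h P := by
  have h3 : IndepFun f g P := h1.comp measurable_id measurable_fst
  rw [indepFun_iff_map_prod_eq_prod_map_map (by fun_prop) (by fun_prop)] at h1 h2 h3 ⊢
  rw [h2] at h1
  have := Measure.isProbabilityMeasure_map (μ := P) hf.aemeasurable
  have := Measure.isProbabilityMeasure_map (μ := P) hg.aemeasurable
  have := Measure.isProbabilityMeasure_map (μ := P) hh.aemeasurable
  have e : (fun ω => ((f ω, g ω), h ω)) =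
      MeasurableEquiv.prodAssoc.symm ∘ fun ω => (f ω, (g ω, h ω)) := rfl
  rw [e, ← Measure.map_map MeasurableEquiv.prodAssoc.symm.measurable (by fun_prop), h1, h3,
    ← (measurePreserving_prodAssoc (P.map f) (P.map g) (P.map h)).map_eq, Measure.map_map
      MeasurableEquiv.prodAssoc.symm.measurable MeasurableEquiv.prodAssoc.measurable]
  simp

/-- A σ-algebra `m` is generated by the identity map into `Ω` equipped with `m`, so the statement
for random variables applies. -/
lemma indep_sup_comap [IsProbabilityMeasure P] {g : Ω → B} {h : Ω → C}
    (hg : Measurable g) (hh : Measurable h) {m : MeasurableSpace Ω} (hm : m ≤ mΩ)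
    (h1 : Indep m (MeasurableSpace.comap (fun ω => (g ω, h ω)) inferInstance) P)
    (h2 : IndepFun g h P) : Indep (m ⊔ mB.comap g) (mC.comap h) P := by
  have h3 : @IndepFun Ω Ω (B × C) mΩ m _ id (fun ω => (g ω, h ω)) P := by
    rw [@IndepFun_iff_Indep Ω Ω (B × C) mΩ m, MeasurableSpace.comap_id]
    exact h1
  have h4 := @indepFun_prodMk_left Ω Ω B C mΩ m mB mC P _ id g h (measurable_id'' hm) hg hh h3 h2
  rw [@IndepFun_iff_Indep Ω (Ω × B) C mΩ (@Prod.instMeasurableSpace Ω B m mB)] at h4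
  refine indep_of_indep_of_le_left h4 (le_of_eq ?_)
  refine Eq.trans ?_ (MeasurableSpace.comap_prodMk (mβ := m) (mγ := mB) id g).symm
  rw [MeasurableSpace.comap_id]

/-- Integrating out an independent variable. -/
lemma lintegral_of_indepFun [IsProbabilityMeasure P] {Y : Ω → A} {X : Ω → B} (hY : Measurable Y)
    (hX : Measurable X) (h : IndepFun Y X P) {F : A × B → ℝ≥0∞} (hF : Measurable F) :
    ∫⁻ ω, F (Y ω, X ω) ∂P = ∫⁻ ω, ∫⁻ x, F (Y ω, x) ∂(P.map X) ∂P := by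
  have := Measure.isProbabilityMeasure_map (μ := P) hX.aemeasurable
  rw [indepFun_iff_map_prod_eq_prod_map_map hY.aemeasurable hX.aemeasurable] at h
  rw [← lintegral_map hF (hY.prodMk hX), h, lintegral_prod _ hF.aemeasurable,
    lintegral_map hF.lintegral_prod_right' hY]

lemma ae_of_indepFun [IsProbabilityMeasure P] {Y : Ω → A} {X : Ω → B} (hY : Measurable Y)
    (hX : Measurable X) (h : IndepFun Y X P) {p : A × B → Prop} (hp : MeasurableSet {a | p a})
    (hae : ∀ᵐ ω ∂P, ∀ᵐ x ∂(P.map X), p (Y ω, x)) : ∀ᵐ ω ∂P, p (Y ω, X ω) := by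
  have h0 := lintegral_of_indepFun hY hX h (F := {a | p a}ᶜ.indicator 1)
    (measurable_one.indicator hp.compl)
  have h1 : ∀ᵐ ω ∂P, ∫⁻ x, {a | p a}ᶜ.indicator 1 (Y ω, x) ∂(P.map X) = 0 := by
    filter_upwards [hae] with ω hω
    rw [← lintegral_zero (μ := P.map X)]
    refine lintegral_congr_ae ?_
    filter_upwards [hω] with x hx
    simp [hx]
  rw [lintegral_congr_ae h1, lintegral_zero] at h0
  have h2 := (lintegral_eq_zero_iff ((measurable_one.indicator hp.compl).comp (hY.prodMk hX))).1 h0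
  filter_upwards [h2] with ω hω
  by_contra hn
  simp [Set.indicator, hn] at hω

end Independence

/-- Ville's maximal inequality for a nonnegative supermartingale over a finite horizon. -/
lemma mul_measure_exists_le_le {Ω : Type*} [mΩ : MeasurableSpace Ω] {P : Measure Ω}
    {F : ℕ → MeasurableSpace Ω} (hmono : Monotone F) {K : ℕ} (hF : ∀ k ≤ K, F k ≤ mΩ)
    {M : ℕ → Ω → ℝ≥0∞} (hM : ∀ k ≤ K, Measurable[F k] (M k))
    (hsuper : ∀ k < K, ∀ A, MeasurableSet[F k] A → ∫⁻ ω in A, M (k + 1) ω ∂P ≤ ∫⁻ ω in A, M k ω ∂P)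
    (a : ℝ≥0∞) : a * P {ω | ∃ k ≤ K, a ≤ M k ω} ≤ ∫⁻ ω, M 0 ω ∂P := by
  have hlt : ∀ k ≤ K, ∀ j ≤ k, MeasurableSet[F k] {ω | M j ω < a} := fun k hk j hj =>
    hmono hj _ (hM j (hj.trans hk) measurableSet_Iio)
  have hS : ∀ k ≤ K, MeasurableSet[F k] {ω | ∀ j ≤ k, M j ω < a} := by
    intro k hk
    have : {ω | ∀ j ≤ k, M j ω < a} = ⋂ j ∈ Finset.range (k + 1), {ω | M j ω < a} := by
      ext ω; simp
    rw [this]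
    exact Finset.measurableSet_biInter _ fun j hj =>
      hlt k hk j (Nat.lt_succ_iff.1 (Finset.mem_range.1 hj))
  -- This invariant freezes the process at its first passage above `a`: the first term accounts for
  -- paths that have crossed, the second for the others.
  have key : ∀ k ≤ K, a * P {ω | ∃ j ≤ k, a ≤ M j ω} +
      ∫⁻ ω in {ω | ∀ j ≤ k, M j ω < a}, M k ω ∂P ≤ ∫⁻ ω, M 0 ω ∂P := by
    intro k
    induction k with
    | zero =>
      intro hk
      have h0 := hF 0 hk _ (hS 0 hk)
      have e : {ω | ∃ j ≤ 0, a ≤ M j ω} = {ω | ∀ j ≤ 0, M j ω < a}ᶜ := by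
        ext ω; simp
      rw [e, ← lintegral_add_compl (μ := P) (M 0) h0,
        add_comm (∫⁻ ω in {ω | ∀ j ≤ 0, M j ω < a}, M 0 ω ∂P)]
      refine add_le_add ?_ le_rfl
      rw [← setLIntegral_const]
      refine setLIntegral_mono' h0.compl fun ω hω => ?_
      simpa using hω
    | succ k ih =>
      intro hk
      have hk' : k < K := hk
      have ih' := ih hk'.le
      refine le_trans ?_ ih'
      set A := {ω | ∀ j ≤ k, M j ω < a} with hA
      have hAm := hF k hk'.le _ (hS k hk'.le)
      have hBm := hF (k + 1) hk _ (hlt (k + 1) hk (k + 1) le_rfl)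
      have e1 : {ω | ∃ j ≤ k + 1, a ≤ M j ω} =
          {ω | ∃ j ≤ k, a ≤ M j ω} ∪ (A ∩ {ω | M (k + 1) ω < a}ᶜ) := by
        ext ω
        simp only [hA, Set.mem_ofPred_eq, Set.mem_union, Set.mem_inter_iff, Set.mem_compl_iff, not_lt]
        constructor
        · rintro ⟨j, hj, h⟩
          by_cases hex : ∃ j ≤ k, a ≤ M j ω
          · exact Or.inl hex
          · push Not at hex
            rcases Nat.lt_or_ge j (k + 1) with hj' | hj'
            · exact absurd h (not_le.2 (hex j (Nat.lt_succ_iff.1 hj')))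
            · exact Or.inr ⟨hex, le_antisymm hj hj' ▸ h⟩
        · rintro (⟨j, hj, h⟩ | ⟨_, h⟩)
          · exact ⟨j, hj.trans (Nat.le_succ k), h⟩
          · exact ⟨k + 1, le_rfl, h⟩
      have e2 : {ω | ∀ j ≤ k + 1, M j ω < a} = A ∩ {ω | M (k + 1) ω < a} := by
        ext ω
        simp only [hA, Set.mem_ofPred_eq, Set.mem_inter_iff]
        constructor
        · exact fun h => ⟨fun j hj => h j (hj.trans (Nat.le_succ k)), h _ le_rfl⟩
        · rintro ⟨h1, h2⟩ j hj
          rcases Nat.lt_or_ge j (k + 1) with hj' | hj'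
          · exact h1 j (Nat.lt_succ_iff.1 hj')
          · exact le_antisymm hj hj' ▸ h2
      have h1 : a * P (A ∩ {ω | M (k + 1) ω < a}ᶜ) ≤
          ∫⁻ ω in A ∩ {ω | M (k + 1) ω < a}ᶜ, M (k + 1) ω ∂P := by
        rw [← setLIntegral_const]
        refine setLIntegral_mono' (hAm.inter hBm.compl) fun ω hω => ?_
        simpa using hω.2
      have h2 : ∫⁻ ω in A ∩ {ω | M (k + 1) ω < a}, M (k + 1) ω ∂P +
          ∫⁻ ω in A ∩ {ω | M (k + 1) ω < a}ᶜ, M (k + 1) ω ∂P = ∫⁻ ω in A, M (k + 1) ω ∂P := by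
        have := lintegral_inter_add_sdiff (μ := P) (M (k + 1)) A hBm
        rwa [Set.sdiff_eq] at this
      calc _ ≤ a * P {ω | ∃ j ≤ k, a ≤ M j ω} + a * P (A ∩ {ω | M (k + 1) ω < a}ᶜ) +
            ∫⁻ ω in A ∩ {ω | M (k + 1) ω < a}, M (k + 1) ω ∂P := by
              rw [e1, e2, ← mul_add]
              gcongr
              exact measure_union_le _ _
        _ ≤ a * P {ω | ∃ j ≤ k, a ≤ M j ω} + (∫⁻ ω in A ∩ {ω | M (k + 1) ω < a}, M (k + 1) ω ∂P +
            ∫⁻ ω in A ∩ {ω | M (k + 1) ω < a}ᶜ, M (k + 1) ω ∂P) := by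
              rw [add_assoc, add_comm (∫⁻ ω in A ∩ {ω | M (k + 1) ω < a}, M (k + 1) ω ∂P)]
              gcongr
        _ ≤ _ := by
              rw [h2]
              exact add_le_add le_rfl (hsuper k hk' A (hS k hk'.le))
  exact (le_add_right le_rfl).trans (key K le_rfl)

/-! ### Exponential inequalities within one episode. -/

namespace Model

variable {d m p q H : ℕ} {S : Model d m p q H} {cq cx cΘ cw : ℝ}

lemma obsAt_update (Θ : Decoder d p q) (c : Context d m p q) (w : Fin (H - 1) → Vec d)
    (i : Fin (H - 1)) (y : Vec d) {h : ℕ} (hh : h ≤ i) :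
    S.obsAt Θ c (Function.update w i y) h = S.obsAt Θ c w h := by
  simp only [obsAt, stateAt, actionAt, rollout_update (H := H) _ _ _ w i y hh]

/-- Playing one episode does not increase the exponential of the self-normalized square. -/
lemma Assumptions.lintegral_episode_le (hS : S.Assumptions cq cx cΘ cw) (hcw : 0 < cw)
    (Θ : Decoder d p q) (c : Context d m p q) {V : Matrix (Fin p ⊕ Fin q) (Fin p ⊕ Fin q) ℝ}
    (hV : V.PosDef) (s : Fin p ⊕ Fin q → ℝ) (i : Fin d) :
    ∫⁻ w, expSelfNormalized cw
      (V + ∑ h ∈ Finset.range (H - 1), Matrix.vecMulVec (S.obsAt Θ c w h) (S.obsAt Θ c w h))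
      (s + ∑ h ∈ Finset.range (H - 1), extendNoise (H := H) w h i • S.obsAt Θ c w h)
        ∂(Measure.pi S.noiseLaw) ≤ expSelfNormalized cw V s := by
  have := hS.prob_noise
  suffices ∀ n ≤ H - 1, ∫⁻ w, expSelfNormalized cw
      (V + ∑ h ∈ Finset.range n, Matrix.vecMulVec (S.obsAt Θ c w h) (S.obsAt Θ c w h))
      (s + ∑ h ∈ Finset.range n, extendNoise (H := H) w h i • S.obsAt Θ c w h)
        ∂(Measure.pi S.noiseLaw) ≤ expSelfNormalized cw V s from this _ le_rfl
  intro n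
  induction n with
  | zero => intro _; simp
  | succ n ih =>
    intro hn
    refine le_trans ?_ (ih (by omega))
    have hm : ∀ h, h < H - 1 → Measurable fun w : Fin (H - 1) → Vec d => S.obsAt Θ c w h :=
      fun h hh => measurable_obsAt (S := S) (α := Fin (H - 1) → Vec d) (measurable_const (a := Θ))
        (measurable_const (a := c)) measurable_id (by omega)
    have hnoise : ∀ h, Measurable fun w : Fin (H - 1) → Vec d => extendNoise (H := H) w h i :=
      fun h => (measurable_pi_apply i).comp (measurable_extendNoise measurable_id h)
    rw [lintegral_pi_update (⟨n, by omega⟩ : Fin (H - 1))]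
    -- With all other noise vectors fixed, the matrix `V'`, the sum `s'` and the observation at
    -- stage `n` do not depend on the resampled vector `y`, so the one-step bound applies.
    · refine lintegral_mono fun w => ?_
      set V' := V + ∑ h ∈ Finset.range n, Matrix.vecMulVec (S.obsAt Θ c w h) (S.obsAt Θ c w h)
      have hV' : V'.PosDef := hV.add_posSemidef
        (Matrix.posSemidef_sum _ fun h _ => posSemidef_vecMulVec _)
      set s' := s + ∑ h ∈ Finset.range n, extendNoise (H := H) w h i • S.obsAt Θ c w h
      refine le_trans (le_of_eq ?_) (lintegral_expSelfNormalized_le (measurable_pi_apply i) hcw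
        (hS.noise_subGaussian ⟨n, by omega⟩ i) hV' (S.obsAt Θ c w n) s')
      refine lintegral_congr fun y => ?_
      have e1 : ∀ h ≤ n, S.obsAt Θ c (Function.update w ⟨n, by omega⟩ y) h = S.obsAt Θ c w h :=
        fun h hh => obsAt_update Θ c w ⟨n, by omega⟩ y hh
      have e2 : ∀ h < n, extendNoise (H := H) (Function.update w ⟨n, by omega⟩ y) h =
          extendNoise (H := H) w h := by
        intro h hh
        rw [extendNoise_of_lt _ (by omega), extendNoise_of_lt _ (by omega), Function.update_of_ne]
        intro he
        have := congrArg Fin.val he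
        simp at this
        omega
      have e3 : extendNoise (H := H) (Function.update w ⟨n, by omega⟩ y) n = y := by
        rw [extendNoise_of_lt _ (by omega), Function.update_self]
      rw [Finset.sum_range_succ, Finset.sum_range_succ, e1 n le_rfl, e3, ← add_assoc, ← add_assoc,
        Finset.sum_congr rfl fun h hh => by rw [e1 h (Finset.mem_range.1 hh).le],
        Finset.sum_congr (f := fun h => _ • _) rfl fun h hh => by
          rw [e1 h (Finset.mem_range.1 hh).le, e2 h (Finset.mem_range.1 hh)]]
    · refine measurable_expSelfNormalized cw (measurable_const.add (Finset.measurable_sum _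
        fun h hh => ?_)) (measurable_const.add (Finset.measurable_sum _ fun h hh => ?_))
      · have := hm h (by have := Finset.mem_range.1 hh; omega)
        exact measurable_vecMulVec this this
      · exact (hnoise h).smul (hm h (by have := Finset.mem_range.1 hh; omega))

/-- The exponential inequality that compares the expected width of an episode with its realized
width. -/
lemma Assumptions.lintegral_exp_neg_width_le (hS : S.Assumptions cq cx cΘ cw)
    {c : Context d m p q} (hc : c ∈ S.contextLaw.support) {Θ : Decoder d p q}
    (hπ : S.IsPolicy (S.linearPolicy (decode Θ c))) (hH : 1 ≤ H) (hcx : 0 < cx)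
    {V : Matrix (Fin p ⊕ Fin q) (Fin p ⊕ Fin q) ℝ} (hV : V.PosDef)
    (hV1 : ∀ z, z ⬝ᵥ z ≤ z ⬝ᵥ (V *ᵥ z)) :
    ∫⁻ w, ENNReal.ofReal (Real.exp (S.meanWidth V Θ c / (2 * (H * cx ^ 2)) -
      S.width V Θ c w / (H * cx ^ 2))) ∂(Measure.pi S.noiseLaw) ≤ 1 := by
  have := hS.prob_noise
  have hH0 : (0 : ℝ) < H := by exact_mod_cast hH
  set b := (H : ℝ) * cx ^ 2 with hb
  have hb0 : 0 < b := by positivity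
  have hle := hS.ae_width_le hc hπ hH hV hV1
  have hm : Measurable fun w => S.width V Θ c w :=
    measurable_width (α := Fin (H - 1) → Vec d) measurable_const measurable_const measurable_id
      measurable_const
  have hint : Integrable (fun w => S.width V Θ c w) (Measure.pi S.noiseLaw) := by
    refine Integrable.of_bound hm.aestronglyMeasurable b ?_
    filter_upwards [hle] with w hw
    rwa [Real.norm_of_nonneg (width_nonneg hV Θ c w)]
  -- For `y` in `[0, 1]`, `exp (-y) ≤ 1 / (1 + y) ≤ 1 - y / 2`. Dividing the width by its bound `b`
  -- puts it in that range.
  have hpt : ∀ᵐ w ∂(Measure.pi S.noiseLaw),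
      Real.exp (S.meanWidth V Θ c / (2 * b) - S.width V Θ c w / b) ≤
        Real.exp (S.meanWidth V Θ c / (2 * b)) * (1 - S.width V Θ c w / (2 * b)) := by
    filter_upwards [hle] with w hw
    rw [sub_eq_add_neg, Real.exp_add]
    refine mul_le_mul_of_nonneg_left ?_ (Real.exp_pos _).le
    have h0 := width_nonneg (S := S) hV Θ c w
    set y := S.width V Θ c w / b with hy
    have hy0 : 0 ≤ y := by positivity
    have hy1 : y ≤ 1 := (div_le_one hb0).2 hw
    have e : S.width V Θ c w / (2 * b) = y / 2 := by rw [hy]; field_simp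
    rw [e]
    have h1 := Real.add_one_le_exp y
    rw [Real.exp_neg, inv_le_comm₀ (Real.exp_pos y) (by linarith)]
    refine le_trans ?_ h1
    rw [inv_le_iff_one_le_mul₀ (by linarith)]
    nlinarith
  have hint2 : Integrable (fun w => Real.exp (S.meanWidth V Θ c / (2 * b)) *
      (1 - S.width V Θ c w / (2 * b))) (Measure.pi S.noiseLaw) :=
    ((integrable_const _).sub (hint.div_const _)).const_mul _
  calc _ ≤ ∫⁻ w, ENNReal.ofReal (Real.exp (S.meanWidth V Θ c / (2 * b)) *
        (1 - S.width V Θ c w / (2 * b))) ∂(Measure.pi S.noiseLaw) := by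
        refine lintegral_mono_ae ?_
        filter_upwards [hpt] with w hw using ENNReal.ofReal_le_ofReal hw
    _ = ENNReal.ofReal (∫ w, Real.exp (S.meanWidth V Θ c / (2 * b)) *
        (1 - S.width V Θ c w / (2 * b)) ∂(Measure.pi S.noiseLaw)) := by
        refine (ofReal_integral_eq_lintegral_ofReal hint2 ?_).symm
        filter_upwards [hpt] with w hw using (Real.exp_pos _).le.trans hw
    _ = ENNReal.ofReal (Real.exp (S.meanWidth V Θ c / (2 * b)) *
        (1 - S.meanWidth V Θ c / (2 * b))) := by
        rw [integral_const_mul, integral_sub (integrable_const _) (hint.div_const _),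
          integral_div]
        simp [meanWidth]
    _ ≤ 1 := by
        rw [ENNReal.ofReal_le_one]
        -- After integration, the factor `1 - mean / (2 b)` is absorbed by the compensating
        -- exponential.
        have h1 := Real.add_one_le_exp (-(S.meanWidth V Θ c / (2 * b)))
        calc _ ≤ Real.exp (S.meanWidth V Θ c / (2 * b)) * Real.exp (-(S.meanWidth V Θ c / (2 * b))) :=
              mul_le_mul_of_nonneg_left (by linarith) (Real.exp_pos _).le
          _ = 1 := by rw [← Real.exp_add, add_neg_cancel, Real.exp_zero]

end Model

end ContextualLQR

namespace ContextualLQR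

/-! ### The two supermartingales indexed by episodes. -/

namespace Run

variable {d m p q H : ℕ} {Ω : Type*} (r : Run d m p q H Ω) (S : Model d m p q H)

/-- The sum of the observations before episode `k`, weighted by a coordinate of the noise. -/
noncomputable def noiseSum (k : ℕ) (i : Fin d) (ω : Ω) : Fin p ⊕ Fin q → ℝ :=
  ∑ j ∈ Finset.range k, ∑ h ∈ Finset.range (H - 1),
    extendNoise (H := H) (r.noise j ω) h i • r.obs S j h ω

variable {r S}

lemma V_zero (ω : Ω) : r.V S 0 ω = 1 := by simp [V]

lemma V_succ (k : ℕ) (ω : Ω) : r.V S (k + 1) ω = r.V S k ω +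
    ∑ h ∈ Finset.range (H - 1), Matrix.vecMulVec (r.obs S k h ω) (r.obs S k h ω) := by
  rw [V, V, Finset.sum_range_succ, add_assoc]

lemma noiseSum_succ (k : ℕ) (i : Fin d) (ω : Ω) : r.noiseSum S (k + 1) i ω = r.noiseSum S k i ω +
    ∑ h ∈ Finset.range (H - 1), extendNoise (H := H) (r.noise k ω) h i • r.obs S k h ω := by
  rw [noiseSum, noiseSum, Finset.sum_range_succ]

lemma V_posDef (k : ℕ) (ω : Ω) : (r.V S k ω).PosDef :=
  Matrix.PosDef.one.add_posSemidef (Matrix.posSemidef_sum _ fun _ _ =>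
    Matrix.posSemidef_sum _ fun _ _ => posSemidef_vecMulVec _)

/-- The ridge term makes widths bounded by plain squared lengths, whatever has been observed. -/
lemma dot_le_dot_V (k : ℕ) (ω : Ω) (z : Fin p ⊕ Fin q → ℝ) : z ⬝ᵥ z ≤ z ⬝ᵥ (r.V S k ω *ᵥ z) := by
  rw [V, Matrix.add_mulVec, Matrix.one_mulVec, dotProduct_add]
  exact le_add_of_nonneg_right (Matrix.PosSemidef.dot_nonneg (Matrix.posSemidef_sum _ fun _ _ =>
    Matrix.posSemidef_sum _ fun _ _ => posSemidef_vecMulVec _) z)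

section

variable {mΩ : MeasurableSpace Ω} {k : ℕ} (hΘ : ∀ j < k, Measurable (r.Θopt j))
  (hc : ∀ j < k, Measurable (r.ctx j)) (hw : ∀ j < k, Measurable (r.noise j))
include hΘ hc hw

lemma measurable_obs {j h : ℕ} (hj : j < k) (hh : h + 1 < H) : Measurable (r.obs S j h) :=
  Model.measurable_obsAt (hΘ j hj) (hc j hj) (hw j hj) hh

/-- The σ-algebra on `Ω` is a variable here because it will be taken to be `r.past k`; only the
first `k` episodes matter. -/
lemma measurable_V : Measurable (r.V S k) := by
  refine measurable_const.add (Finset.measurable_sum _ fun j hj => Finset.measurable_sum _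
    fun h hh => ?_)
  have := measurable_obs (S := S) hΘ hc hw (h := h) (Finset.mem_range.1 hj)
    (by have := Finset.mem_range.1 hh; omega)
  exact measurable_vecMulVec this this

lemma measurable_noiseSum (i : Fin d) : Measurable (r.noiseSum S k i) := by
  refine Finset.measurable_sum _ fun j hj => Finset.measurable_sum _ fun h hh => ?_
  have := measurable_obs (S := S) hΘ hc hw (h := h) (Finset.mem_range.1 hj)
    (by have := Finset.mem_range.1 hh; omega)
  exact Measurable.smul ((measurable_pi_apply i).comp
    (measurable_extendNoise (hw j (Finset.mem_range.1 hj)) h)) this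

end

/-- A weight, with the data that determine the law of the growth of `expNoise` in an episode. -/
abbrev NoiseData (d m p q : ℕ) := ℝ≥0∞ × Matrix (Fin p ⊕ Fin q) (Fin p ⊕ Fin q) ℝ ×
  (Fin p ⊕ Fin q → ℝ) × Decoder d p q × Context d m p q

/-- A weight, with the data that determine the law of the growth of `expWidth` in an episode. -/
abbrev WidthData (d m p q : ℕ) := ℝ≥0∞ × Matrix (Fin p ⊕ Fin q) (Fin p ⊕ Fin q) ℝ ×
  Decoder d p q × Context d m p q

variable (r S) in
/-- The sum over the coordinates of the exponentials of the self-normalized squares. -/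
noncomputable def expNoise (σ : ℝ) (k : ℕ) (ω : Ω) : ℝ≥0∞ :=
  ∑ i, expSelfNormalized σ (r.V S k ω) (r.noiseSum S k i ω)

variable (r S) in
/-- The exponential of the accumulated difference of (half of) the expected and the realized
widths of the episodes, in units of `b`. -/
noncomputable def expWidth (b : ℝ) (k : ℕ) (ω : Ω) : ℝ≥0∞ :=
  ENNReal.ofReal (Real.exp (∑ j ∈ Finset.range k,
    (S.meanWidth (r.V S j ω) (r.Θopt j ω) (r.ctx j ω) / (2 * b) -
      S.width (r.V S j ω) (r.Θopt j ω) (r.ctx j ω) (r.noise j ω) / b)))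

variable (r) in
/-- The information in the episodes before `k`. -/
@[reducible] def past (k : ℕ) : MeasurableSpace Ω :=
  ⨆ j ∈ Finset.range k,
    MeasurableSpace.comap (fun ω => (r.ctx j ω, r.noise j ω)) inferInstance

lemma past_mono : Monotone r.past := fun _ _ h =>
  biSup_mono fun _ hj => Finset.mem_range.2 ((Finset.mem_range.1 hj).trans_le h)

lemma comap_le_past {j k : ℕ} (hj : j < k) :
    MeasurableSpace.comap (fun ω => (r.ctx j ω, r.noise j ω)) inferInstance ≤ r.past k :=
  le_biSup (fun j => MeasurableSpace.comap (fun ω => (r.ctx j ω, r.noise j ω)) inferInstance)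
    (Finset.mem_range.2 hj)

lemma measurable_past {j k : ℕ} (hj : j < k) :
    Measurable[r.past k] fun ω => (r.ctx j ω, r.noise j ω) :=
  (comap_measurable _).mono (comap_le_past hj) le_rfl

/-- The context of episode `j` has become part of the past, so the decoders chosen before episode
`k` are functions of the past. -/
lemma knowledge_le_past {j k : ℕ} (hj : j < k) : r.knowledge j ≤ r.past k := by
  refine sup_le (past_mono hj.le) ?_
  rw [← measurable_iff_comap_le]
  exact measurable_fst.comp (measurable_past hj)

namespace IsAlgorithmRun

variable [mΩ : MeasurableSpace Ω] {cq cx cΘ cw δ : ℝ} {K : ℕ} {Pr : Measure Ω}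
  (hr : r.IsAlgorithmRun S cq cx cΘ cw δ K Pr)
include hr

lemma past_le {k : ℕ} (hk : k ≤ K) : r.past k ≤ mΩ := by
  refine iSup₂_le fun j hj => ?_
  have hj' := (Finset.mem_range.1 hj).trans_le hk
  exact ((hr.measurable_ctx j hj').prodMk (hr.measurable_noise j hj')).comap_le

lemma knowledge_le {k : ℕ} (hk : k < K) : r.knowledge k ≤ mΩ :=
  (knowledge_le_past (Nat.lt_succ_self k)).trans (hr.past_le hk)

lemma measurable_Θopt_past {j k : ℕ} (hk : k ≤ K) (hj : j < k) : Measurable[r.past k] (r.Θopt j) :=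
  (hr.nonanticipating j (hj.trans_le hk)).mono (knowledge_le_past hj) le_rfl

lemma measurable_V_past {k : ℕ} (hk : k ≤ K) : Measurable[r.past k] (r.V S k) :=
  measurable_V (mΩ := r.past k) (fun _ hj => hr.measurable_Θopt_past hk hj)
    (fun _ hj => measurable_fst.comp (measurable_past hj))
    (fun _ hj => measurable_snd.comp (measurable_past hj))

lemma measurable_noiseSum_past {k : ℕ} (hk : k ≤ K) (i : Fin d) :
    Measurable[r.past k] (r.noiseSum S k i) :=
  measurable_noiseSum (mΩ := r.past k) (fun _ hj => hr.measurable_Θopt_past hk hj)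
    (fun _ hj => measurable_fst.comp (measurable_past hj))
    (fun _ hj => measurable_snd.comp (measurable_past hj)) i

lemma measurable_expNoise_past (σ : ℝ) {k : ℕ} (hk : k ≤ K) :
    Measurable[r.past k] (r.expNoise S σ k) :=
  @Finset.measurable_sum _ _ _ _ _ _ (r.past k) _ _ fun i _ =>
    @measurable_expSelfNormalized _ _ _ _ (r.past k) σ _ (hr.measurable_V_past hk) _
      (hr.measurable_noiseSum_past hk i)

lemma measurable_expWidth_past (hS : ∀ h, IsProbabilityMeasure (S.noiseLaw h)) (b : ℝ) {k : ℕ}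
    (hk : k ≤ K) : Measurable[r.past k] (r.expWidth S b k) := by
  have h1 : ∀ j ∈ Finset.range k, Measurable[r.past k] fun ω =>
      S.meanWidth (r.V S j ω) (r.Θopt j ω) (r.ctx j ω) / (2 * b) -
        S.width (r.V S j ω) (r.Θopt j ω) (r.ctx j ω) (r.noise j ω) / b := by
    intro j hj
    have hj := Finset.mem_range.1 hj
    have hΘ := hr.measurable_Θopt_past hk hj
    have hc : Measurable[r.past k] (r.ctx j) := measurable_fst.comp (measurable_past hj)
    have hw : Measurable[r.past k] (r.noise j) := measurable_snd.comp (measurable_past hj)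
    have hV : Measurable[r.past k] (r.V S j) :=
      (hr.measurable_V_past (hj.le.trans hk)).mono (past_mono hj.le) le_rfl
    have h1 := @Model.measurable_meanWidth _ _ _ _ _ S _ (r.past k) hS _ hΘ _ hc _ hV
    have h2 := @Model.measurable_width _ _ _ _ _ S _ (r.past k) _ hΘ _ hc _ hw _ hV
    exact (h1.div_const _).sub (h2.div_const _)
  exact ENNReal.measurable_ofReal.comp (Real.measurable_exp.comp
    (@Finset.measurable_sum _ _ _ _ _ _ (r.past k) _ _ h1))

section Laws

variable (hS : S.Assumptions cq cx cΘ cw)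
include hS

lemma map_noise {k : ℕ} (hk : k < K) : Pr.map (r.noise k) = Measure.pi S.noiseLaw := by
  have := hS.prob_context
  have := hS.prob_noise
  have h := congrArg (Measure.map Prod.snd) (hr.law k hk)
  rw [Measure.map_map measurable_snd ((hr.measurable_ctx k hk).prodMk (hr.measurable_noise k hk)),
    Measure.map_snd_prod, measure_univ, one_smul] at h
  exact h

lemma map_ctx {k : ℕ} (hk : k < K) : Pr.map (r.ctx k) = S.contextLaw := by
  have := hS.prob_context
  have := hS.prob_noise
  have h := congrArg (Measure.map Prod.fst) (hr.law k hk)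
  rw [Measure.map_map measurable_fst ((hr.measurable_ctx k hk).prodMk (hr.measurable_noise k hk)),
    Measure.map_fst_prod, measure_univ, one_smul] at h
  exact h

lemma ae_ctx_mem {k : ℕ} (hk : k < K) : ∀ᵐ ω ∂Pr, r.ctx k ω ∈ S.contextLaw.support := by
  have h : ∀ᵐ c ∂S.contextLaw, c ∈ S.contextLaw.support := Measure.support_mem_ae
  rw [← hr.map_ctx hS hk] at h ⊢
  exact ae_of_ae_map (hr.measurable_ctx k hk).aemeasurable h

/-- The noise of an episode is independent of what is known when its decoder is chosen. -/
lemma indepFun_noise [IsProbabilityMeasure Pr] {k : ℕ} (hk : k < K) {T : Type*}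
    [MeasurableSpace T] {Y : Ω → T} (hY : Measurable[r.knowledge k] Y) :
    IndepFun Y (r.noise k) Pr := by
  have := hS.prob_context
  have := hS.prob_noise
  have hm : ∀ j : Fin K, Measurable fun ω => (r.ctx j ω, r.noise j ω) := fun j =>
    (hr.measurable_ctx j j.2).prodMk (hr.measurable_noise j j.2)
  have h1 : Indep (r.past k)
      (MeasurableSpace.comap (fun ω => (r.ctx k ω, r.noise k ω)) inferInstance) Pr := by
    -- Independent episodes over disjoint index sets: the earlier ones and the present one.
    have h := indep_iSup_of_disjoint (fun j => (hm j).comap_le) hr.indep.iIndep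
      (S := {j : Fin K | (j : ℕ) < k}) (T := {⟨k, hk⟩}) (by simp)
    refine indep_of_indep_of_le h (iSup₂_le fun j hj => ?_) ?_
    · have hj := Finset.mem_range.1 hj
      exact le_iSup₂_of_le (⟨j, hj.trans hk⟩ : Fin K) hj le_rfl
    · exact le_iSup₂_of_le (⟨k, hk⟩ : Fin K) rfl le_rfl
  have h3 : IndepFun (r.ctx k) (r.noise k) Pr := by
    rw [indepFun_iff_map_prod_eq_prod_map_map (hr.measurable_ctx k hk).aemeasurable
      (hr.measurable_noise k hk).aemeasurable, hr.law k hk, hr.map_ctx hS hk, hr.map_noise hS hk]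
  rw [IndepFun_iff_Indep]
  exact indep_of_indep_of_le_left (indep_sup_comap (hr.measurable_ctx k hk)
    (hr.measurable_noise k hk) (hr.past_le hk.le) h1 h3) (measurable_iff_comap_le.1 hY)

lemma lintegral_noise [IsProbabilityMeasure Pr] {k : ℕ} (hk : k < K) {T : Type*}
    [MeasurableSpace T] {Y : Ω → T} (hY : Measurable[r.knowledge k] Y)
    {F : T × (Fin (H - 1) → Vec d) → ℝ≥0∞} (hF : Measurable F) :
    ∫⁻ ω, F (Y ω, r.noise k ω) ∂Pr = ∫⁻ ω, ∫⁻ w, F (Y ω, w) ∂(Measure.pi S.noiseLaw) ∂Pr := by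
  rw [lintegral_of_indepFun (hY.mono (hr.knowledge_le hk) le_rfl) (hr.measurable_noise k hk)
    (hr.indepFun_noise hS hk hY) hF, hr.map_noise hS hk]

/-- The within-episode inequality integrated over what is known at the start. Set integrals over
past events replace conditional expectations. -/
lemma setLIntegral_expNoise_le [IsProbabilityMeasure Pr] (hcw : 0 < cw) {k : ℕ} (hk : k < K)
    {A : Set Ω} (hA : MeasurableSet[r.past k] A) :
    ∫⁻ ω in A, r.expNoise S cw (k + 1) ω ∂Pr ≤ ∫⁻ ω in A, r.expNoise S cw k ω ∂Pr := by
  have hpk : r.past k ≤ r.knowledge k := le_sup_left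
  have hA' := hr.past_le hk.le _ hA
  have hm : ∀ k ≤ K, ∀ i, Measurable fun ω => expSelfNormalized cw (r.V S k ω) (r.noiseSum S k i ω) :=
    fun k hk i => measurable_expSelfNormalized cw
      ((hr.measurable_V_past hk).mono (hr.past_le hk) le_rfl)
      ((hr.measurable_noiseSum_past hk i).mono (hr.past_le hk) le_rfl)
  simp only [expNoise]
  rw [lintegral_finsetSum _ fun i _ => hm (k + 1) hk i, lintegral_finsetSum _ fun i _ => hm k hk.le i]
  refine Finset.sum_le_sum fun i _ => ?_
  -- The event `A` enters as a weight, so that the set integral becomes an integral of a function of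
  -- known data and independent noise.
  set Y : Ω → NoiseData d m p q := fun ω => (A.indicator (fun _ => 1) ω, r.V S k ω, r.noiseSum S k i ω, r.Θopt k ω, r.ctx k ω)
  have hY : Measurable[r.knowledge k] Y :=
    (@Measurable.indicator Ω ℝ≥0∞ A (fun _ => 1) (r.knowledge k) _ _
      (@measurable_const _ _ _ (r.knowledge k) 1) (hpk _ hA)).prodMk
      (((hr.measurable_V_past hk.le).mono hpk le_rfl).prodMk
      (((hr.measurable_noiseSum_past hk.le i).mono hpk le_rfl).prodMk
      ((hr.nonanticipating k hk).prodMk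
        ((comap_measurable (r.ctx k)).mono le_sup_right le_rfl))))
  set F : NoiseData d m p q × (Fin (H - 1) → Vec d) → ℝ≥0∞ := fun a => a.1.1 * expSelfNormalized cw
      (a.1.2.1 + ∑ h ∈ Finset.range (H - 1), Matrix.vecMulVec
        (S.obsAt a.1.2.2.2.1 a.1.2.2.2.2 a.2 h) (S.obsAt a.1.2.2.2.1 a.1.2.2.2.2 a.2 h))
      (a.1.2.2.1 + ∑ h ∈ Finset.range (H - 1),
        extendNoise (H := H) a.2 h i • S.obsAt a.1.2.2.2.1 a.1.2.2.2.2 a.2 h)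
  have hF : Measurable F := by
    have ho : ∀ h ∈ Finset.range (H - 1), Measurable fun a : NoiseData d m p q × (Fin (H - 1) → Vec d) =>
        S.obsAt a.1.2.2.2.1 a.1.2.2.2.2 a.2 h := fun h hh =>
      Model.measurable_obsAt (by fun_prop) (by fun_prop) (by fun_prop)
        (by have := Finset.mem_range.1 hh; omega)
    have hn : ∀ h, Measurable fun a : NoiseData d m p q × (Fin (H - 1) → Vec d) =>
        extendNoise (H := H) a.2 h i := fun h =>
      (measurable_pi_apply i).comp (measurable_extendNoise measurable_snd h)
    refine Measurable.mul (by fun_prop) (measurable_expSelfNormalized cw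
      (Measurable.add (by fun_prop) (Finset.measurable_sum _ fun h hh =>
        measurable_vecMulVec (ho h hh) (ho h hh)))
      (Measurable.add (by fun_prop) (Finset.measurable_sum _ fun h hh =>
        (hn h).smul (ho h hh))))
  have hl : ∀ ω, A.indicator (fun ω => expSelfNormalized cw (r.V S (k + 1) ω)
      (r.noiseSum S (k + 1) i ω)) ω = F (Y ω, r.noise k ω) := by
    intro ω
    by_cases hω : ω ∈ A
    · simp only [F, Y, Set.indicator_of_mem hω, one_mul, V_succ, noiseSum_succ]
      rfl
    · simp [F, Y, Set.indicator_of_notMem hω]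
  rw [← lintegral_indicator hA', lintegral_congr hl, hr.lintegral_noise hS hk hY hF,
    ← lintegral_indicator hA']
  refine lintegral_mono fun ω => ?_
  by_cases hω : ω ∈ A
  · simp only [F, Y, Set.indicator_of_mem hω, one_mul]
    exact hS.lintegral_episode_le hcw _ _ (V_posDef k ω) _ i
  · simp [F, Y, Set.indicator_of_notMem hω]

lemma setLIntegral_expWidth_le [IsProbabilityMeasure Pr] (hH : 1 ≤ H) (hcx : 0 < cx) {k : ℕ}
    (hk : k < K) {A : Set Ω} (hA : MeasurableSet[r.past k] A) :
    ∫⁻ ω in A, r.expWidth S (H * cx ^ 2) (k + 1) ω ∂Pr ≤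
      ∫⁻ ω in A, r.expWidth S (H * cx ^ 2) k ω ∂Pr := by
  have hpk : r.past k ≤ r.knowledge k := le_sup_left
  have hA' := hr.past_le hk.le _ hA
  have hN := hr.measurable_expWidth_past hS.prob_noise (H * cx ^ 2) hk.le
  -- The accumulated exponential, restricted to `A`, serves as the weight; the new episode
  -- contributes a factor of integral at most `1`.
  set Y : Ω → WidthData d m p q := fun ω => (A.indicator (r.expWidth S (H * cx ^ 2) k) ω, r.V S k ω, r.Θopt k ω,
    r.ctx k ω)
  have hY : Measurable[r.knowledge k] Y :=
    (Measurable.indicator (hN.mono hpk le_rfl) (hpk _ hA)).prodMk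
      (((hr.measurable_V_past hk.le).mono hpk le_rfl).prodMk
      ((hr.nonanticipating k hk).prodMk
        ((comap_measurable (r.ctx k)).mono le_sup_right le_rfl)))
  set F : WidthData d m p q × (Fin (H - 1) → Vec d) → ℝ≥0∞ := fun a => a.1.1 * ENNReal.ofReal (Real.exp
    (S.meanWidth a.1.2.1 a.1.2.2.1 a.1.2.2.2 / (2 * (H * cx ^ 2)) -
      S.width a.1.2.1 a.1.2.2.1 a.1.2.2.2 a.2 / (H * cx ^ 2)))
  have hF : Measurable F := by
    have h1 : Measurable fun a : WidthData d m p q × (Fin (H - 1) → Vec d) =>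
        S.meanWidth a.1.2.1 a.1.2.2.1 a.1.2.2.2 :=
      Model.measurable_meanWidth hS.prob_noise (by fun_prop) (by fun_prop) (by fun_prop)
    have h2 : Measurable fun a : WidthData d m p q × (Fin (H - 1) → Vec d) =>
        S.width a.1.2.1 a.1.2.2.1 a.1.2.2.2 a.2 :=
      Model.measurable_width (by fun_prop) (by fun_prop) (by fun_prop) (by fun_prop)
    fun_prop
  have hl : ∀ ω, A.indicator (r.expWidth S (H * cx ^ 2) (k + 1)) ω = F (Y ω, r.noise k ω) := by
    intro ω
    by_cases hω : ω ∈ A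
    · simp only [F, Y, Set.indicator_of_mem hω, expWidth, Finset.sum_range_succ, Real.exp_add]
      rw [ENNReal.ofReal_mul (Real.exp_pos _).le]
    · simp [F, Y, Set.indicator_of_notMem hω]
  rw [← lintegral_indicator hA', lintegral_congr hl, hr.lintegral_noise hS hk hY hF,
    ← lintegral_indicator hA']
  refine lintegral_mono_ae ?_
  filter_upwards [hr.ae_ctx_mem hS hk, hr.isPolicy k hk] with ω hω hπ
  simp only [F]
  rw [lintegral_const_mul' _ _ (by
    by_cases hA : ω ∈ A
    · simp [Y, hA, expWidth]
    · simp [Y, hA])]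
  refine (mul_le_mul_right (hS.lintegral_exp_neg_width_le hω hπ hH hcx (V_posDef k ω)
    (dot_le_dot_V k ω)) _).trans ?_
  rw [mul_one]

/-- The bound is known for each fixed decoder and context, almost surely in the noise; independence
transfers it to the random decoder. -/
lemma ae_obs_le [IsProbabilityMeasure Pr] (hH : 1 ≤ H) {k : ℕ} (hk : k < K) :
    ∀ᵐ ω ∂Pr, ∀ h, h + 1 < H → r.obs S k h ω ⬝ᵥ r.obs S k h ω ≤ cx ^ 2 := by
  have hY : Measurable[r.knowledge k] fun ω => (r.Θopt k ω, r.ctx k ω) :=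
    (hr.nonanticipating k hk).prodMk ((comap_measurable (r.ctx k)).mono le_sup_right le_rfl)
  refine ae_of_indepFun (p := fun a : (Decoder d p q × Context d m p q) × (Fin (H - 1) → Vec d) =>
    ∀ h, h + 1 < H → S.obsAt a.1.1 a.1.2 a.2 h ⬝ᵥ S.obsAt a.1.1 a.1.2 a.2 h ≤ cx ^ 2)
    (hY.mono (hr.knowledge_le hk) le_rfl) (hr.measurable_noise k hk)
    (hr.indepFun_noise hS hk hY) ?_ ?_
  · have : {a : (Decoder d p q × Context d m p q) × (Fin (H - 1) → Vec d) |
        ∀ h, h + 1 < H → S.obsAt a.1.1 a.1.2 a.2 h ⬝ᵥ S.obsAt a.1.1 a.1.2 a.2 h ≤ cx ^ 2} =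
        ⋂ h ∈ Finset.range (H - 1),
          {a | S.obsAt a.1.1 a.1.2 a.2 h ⬝ᵥ S.obsAt a.1.1 a.1.2 a.2 h ≤ cx ^ 2} := by
      ext a
      simp [Nat.lt_sub_iff_add_lt]
    rw [this]
    refine Finset.measurableSet_biInter _ fun h hh => ?_
    have := Model.measurable_obsAt (S := S)
      (α := (Decoder d p q × Context d m p q) × (Fin (H - 1) → Vec d))
      (measurable_fst.comp measurable_fst) (measurable_snd.comp measurable_fst) measurable_snd
      (h := h) (by have := Finset.mem_range.1 hh; omega)
    exact measurable_dotProduct this this measurableSet_Iic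
  · rw [hr.map_noise hS hk]
    filter_upwards [hr.ae_ctx_mem hS hk, hr.isPolicy k hk] with ω hω hπ
    exact hS.ae_obsAt_le hω hπ hH

end Laws

end IsAlgorithmRun

end Run

end ContextualLQR

namespace ContextualLQR

/-! ### The ridge error, the potential argument and the slack in the radius. -/

namespace Run

variable {d m p q H : ℕ} {Ω : Type*} {r : Run d m p q H Ω} {S : Model d m p q H}
  {cq cx cΘ cw δ : ℝ}

/-- The linear regression model: the next state is a linear response to the observation, with the
same coefficients in every context. -/
lemma state_succ (k h : ℕ) (ω : Ω) : r.state S k (h + 1) ω =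
    S.Θstar *ᵥ r.obs S k h ω + extendNoise (H := H) (r.noise k ω) h := by
  rw [obs, ← decode_mulVec]
  rfl

/-- The error of the ridge estimate in each coordinate. -/
lemma Θstar_sub_ridge_apply (k : ℕ) (ω : Ω) (i : Fin d) :
    (S.Θstar - r.ridge S k ω) i =
      (r.V S k ω)⁻¹ *ᵥ (S.Θstar i - r.noiseSum S k i ω) := by
  have hV := V_posDef (r := r) (S := S) k ω
  -- Each response is `Θ⋆ z` plus noise and the sum of `z zᵀ` is `V - 1`; hence the bias `-Θ⋆` of
  -- ridge regression.
  have hW : (fun a => r.W S k ω a i) =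
      r.V S k ω *ᵥ S.Θstar i - S.Θstar i + r.noiseSum S k i ω := by
    ext a
    simp only [W, V, noiseSum, Matrix.add_mulVec, Matrix.one_mulVec, Matrix.sum_mulVec,
      Matrix.sum_apply, Matrix.vecMulVec_apply, Matrix.vecMulVec_mulVec, state_succ,
      Finset.sum_apply, Pi.add_apply, Pi.sub_apply, Pi.smul_apply, smul_eq_mul,
      MulOpposite.smul_eq_mul_unop, MulOpposite.unop_op, mul_add, Finset.sum_add_distrib]
    have e : ∀ j h, r.obs S j h ω a * (S.Θstar *ᵥ r.obs S j h ω) i =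
        r.obs S j h ω a * (r.obs S j h ω ⬝ᵥ S.Θstar i) := fun j h => by
      rw [dotProduct_comm]; rfl
    simp only [e, mul_comm (extendNoise _ _ _)]
    ring
  have h1 : r.ridge S k ω i = (r.V S k ω)⁻¹ *ᵥ (fun a => r.W S k ω a i) := by
    ext a
    simp [ridge, Matrix.mul_apply, Matrix.mulVec, dotProduct]
  change S.Θstar i - r.ridge S k ω i = _
  rw [h1, hW, Matrix.mulVec_add, Matrix.mulVec_sub,
    hV.inv_mulVec_mulVec, Matrix.mulVec_sub]
  abel

/-- The true decoder is in the confidence ellipsoid if the self-normalized sums are small. -/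
lemma trace_Θstar_sub_ridge_le {k : ℕ} {ω : Ω} (hcΘ : 0 < cΘ) (hΘ : frobeniusNorm S.Θstar ≤ cΘ)
    {A : ℝ} (hA : 0 < A)
    (h : ∑ i, r.noiseSum S k i ω ⬝ᵥ ((r.V S k ω)⁻¹ *ᵥ r.noiseSum S k i ω) ≤ A ^ 2) :
    ((S.Θstar - r.ridge S k ω) * r.V S k ω * (S.Θstar - r.ridge S k ω)ᵀ).trace ≤
      (cΘ + A) ^ 2 := by
  have hV := V_posDef (r := r) (S := S) k ω
  have hΘ2 : ∑ i, S.Θstar i ⬝ᵥ ((r.V S k ω)⁻¹ *ᵥ S.Θstar i) ≤ cΘ ^ 2 := by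
    calc _ ≤ ∑ i, S.Θstar i ⬝ᵥ S.Θstar i :=
          Finset.sum_le_sum fun i _ => dot_inv_le_dot hV (dot_le_dot_V k ω) _
      _ = frobeniusNorm S.Θstar ^ 2 := by
          refine Eq.trans ?_ (Real.sq_sqrt (Finset.sum_nonneg fun i _ => Finset.sum_nonneg
            fun j _ => sq_nonneg (S.Θstar i j))).symm
          simp only [dotProduct, sq]
      _ ≤ cΘ ^ 2 := pow_le_pow_left₀ (Real.sqrt_nonneg _) hΘ 2
  -- With this weight the two halves of `dot_sub_le` add up to exactly the square `(cΘ + A) ^ 2`.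
  have ht : 0 < A / cΘ := by positivity
  rw [trace_mul_mul_transpose]
  calc _ ≤ ∑ i, ((1 + A / cΘ) * (S.Θstar i ⬝ᵥ ((r.V S k ω)⁻¹ *ᵥ S.Θstar i)) + (1 + (A / cΘ)⁻¹) *
        (r.noiseSum S k i ω ⬝ᵥ ((r.V S k ω)⁻¹ *ᵥ r.noiseSum S k i ω))) := by
        refine Finset.sum_le_sum fun i _ => ?_
        rw [Θstar_sub_ridge_apply, hV.mulVec_inv_mulVec, dotProduct_comm]
        exact dot_sub_le hV.inv.posSemidef ht _ _
    _ ≤ (1 + A / cΘ) * cΘ ^ 2 + (1 + (A / cΘ)⁻¹) * A ^ 2 := by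
        rw [Finset.sum_add_distrib, ← Finset.mul_sum, ← Finset.mul_sum]
        gcongr
    _ = (cΘ + A) ^ 2 := by
        field_simp
        ring

/-- Both decoders are within `B` of the center of the ellipsoid, so they are within its diameter of
each other. -/
lemma trace_sub_le {k : ℕ} {ω : Ω} {Θ : Decoder d p q} {B : ℝ}
    (h1 : S.Θstar ∈ r.confidenceSet S cq cx cΘ cw δ k ω)
    (h2 : Θ ∈ r.confidenceSet S cq cx cΘ cw δ k ω)
    (hB : radius d (p + q) H cx cΘ cw δ k ≤ B ^ 2) :
    ((S.Θstar - Θ) * r.V S k ω * (S.Θstar - Θ)ᵀ).trace ≤ (2 * B) ^ 2 := by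
  have h1 := h1.1
  have h2 := h2.1
  rw [trace_mul_mul_transpose] at h1 h2 ⊢
  have e : S.Θstar - Θ = (S.Θstar - r.ridge S k ω) - (Θ - r.ridge S k ω) := by abel
  rw [e]
  calc _ ≤ ∑ i, ((1 + 1) * ((S.Θstar - r.ridge S k ω) i ⬝ᵥ
          (r.V S k ω *ᵥ (S.Θstar - r.ridge S k ω) i)) + (1 + 1⁻¹) *
            ((Θ - r.ridge S k ω) i ⬝ᵥ (r.V S k ω *ᵥ (Θ - r.ridge S k ω) i))) :=
        Finset.sum_le_sum fun i _ => dot_sub_le (V_posDef k ω).posSemidef one_pos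
          ((S.Θstar - r.ridge S k ω) i) ((Θ - r.ridge S k ω) i)
    _ ≤ (2 * B) ^ 2 := by
        rw [Finset.sum_add_distrib, ← Finset.mul_sum, ← Finset.mul_sum]
        linarith

section Potential

variable {ω : Ω} {K : ℕ}
  (hobs : ∀ k < K, ∀ h, h + 1 < H → r.obs S k h ω ⬝ᵥ r.obs S k h ω ≤ cx ^ 2)
include hobs

/-- The trace is at most `p + q` plus the number of observations times `cx ^ 2`. -/
lemma det_V_le (hn : 1 ≤ p + q) {k : ℕ} (hk : k ≤ K) : (r.V S k ω).det ≤
    (1 + k * ((H - 1 : ℕ) : ℝ) * cx ^ 2 / ((p + q : ℕ) : ℝ)) ^ (p + q) := by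
  have hne : Nonempty (Fin p ⊕ Fin q) := by
    rw [← Fintype.card_pos_iff, Fintype.card_sum, Fintype.card_fin, Fintype.card_fin]; exact hn
  have hn0 : (0 : ℝ) < ((p + q : ℕ) : ℝ) := by exact_mod_cast hn
  have h := det_le_trace_div_pow (V_posDef (r := r) (S := S) k ω).posSemidef
  have hcard : Fintype.card (Fin p ⊕ Fin q) = p + q := by simp
  rw [hcard] at h
  refine h.trans (pow_le_pow_left₀ ?_ ?_ _)
  · exact div_nonneg (V_posDef k ω).posSemidef.trace_nonneg hn0.le
  · have ht : (r.V S k ω).trace ≤ ((p + q : ℕ) : ℝ) + k * ((H - 1 : ℕ) : ℝ) * cx ^ 2 := by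
      simp only [V, Matrix.trace_add, Matrix.trace_one, Matrix.trace_sum, Matrix.trace_vecMulVec,
        hcard]
      refine add_le_add le_rfl ?_
      calc _ ≤ ∑ j ∈ Finset.range k, ∑ h ∈ Finset.range (H - 1), cx ^ 2 :=
            Finset.sum_le_sum fun j hj => Finset.sum_le_sum fun h hh =>
              hobs j ((Finset.mem_range.1 hj).trans_le hk) h
                (by have := Finset.mem_range.1 hh; omega)
        _ = _ := by simp [mul_assoc]
    calc _ ≤ (((p + q : ℕ) : ℝ) + k * ((H - 1 : ℕ) : ℝ) * cx ^ 2) / ((p + q : ℕ) : ℝ) := by gcongr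
      _ = _ := by rw [add_div, div_self hn0.ne']

/-- The elliptic potential argument with a matrix frozen in each episode: the determinant grows at
least by the factor `1 + x`, with `x` the width. As `x` can be as large as `H cx ^ 2`, comparing it
with `log (1 + x)` costs the factor in front. -/
lemma sum_width_le (hcx : 0 < cx) {k : ℕ} (hk : k ≤ K) :
    ∑ j ∈ Finset.range k, S.width (r.V S j ω) (r.Θopt j ω) (r.ctx j ω) (r.noise j ω) ≤
      (1 + H * cx ^ 2) * Real.log (r.V S k ω).det := by
  induction k with
  | zero => simp [V_zero]
  | succ k ih =>
    have hV := V_posDef (r := r) (S := S) k ω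
    have hb : (0 : ℝ) < 1 + H * cx ^ 2 := by positivity
    set x := S.width (r.V S k ω) (r.Θopt k ω) (r.ctx k ω) (r.noise k ω) with hx
    have hx0 : 0 ≤ x := Model.width_nonneg hV _ _ _
    have hxle : x ≤ H * cx ^ 2 := by
      calc x ≤ ∑ h ∈ Finset.range (H - 1), cx ^ 2 := Finset.sum_le_sum fun h hh =>
            (dot_inv_le_dot hV (dot_le_dot_V k ω) _).trans
              (hobs k hk h (by have := Finset.mem_range.1 hh; omega))
        _ = ((H - 1 : ℕ) : ℝ) * cx ^ 2 := by simp
        _ ≤ H * cx ^ 2 := by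
            gcongr
            omega
    have hdet : (r.V S k ω).det * (1 + x) ≤ (r.V S (k + 1) ω).det := by
      have h := det_mul_one_add_sum_le hV (fun h : Fin (H - 1) => r.obs S k h ω)
      rw [V_succ, Finset.sum_range, hx, Model.width, Finset.sum_range]
      exact h
    have hlog : Real.log (r.V S k ω).det + Real.log (1 + x) ≤ Real.log (r.V S (k + 1) ω).det := by
      rw [← Real.log_mul hV.det_pos.ne' (by positivity)]
      exact Real.log_le_log (mul_pos hV.det_pos (by positivity)) hdet
    have hlx : x ≤ (1 + H * cx ^ 2) * Real.log (1 + x) := by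
      have h1 := Real.one_sub_inv_le_log_of_pos (show 0 < 1 + x by positivity)
      have h2 : x ≤ (1 + x) * Real.log (1 + x) := by
        have e : (1 + x) * (1 - (1 + x)⁻¹) = x := by field_simp; ring
        calc x = (1 + x) * (1 - (1 + x)⁻¹) := e.symm
          _ ≤ _ := by gcongr
      have h3 : 0 ≤ Real.log (1 + x) := Real.log_nonneg (by linarith)
      exact h2.trans (by gcongr)
    rw [Finset.sum_range_succ]
    have := ih (by omega)
    have h4 := mul_le_mul_of_nonneg_left hlog hb.le
    rw [mul_add] at h4
    linarith

end Potential

/-- The growth of the radius leaves room for a second exceptional event. -/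
lemma slack_mul_pow_le {n H k : ℕ} (hn : 1 ≤ n) (hH : 1 ≤ H) {x : ℝ} (hx : 1 ≤ x) :
    (1 + 1 / (3 * H : ℝ)) ^ 2 * (1 + k * ((H - 1 : ℕ) : ℝ) * x / n) ^ n ≤
      (1 + (k + 1) * H * x / n) ^ n := by
  have hn0 : (1 : ℝ) ≤ n := by exact_mod_cast hn
  have hH0 : (1 : ℝ) ≤ H := by exact_mod_cast hH
  have hk0 : (0 : ℝ) ≤ k := Nat.cast_nonneg k
  have hH1 : ((H - 1 : ℕ) : ℝ) = H - 1 := by push_cast [Nat.cast_sub hH]; ring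
  rw [hH1]
  set a := (k : ℝ) * (H - 1) * x with ha
  have ha0 : 0 ≤ a := mul_nonneg (mul_nonneg hk0 (by linarith)) (by linarith)
  set b := x * (k + H) with hb
  have hb0 : 0 ≤ b := by positivity
  -- Here `a + b = (k + 1) H x`. Bernoulli's inequality makes the `n`-th power of the second factor
  -- at least `1 + 1 / H`, which exceeds the squared slack.
  have e : (1 + (k + 1) * H * x / n : ℝ) = (1 + a / n) * (1 + b / (n + a)) := by
    field_simp
    rw [ha, hb]
    ring
  rw [e, mul_pow, mul_comm]
  refine mul_le_mul_of_nonneg_left ?_ (by positivity)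
  have h1 : 1 + (n : ℝ) * (b / (n + a)) ≤ (1 + b / (n + a)) ^ n :=
    one_add_mul_le_pow (by have : 0 ≤ b / (n + a) := by positivity
                           linarith) n
  have h2 : 1 / (H : ℝ) ≤ n * (b / (n + a)) := by
    rw [mul_div_assoc', div_le_div_iff₀ (by positivity) (by positivity), one_mul]
    have h3 : (n : ℝ) ≤ n * (x * H) * H := by
      have : 1 ≤ x * H * H := by
        have := one_le_mul_of_one_le_of_one_le hx hH0
        exact one_le_mul_of_one_le_of_one_le this hH0
      nlinarith
    have h4 : a ≤ n * (x * k) * H := by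
      have h5 : a ≤ x * k * H := by
        rw [ha]
        have : 0 ≤ x * k := by positivity
        nlinarith
      have : 0 ≤ x * k * H := by positivity
      nlinarith
    rw [hb]
    nlinarith
  have h3 : (1 + 1 / (3 * H : ℝ)) ^ 2 ≤ 1 + 1 / H := by
    have h4 : 1 / (3 * H : ℝ) = (1 / H) / 3 := by field_simp
    have h5 : 1 / (H : ℝ) ≤ 1 := by rw [div_le_one (by linarith)]; exact hH0
    have h6 : 0 ≤ 1 / (H : ℝ) := by positivity
    rw [h4]
    nlinarith
  linarith

end Run

end ContextualLQR

namespace ContextualLQR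

/-! ### The good events and the final estimate. -/

namespace Run

variable {d m p q H K : ℕ} {Ω : Type*} {r : Run d m p q H Ω} {S : Model d m p q H}
  {cq cx cΘ cw δ : ℝ}

/-- Each coordinate's exponential is bounded by the sum, so taking logarithms controls every
self-normalized square. Adding the `d` bounds gives the stochastic part of the radius. -/
lemma Θstar_mem_confidenceSet (hS : S.Assumptions cq cx cΘ cw) (hd : 1 ≤ d) (hn : 1 ≤ p + q)
    (hH : 1 ≤ H) (hcx : 1 ≤ cx) (hcΘ : 0 < cΘ) (hcw : 0 < cw) (hδ : 0 < δ) (hδ1 : δ < 1) {ω : Ω}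
    (hobs : ∀ k < K, ∀ h, h + 1 < H → r.obs S k h ω ⬝ᵥ r.obs S k h ω ≤ cx ^ 2) {k : ℕ} (hk : k ≤ K)
    (h : r.expNoise S cw k ω < ENNReal.ofReal (d * (1 + 1 / (3 * H)) / δ)) :
    S.Θstar ∈ r.confidenceSet S cq cx cΘ cw δ k ω := by
  refine ⟨?_, fun h hh c hc => hS.riccati_le c hc h hh⟩
  have hd0 : (1 : ℝ) ≤ d := by exact_mod_cast hd
  have hn0 : (1 : ℝ) ≤ ((p + q : ℕ) : ℝ) := by exact_mod_cast hn
  have hH0 : (1 : ℝ) ≤ H := by exact_mod_cast hH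
  have hx : 1 ≤ cx ^ 2 := one_le_pow₀ hcx
  set s : ℝ := 1 + 1 / (3 * H) with hs
  have hs0 : 0 < s := by positivity
  set X : ℝ := 1 + (k + 1) * H * cx ^ 2 / ((p + q : ℕ) : ℝ) with hX
  have hX1 : 1 ≤ X := le_add_of_nonneg_right (by positivity)
  set Λ : ℝ := Real.log d + ((p + q : ℕ) : ℝ) * Real.log X / 2 + Real.log δ⁻¹ with hΛ
  have hlogX : 0 ≤ Real.log X := Real.log_nonneg hX1
  have hΛ0 : 0 < Λ := by
    have h1 : 0 ≤ Real.log d := Real.log_nonneg hd0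
    have h2 : 0 < Real.log δ⁻¹ := Real.log_pos (one_lt_inv_iff₀.2 ⟨hδ, hδ1⟩)
    have h3 : 0 ≤ ((p + q : ℕ) : ℝ) * Real.log X / 2 := by positivity
    linarith
  have hV := V_posDef (r := r) (S := S) k ω
  -- The slack `s` in the threshold is squared because the determinant enters through its square
  -- root.
  have hdet : s ^ 2 * (r.V S k ω).det ≤ X ^ (p + q) :=
    (mul_le_mul_of_nonneg_left (det_V_le hobs hn hk) (sq_nonneg s)).trans
      (slack_mul_pow_le hn hH hx)
  have hlog : Real.log (s * √(r.V S k ω).det) ≤ ((p + q : ℕ) : ℝ) * Real.log X / 2 := by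
    have h0 : 0 < s * √(r.V S k ω).det := mul_pos hs0 (Real.sqrt_pos.2 hV.det_pos)
    have h1 := Real.log_le_log (mul_pos (pow_pos hs0 2) hV.det_pos) hdet
    have h2 : s ^ 2 * (r.V S k ω).det = (s * √(r.V S k ω).det) ^ 2 := by
      rw [mul_pow, Real.sq_sqrt hV.det_pos.le]
    rw [h2, Real.log_pow, Real.log_pow] at h1
    push_cast at h1 ⊢
    linarith
  have hQ : ∀ i, r.noiseSum S k i ω ⬝ᵥ ((r.V S k ω)⁻¹ *ᵥ r.noiseSum S k i ω) ≤ 2 * cw ^ 2 * Λ := by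
    intro i
    set Q := r.noiseSum S k i ω ⬝ᵥ ((r.V S k ω)⁻¹ *ᵥ r.noiseSum S k i ω)
    have h1 : expSelfNormalized cw (r.V S k ω) (r.noiseSum S k i ω) <
        ENNReal.ofReal (d * s / δ) :=
      lt_of_le_of_lt (Finset.single_le_sum
        (f := fun i => expSelfNormalized cw (r.V S k ω) (r.noiseSum S k i ω))
        (fun _ _ => bot_le) (Finset.mem_univ i)) h
    have hsd : 0 < √(r.V S k ω).det := Real.sqrt_pos.2 hV.det_pos
    rw [expSelfNormalized, ENNReal.ofReal_lt_ofReal_iff (by positivity), div_lt_iff₀ hsd] at h1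
    have h2 := Real.log_le_log (Real.exp_pos _) h1.le
    rw [Real.log_exp] at h2
    have e : d * s / δ * √(r.V S k ω).det = d * (s * √(r.V S k ω).det) * δ⁻¹ := by
      field_simp
    rw [e, Real.log_mul (by positivity) (by positivity), Real.log_mul (by positivity) (by positivity),
      div_le_iff₀ (by positivity)] at h2
    have h3 : Real.log d + Real.log (s * √(r.V S k ω).det) + Real.log δ⁻¹ ≤ Λ := by
      rw [hΛ]; linarith
    calc Q ≤ _ := h2
      _ ≤ Λ * (2 * cw ^ 2) := by gcongr
      _ = _ := by ring
  have hA : 0 < cw * √(2 * d * Λ) := mul_pos hcw (Real.sqrt_pos.2 (by positivity))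
  refine trace_Θstar_sub_ridge_le hcΘ hS.Θstar_le hA ?_
  calc _ ≤ ∑ _i : Fin d, 2 * cw ^ 2 * Λ := Finset.sum_le_sum fun i _ => hQ i
    _ = (cw * √(2 * d * Λ)) ^ 2 := by
        rw [mul_pow, Real.sq_sqrt (by positivity)]
        simp
        ring

section Events

variable [mΩ : MeasurableSpace Ω] {Pr : Measure Ω} [IsProbabilityMeasure Pr]
  (hr : r.IsAlgorithmRun S cq cx cΘ cw δ K Pr) (hS : S.Assumptions cq cx cΘ cw)
include hr hS

/-- Ville's inequality for a process that starts at `d`, one unit per coordinate. This is where the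
term `log d` of the radius originates. -/
lemma measure_expNoise_le (hd : 1 ≤ d) (hcw : 0 < cw) {a : ℝ} (ha : 0 < a) :
    Pr {ω | ∃ k ≤ K, ENNReal.ofReal (d * a) ≤ r.expNoise S cw k ω} ≤ ENNReal.ofReal a⁻¹ := by
  have hd0 : (0 : ℝ) < d := by exact_mod_cast hd
  have h := mul_measure_exists_le_le (P := Pr) past_mono (fun k hk => hr.past_le hk)
    (fun k hk => hr.measurable_expNoise_past cw hk)
    (fun k hk A hA => hr.setLIntegral_expNoise_le hS hcw hk hA) (ENNReal.ofReal (d * a))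
  have h0 : ∀ ω, r.expNoise S cw 0 ω = ENNReal.ofReal d := by
    intro ω
    simp [expNoise, expSelfNormalized, V_zero, noiseSum]
  simp only [h0, lintegral_const, measure_univ, mul_one] at h
  rw [ENNReal.ofReal_mul hd0.le, mul_assoc] at h
  have h1 : ENNReal.ofReal d * (ENNReal.ofReal a *
      Pr {ω | ∃ k ≤ K, ENNReal.ofReal d * ENNReal.ofReal a ≤ r.expNoise S cw k ω}) ≤
      ENNReal.ofReal d * 1 := by rwa [mul_one]
  have h2 := (ENNReal.mul_le_mul_iff_right (ENNReal.ofReal_pos.2 hd0).ne' ENNReal.ofReal_ne_top).1 h1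
  rw [ENNReal.ofReal_inv_of_pos ha, ENNReal.ofReal_mul hd0.le, ENNReal.le_inv_iff_mul_le, mul_comm]
  exact h2

lemma measure_expWidth_le (hH : 1 ≤ H) (hcx : 0 < cx) {a : ℝ} (ha : 0 < a) :
    Pr {ω | ∃ k ≤ K, ENNReal.ofReal a ≤ r.expWidth S (H * cx ^ 2) k ω} ≤ ENNReal.ofReal a⁻¹ := by
  have h := mul_measure_exists_le_le (P := Pr) past_mono (fun k hk => hr.past_le hk)
    (fun k hk => hr.measurable_expWidth_past hS.prob_noise (H * cx ^ 2) hk)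
    (fun k hk A hA => hr.setLIntegral_expWidth_le hS hH hcx hk hA) (ENNReal.ofReal a)
  have h0 : ∀ ω, r.expWidth S (H * cx ^ 2) 0 ω = 1 := by
    intro ω
    simp [expWidth]
  simp only [h0, lintegral_const, measure_univ, mul_one] at h
  rw [ENNReal.ofReal_inv_of_pos ha, ENNReal.le_inv_iff_mul_le, mul_comm]
  exact h

end Events

/-- Take logarithms and clear the denominators. -/
lemma sum_meanWidth_le {b : ℝ} (hb : 0 < b) {a : ℝ} (ha : 0 < a) {ω : Ω}
    (h : r.expWidth S b K ω < ENNReal.ofReal a) :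
    ∑ k ∈ Finset.range K, S.meanWidth (r.V S k ω) (r.Θopt k ω) (r.ctx k ω) ≤
      2 * ∑ k ∈ Finset.range K, S.width (r.V S k ω) (r.Θopt k ω) (r.ctx k ω) (r.noise k ω) +
        2 * b * Real.log a := by
  rw [expWidth, ENNReal.ofReal_lt_ofReal_iff ha] at h
  have h1 := Real.log_le_log (Real.exp_pos _) h.le
  rw [Real.log_exp, Finset.sum_sub_distrib, ← Finset.sum_div, ← Finset.sum_div] at h1
  have h2 := mul_le_mul_of_nonneg_left h1 (by positivity : 0 ≤ 2 * b)
  have e : ∀ x y : ℝ, 2 * b * (x / (2 * b) - y / b) = x - 2 * y := fun x y => by field_simp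
  rw [e] at h2
  linarith

section Logarithms

variable (hd : 1 ≤ d) (hK : 1 ≤ K) (hH : 2 ≤ H) (hcx : 1 ≤ cx) (hδ : 0 < δ) (hδ1 : δ < 1)
include hd hK hH hcx hδ hδ1

lemma two_le_and_bounds : 2 ≤ d * K * H * cx / δ ∧ (d : ℝ) ≤ d * K * H * cx / δ ∧
    δ⁻¹ ≤ d * K * H * cx / δ ∧ H / δ ≤ d * K * H * cx / δ ∧
    (K : ℝ) * H * cx ≤ d * K * H * cx / δ := by
  have hd0 : (1 : ℝ) ≤ d := by exact_mod_cast hd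
  have hK0 : (1 : ℝ) ≤ K := by exact_mod_cast hK
  have hH0 : (2 : ℝ) ≤ H := by exact_mod_cast hH
  have hH1 : (1 : ℝ) ≤ H := by linarith
  have hi : 1 ≤ δ⁻¹ := (one_le_inv₀ hδ).2 hδ1.le
  have hKx : 1 ≤ K * cx := one_le_mul_of_one_le_of_one_le hK0 hcx
  have hdKx : 1 ≤ d * (K * cx) := one_le_mul_of_one_le_of_one_le hd0 hKx
  have e : (d : ℝ) * K * H * cx / δ = (d * (K * cx)) * H * δ⁻¹ := by ring
  have hHi : 2 ≤ H * δ⁻¹ := by nlinarith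
  have hHd : H * δ⁻¹ ≤ d * (K * cx) * H * δ⁻¹ := by
    rw [mul_assoc]
    exact le_mul_of_one_le_left (by positivity) hdKx
  rw [e, div_eq_mul_inv]
  refine ⟨hHi.trans hHd, ?_, le_trans ?_ hHd, hHd, ?_⟩
  · calc (d : ℝ) = d * 1 * 1 * 1 := by ring
      _ ≤ _ := by gcongr
  · exact le_mul_of_one_le_left (by positivity) hH1
  · calc (K : ℝ) * H * cx = 1 * (K * cx) * H * 1 := by ring
      _ ≤ _ := by gcongr

/-- All logarithms of the proof reduce to a single one. With `y` its argument, both last bounds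
compare with `y ^ 3`: `3 H + 1 ≤ H ^ 3` for `H ≥ 2`, and `1 + y ^ 2 ≤ y ^ 3` for `y ≥ 2`. -/
lemma log_bounds : Real.log 2 ≤ Real.log (d * K * H * cx / δ) ∧
    Real.log d ≤ Real.log (d * K * H * cx / δ) ∧
    Real.log δ⁻¹ ≤ Real.log (d * K * H * cx / δ) ∧
    Real.log ((3 * H + 1) / δ) ≤ 3 * Real.log (d * K * H * cx / δ) ∧
    Real.log (1 + K * H * cx ^ 2) ≤ 3 * Real.log (d * K * H * cx / δ) := by
  obtain ⟨h1, h2, h3, h4, h5⟩ := two_le_and_bounds hd hK hH hcx hδ hδ1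
  have hd0 : (1 : ℝ) ≤ d := by exact_mod_cast hd
  have hK0 : (1 : ℝ) ≤ K := by exact_mod_cast hK
  have hH0 : (2 : ℝ) ≤ H := by exact_mod_cast hH
  set y := (d : ℝ) * K * H * cx / δ with hy
  have hlog3 : 3 * Real.log y = Real.log (y ^ 3) := by rw [Real.log_pow]; norm_num
  refine ⟨Real.log_le_log (by norm_num) h1, Real.log_le_log (by linarith) h2,
    Real.log_le_log (inv_pos.2 hδ) h3, ?_, ?_⟩
  · rw [hlog3]
    refine Real.log_le_log (by positivity) (le_trans ?_ (pow_le_pow_left₀ (by positivity) h4 3))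
    rw [div_pow, div_le_div_iff₀ hδ (by positivity)]
    have h6 : δ ^ 3 ≤ δ := by
      calc δ ^ 3 = δ * δ ^ 2 := by ring
        _ ≤ δ * 1 := by gcongr; exact pow_le_one₀ hδ.le hδ1.le
        _ = δ := mul_one δ
    have h7 : (3 * H + 1 : ℝ) ≤ H ^ 3 := by nlinarith [sq_nonneg ((H : ℝ) - 2)]
    exact mul_le_mul h7 h6 (by positivity) (by positivity)
  · rw [hlog3]
    refine Real.log_le_log (by positivity) ?_
    have hKH : 1 ≤ (K : ℝ) * H := by nlinarith
    have h6 : (K : ℝ) * H * cx ^ 2 ≤ y ^ 2 := by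
      calc (K : ℝ) * H * cx ^ 2 ≤ (K * H) * (K * H) * cx ^ 2 :=
            mul_le_mul_of_nonneg_right (le_mul_of_one_le_left (by positivity) hKH) (sq_nonneg cx)
        _ = (K * H * cx) ^ 2 := by ring
        _ ≤ y ^ 2 := pow_le_pow_left₀ (by positivity) h5 2
    nlinarith

end Logarithms

lemma radius_le (hd : 1 ≤ d) (hn : 1 ≤ p + q) (hH : 2 ≤ H) (hcx : 1 ≤ cx)
    (hcΘ : 0 < cΘ) (hcw : 0 < cw) (hδ : 0 < δ) (hδ1 : δ < 1) {k : ℕ} (hk : k < K) :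
    radius d (p + q) H cx cΘ cw δ k ≤ ((2 * cΘ + 3 * cw) *
      √(d * ((p + q : ℕ) : ℝ) * Real.log (d * K * H * cx / δ))) ^ 2 := by
  obtain ⟨h1, h2, h3, -, h5⟩ := log_bounds hd (by omega : 1 ≤ K) hH hcx hδ hδ1
  set L := Real.log (d * K * H * cx / δ)
  have hL : 1 / 4 ≤ L := by have := Real.log_two_gt_d9; linarith
  have hd0 : (1 : ℝ) ≤ d := by exact_mod_cast hd
  have hn0 : (1 : ℝ) ≤ ((p + q : ℕ) : ℝ) := by exact_mod_cast hn
  set n : ℝ := ((p + q : ℕ) : ℝ)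
  have hkK : (k : ℝ) + 1 ≤ K := by exact_mod_cast hk
  have hX : Real.log (1 + (k + 1) * H * cx ^ 2 / n) ≤ 3 * L := by
    refine le_trans (Real.log_le_log (by positivity) ?_) h5
    have : (k + 1) * H * cx ^ 2 / n ≤ (k + 1) * H * cx ^ 2 := div_le_self (by positivity) hn0
    have h6 : ((k : ℝ) + 1) * H * cx ^ 2 ≤ K * H * cx ^ 2 := by gcongr
    linarith
  have hdn : 1 ≤ d * n := one_le_mul_of_one_le_of_one_le hd0 hn0
  have hs : 1 / 2 ≤ √(d * n * L) := by
    rw [show (1 / 2 : ℝ) = √(1 / 4) by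
      rw [show (1 / 4 : ℝ) = (1 / 2) ^ 2 by norm_num, Real.sqrt_sq (by norm_num)]]
    exact Real.sqrt_le_sqrt (by nlinarith)
  -- The three logarithmic terms contribute at most `1 + 3 / 2 + 1` times `n L`; the constant is
  -- rounded up to `9 / 2` so that the root is `3`.
  have hΛ : √(2 * d * (Real.log d + n * Real.log (1 + (k + 1) * H * cx ^ 2 / n) / 2 +
      Real.log δ⁻¹)) ≤ 3 * √(d * n * L) := by
    rw [show 3 * √(d * n * L) = √(9 * (d * n * L)) by
      rw [Real.sqrt_mul (x := 9) (by norm_num) (d * n * L), show (9 : ℝ) = 3 ^ 2 by norm_num,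
        Real.sqrt_sq (by norm_num)]]
    refine Real.sqrt_le_sqrt ?_
    have h6 : n * Real.log (1 + (k + 1) * H * cx ^ 2 / n) ≤ n * (3 * L) := by gcongr
    have h7 : L ≤ n * L := le_mul_of_one_le_left (by linarith) hn0
    calc _ ≤ 2 * d * (9 / 2 * (n * L)) := by
          gcongr
          linarith
      _ = _ := by ring
  unfold radius
  refine pow_le_pow_left₀ (by positivity) ?_ 2
  nlinarith [mul_le_mul_of_nonneg_left hΛ hcw.le, mul_le_mul_of_nonneg_left hs hcΘ.le]

/-- The regret bound on the event that the true decoder is in the confidence sets and the realized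
widths are comparable with their expectations. -/
lemma regret_le (hS : S.Assumptions cq cx cΘ cw) (hd : 1 ≤ d) (hn : 1 ≤ p + q) (hH : 2 ≤ H)
    (hK : 1 ≤ K) (hcq : 0 < cq) (hcx : 1 ≤ cx) (hcΘ : 0 < cΘ) (hcw : 0 < cw) (hδ : 0 < δ)
    (hδ1 : δ < 1) {ω : Ω} (hctx : ∀ k < K, r.ctx k ω ∈ S.contextLaw.support)
    (hπ : ∀ k < K, S.IsPolicy (r.policy S k ω))
    (hopt : ∀ k < K, (r.confidenceSet S cq cx cΘ cw δ k ω).Nonempty →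
      r.Θopt k ω ∈ r.confidenceSet S cq cx cΘ cw δ k ω ∧
      ∀ Θ ∈ r.confidenceSet S cq cx cΘ cw δ k ω,
        S.riccatiValue (decode (r.Θopt k ω) (r.ctx k ω)) 0 S.xinit ≤
          S.riccatiValue (decode Θ (r.ctx k ω)) 0 S.xinit)
    (hobs : ∀ k < K, ∀ h, h + 1 < H → r.obs S k h ω ⬝ᵥ r.obs S k h ω ≤ cx ^ 2)
    (hconf : ∀ k < K, S.Θstar ∈ r.confidenceSet S cq cx cΘ cw δ k ω)
    (hwidth : r.expWidth S (H * cx ^ 2) K ω < ENNReal.ofReal ((3 * H + 1) / δ)) :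
    r.regret S K ω ≤ 32 * cq * cx * (2 * cΘ + 3 * cw) * (1 + H * cx ^ 2) *
      (√d * ((p + q : ℕ) : ℝ) * Real.log (d * K * H * cx / δ) ^ (3 / 2 : ℝ) * √(K * H)) := by
  obtain ⟨hl1, -, -, hl4, hl5⟩ := log_bounds hd hK hH hcx hδ hδ1
  have hcx0 : 0 < cx := by linarith
  have hd0 : (1 : ℝ) ≤ d := by exact_mod_cast hd
  have hn0 : (1 : ℝ) ≤ ((p + q : ℕ) : ℝ) := by exact_mod_cast hn
  have hK0 : (1 : ℝ) ≤ K := by exact_mod_cast hK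
  have hH0 : (2 : ℝ) ≤ H := by exact_mod_cast hH
  have hrad := fun {k} (hk : k < K) => radius_le (p := p) (q := q) hd hn hH hcx hcΘ hcw hδ hδ1 hk
  set L := Real.log (d * K * H * cx / δ) with hLdef
  set n : ℝ := ((p + q : ℕ) : ℝ) with hndef
  have hL : 1 / 4 ≤ L := by have := Real.log_two_gt_d9; linarith
  have hL0 : 0 < L := by linarith
  set B := (2 * cΘ + 3 * cw) * √(d * n * L) with hB
  have hB0 : 0 ≤ B := by positivity
  set D := 1 + (H : ℝ) * cx ^ 2 with hD
  have hD1 : 1 ≤ D := le_add_of_nonneg_right (by positivity)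
  -- Realized widths and the deviation term each contribute at most `6 D n L`. Raising the constant
  -- to `16` and `D` to `D ^ 2` makes the root explicit.
  set T := 16 * D ^ 2 * (n * L) with hT
  have hT0 : 0 < T := by positivity
  have hsum : ∑ k ∈ Finset.range K, S.meanWidth (r.V S k ω) (r.Θopt k ω) (r.ctx k ω) ≤ T := by
    have h1 := sum_meanWidth_le (by positivity : 0 < (H : ℝ) * cx ^ 2) (by positivity) hwidth
    have h2 := sum_width_le hobs hcx0 (le_refl K)
    have h3 : Real.log (r.V S K ω).det ≤ n * (3 * L) := by
      have hdet := det_V_le hobs hn (le_refl K)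
      refine (Real.log_le_log (V_posDef K ω).det_pos hdet).trans ?_
      rw [Real.log_pow]
      refine mul_le_mul_of_nonneg_left (le_trans (Real.log_le_log (by positivity) ?_) hl5)
        (by positivity)
      have h4 : (K : ℝ) * ((H - 1 : ℕ) : ℝ) * cx ^ 2 / n ≤ K * ((H - 1 : ℕ) : ℝ) * cx ^ 2 :=
        div_le_self (by positivity) hn0
      have h5 : (K : ℝ) * ((H - 1 : ℕ) : ℝ) * cx ^ 2 ≤ K * H * cx ^ 2 := by
        gcongr
        omega
      linarith
    have h4 : D * Real.log (r.V S K ω).det ≤ D * (n * (3 * L)) := by gcongr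
    have h5 : 2 * ((H : ℝ) * cx ^ 2) * Real.log ((3 * H + 1) / δ) ≤ 2 * D * (3 * (n * L)) := by
      have : L ≤ n * L := le_mul_of_one_le_left hL0.le hn0
      have h6 : Real.log ((3 * H + 1) / δ) ≤ 3 * (n * L) := by linarith
      calc _ ≤ 2 * ((H : ℝ) * cx ^ 2) * (3 * (n * L)) := by gcongr
        _ ≤ _ := by
          gcongr
          linarith
    have h6 : D ≤ D ^ 2 := by nlinarith
    have h7 : D * (n * L) ≤ D ^ 2 * (n * L) := by gcongr
    have h8 : 0 ≤ D ^ 2 * (n * L) := by positivity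
    rw [hT]
    linarith
  -- The minimizer of `t T + K H / t`, where both terms are equal.
  set t := √(K * H) / √T with ht
  have hKH0 : 0 < √(K * H : ℝ) := Real.sqrt_pos.2 (by positivity)
  have hsT0 : 0 < √T := Real.sqrt_pos.2 hT0
  have ht0 : 0 < t := by positivity
  have hep : ∀ k ∈ Finset.range K,
      (S.policyCost (r.system S k ω) (r.policy S k ω) S.xinit).toReal -
        (S.optimalCost (r.system S k ω) S.xinit).toReal ≤
      cq * cx * (2 * B) * (t * S.meanWidth (r.V S k ω) (r.Θopt k ω) (r.ctx k ω) + H * t⁻¹) := by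
    intro k hk
    have hk := Finset.mem_range.1 hk
    obtain ⟨h1, h2⟩ := hopt k hk ⟨_, hconf k hk⟩
    exact hS.episode_regret_le (hctx k hk) (hπ k hk) (by omega) hcq.le hcx0.le (V_posDef k ω)
      (dot_le_dot_V k ω) (fun h hh => h1.2 h hh _ (hctx k hk)) (h2 _ (hconf k hk)) (by positivity)
      (trace_sub_le (hconf k hk) h1 (hrad hk)) ht0
  have h1 := Finset.sum_le_sum hep
  rw [← Finset.mul_sum, Finset.sum_add_distrib, ← Finset.mul_sum] at h1
  simp only [Finset.sum_const, Finset.card_range, nsmul_eq_mul] at h1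
  have h2 : t * ∑ k ∈ Finset.range K, S.meanWidth (r.V S k ω) (r.Θopt k ω) (r.ctx k ω) +
      K * (H * t⁻¹) ≤ 2 * (√(K * H) * √T) := by
    have h3 : t * ∑ k ∈ Finset.range K, S.meanWidth (r.V S k ω) (r.Θopt k ω) (r.ctx k ω) ≤
        t * T := by gcongr
    have h4 : t * T = √(K * H) * √T := by
      rw [ht]
      nth_rewrite 2 [← Real.sq_sqrt hT0.le]
      field_simp
    have h5 : K * (H * t⁻¹) = √(K * H) * √T := by
      rw [ht, inv_div, ← mul_assoc]
      nth_rewrite 1 [← Real.sq_sqrt (by positivity : 0 ≤ (K * H : ℝ))]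
      field_simp
    linarith
  have hsT : √T = 4 * D * √(n * L) := by
    rw [hT, Real.sqrt_mul (by positivity), show 16 * D ^ 2 = (4 * D) ^ 2 by ring,
      Real.sqrt_sq (by positivity)]
  have hsB : √(d * n * L) * √(n * L) = √d * n * L := by
    rw [mul_assoc, Real.sqrt_mul (by positivity), mul_assoc, Real.mul_self_sqrt (by positivity)]
    ring
  -- The argument gives the first power of the logarithm; since `L ≥ 1 / 4`, it is at most twice the
  -- power `3 / 2`. This doubles the constant `16`.
  have hpow : L ≤ 2 * L ^ (3 / 2 : ℝ) := by
    have e : L ^ (3 / 2 : ℝ) = L * √L := by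
      rw [show (3 / 2 : ℝ) = 1 + 1 / 2 by norm_num, Real.rpow_add hL0, Real.rpow_one,
        Real.sqrt_eq_rpow]
    have h3 : 1 / 2 ≤ √L := Real.le_sqrt_of_sq_le (by linarith)
    rw [e]
    nlinarith
  calc r.regret S K ω ≤ cq * cx * (2 * B) * (t * ∑ k ∈ Finset.range K,
        S.meanWidth (r.V S k ω) (r.Θopt k ω) (r.ctx k ω) + K * (H * t⁻¹)) := h1
    _ ≤ cq * cx * (2 * B) * (2 * (√(K * H) * √T)) := by gcongr
    _ = 16 * cq * cx * (2 * cΘ + 3 * cw) * D * √(K * H) * (√(d * n * L) * √(n * L)) := by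
        rw [hsT, hB]; ring
    _ = 16 * cq * cx * (2 * cΘ + 3 * cw) * D * √(K * H) * (√d * n) * L := by
        rw [hsB]; ring
    _ ≤ 16 * cq * cx * (2 * cΘ + 3 * cw) * D * √(K * H) * (√d * n) * (2 * L ^ (3 / 2 : ℝ)) := by
        gcongr
    _ = _ := by ring

end Run

/-- The regret vanishes if no action is played. -/
lemma Run.regret_nonpos_of_one {d m p q K : ℕ} {Ω : Type*} {r : Run d m p q 1 Ω}
    {S : Model d m p q 1} {cq cx cΘ cw : ℝ} (hS : S.Assumptions cq cx cΘ cw) {ω : Ω}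
    (hctx : ∀ k < K, r.ctx k ω ∈ S.contextLaw.support)
    (hπ : ∀ k < K, S.IsPolicy (r.policy S k ω)) : r.regret S K ω ≤ 0 := by
  refine Finset.sum_nonpos fun k hk => ?_
  have hk := Finset.mem_range.1 hk
  have h1 := hS.policyCost_eq (hctx k hk) (hπ k hk) le_rfl (decode S.Θstar (r.ctx k ω))
  have h2 := hS.riccatiValue_le_optimalCost le_rfl (hctx k hk)
  simp only [Nat.sub_self, Finset.range_zero, Finset.sum_empty, add_zero] at h1
  rw [← h1] at h2
  exact sub_nonpos.2 (ENNReal.toReal_mono (hS.optimalCost_ne_top (hctx k hk) (hπ k hk) le_rfl) h2)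

/-- Noise with identity covariance cannot fit into a state space of radius less than `√d`. For this
a transition must exist, hence `2 ≤ H`. -/
lemma Model.Assumptions.one_le {d m p q H : ℕ} {S : Model d m p q H} {cq cx cΘ cw : ℝ}
    (hS : S.Assumptions cq cx cΘ cw) (hd : 1 ≤ d) (hH : 2 ≤ H) (hcx : 0 < cx) : 1 ≤ cx := by
  have := hS.prob_context
  have h : ∀ᵐ c ∂S.contextLaw, c ∈ S.contextLaw.support := Measure.support_mem_ae
  obtain ⟨c, hc⟩ := h.exists
  have h1 := hS.dot_add_dim_le hc hS.xinit_mem (hS.gain_mem c hc _ hS.xinit_mem 0 (by omega))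
    ⟨0, by omega⟩
  have h2 := dot_self_nonneg' (decode S.Θstar c *ᵥ
    Sum.elim S.xinit (S.gain (decode S.Θstar c) 0 *ᵥ S.xinit))
  have hd0 : (1 : ℝ) ≤ d := by exact_mod_cast hd
  nlinarith

open MvPolynomial in
/-- The polynomial in `(H, cq, cx, cΘ, cw)` of the regret bound. -/
noncomputable def regretPolynomial : MvPolynomial (Fin 5) ℝ :=
  C 32 * X 1 * X 2 * (C 2 * X 3 + C 3 * X 4) * (1 + X 0 * X 2 ^ 2)

lemma eval_regretPolynomial (h cq cx cΘ cw : ℝ) :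
    MvPolynomial.eval ![h, cq, cx, cΘ, cw] regretPolynomial =
      32 * cq * cx * (2 * cΘ + 3 * cw) * (1 + h * cx ^ 2) := by
  simp [regretPolynomial]

/-- For a negative base the real power carries the factor `cos (3 π / 2) = 0`. This matters when `H
= 1`, where the logarithm may be negative. -/
lemma rpow_three_halves_nonneg (x : ℝ) : 0 ≤ x ^ (3 / 2 : ℝ) := by
  rcases le_or_gt 0 x with hx | hx
  · exact Real.rpow_nonneg hx _
  · rw [Real.rpow_def_of_neg hx, show (3 / 2 : ℝ) * Real.pi = Real.pi / 2 + Real.pi by ring,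
      Real.cos_add_pi, Real.cos_pi_div_two, neg_zero, mul_zero]

end ContextualLQR

theorem proposition1 :
    ∃ c : MvPolynomial (Fin 5) ℝ,
      ∀ (d m p q H K : ℕ) (_ : 1 ≤ d) (_ : 1 ≤ p + q) (_ : 1 ≤ H)
        (cq cx cΘ cw δ : ℝ) (_ : 0 < cq) (_ : 0 < cx) (_ : 0 < cΘ) (_ : 0 < cw)
        (_ : 0 < δ) (_ : δ < 1)
        (S : ContextualLQR.Model d m p q H) (_ : S.Assumptions cq cx cΘ cw)
        (Ω : Type*) [MeasurableSpace Ω] (Pr : MeasureTheory.Measure Ω)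
        [MeasureTheory.IsProbabilityMeasure Pr]
        (r : ContextualLQR.Run d m p q H Ω) (_ : r.IsAlgorithmRun S cq cx cΘ cw δ K Pr),
        ∃ E : Set Ω, MeasurableSet E ∧ 1 - δ ≤ Pr.real E ∧
          ∀ ω ∈ E,
            (∀ k < K, S.policyCost (r.system S k ω) (r.policy S k ω) S.xinit ≠ ⊤ ∧
              S.optimalCost (r.system S k ω) S.xinit ≠ ⊤) ∧
            r.regret S K ω ≤
              MvPolynomial.eval ![(H : ℝ), cq, cx, cΘ, cw] c *
                (Real.sqrt d * (p + q : ℝ) *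
                  Real.log (d * K * H * cx / δ) ^ (3 / 2 : ℝ) * Real.sqrt (K * H)) := by
  open ContextualLQR in
  refine ⟨regretPolynomial, ?_⟩
  intro d m p q H K hd hn hH cq cx cΘ cw δ hcq hcx hcΘ hcw hδ hδ1 S hS Ω _ Pr _ r hr
  rw [eval_regretPolynomial]
  have hae : ∀ᵐ ω ∂Pr, ∀ k, k < K → r.ctx k ω ∈ S.contextLaw.support ∧
      S.IsPolicy (r.policy S k ω) ∧
      ((r.confidenceSet S cq cx cΘ cw δ k ω).Nonempty →
        r.Θopt k ω ∈ r.confidenceSet S cq cx cΘ cw δ k ω ∧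
        ∀ Θ ∈ r.confidenceSet S cq cx cΘ cw δ k ω,
          S.riccatiValue (decode (r.Θopt k ω) (r.ctx k ω)) 0 S.xinit ≤
            S.riccatiValue (decode Θ (r.ctx k ω)) 0 S.xinit) ∧
      ∀ h, h + 1 < H → r.obs S k h ω ⬝ᵥ r.obs S k h ω ≤ cx ^ 2 := by
    rw [ae_all_iff]
    intro k
    by_cases hk : k < K
    · filter_upwards [hr.ae_ctx_mem hS hk, hr.isPolicy k hk, hr.optimistic k hk,
        hr.ae_obs_le hS hH hk] with ω h1 h2 h3 h4 _ using ⟨h1, h2, h3, h4⟩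
    · exact Filter.Eventually.of_forall fun ω h => absurd h hk
  have hH0 : (1 : ℝ) ≤ H := by exact_mod_cast hH
  -- The failure probability is split as `δ / s = 3 H δ / (3 H + 1)` for the confidence sets and `δ
  -- / (3 H + 1)` for the widths, which add up to `δ`.
  set s : ℝ := 1 + 1 / (3 * H) with hs
  set N : Set Ω := {ω | ¬ ∀ k, k < K → r.ctx k ω ∈ S.contextLaw.support ∧
      S.IsPolicy (r.policy S k ω) ∧
      ((r.confidenceSet S cq cx cΘ cw δ k ω).Nonempty →
        r.Θopt k ω ∈ r.confidenceSet S cq cx cΘ cw δ k ω ∧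
        ∀ Θ ∈ r.confidenceSet S cq cx cΘ cw δ k ω,
          S.riccatiValue (decode (r.Θopt k ω) (r.ctx k ω)) 0 S.xinit ≤
            S.riccatiValue (decode Θ (r.ctx k ω)) 0 S.xinit) ∧
      ∀ h, h + 1 < H → r.obs S k h ω ⬝ᵥ r.obs S k h ω ≤ cx ^ 2}
  set B₁ : Set Ω := {ω | ∃ k ≤ K, ENNReal.ofReal (d * (s / δ)) ≤ r.expNoise S cw k ω}
  set B₂ : Set Ω := {ω | ∃ k ≤ K, ENNReal.ofReal ((3 * H + 1) / δ) ≤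
    r.expWidth S (H * cx ^ 2) k ω}
  have hbad : Pr (N ∪ (B₁ ∪ B₂)) ≤ ENNReal.ofReal δ := by
    have h0 : Pr N = 0 := hae
    have h1 := Run.measure_expNoise_le hr hS hd hcw (a := s / δ) (by positivity)
    have h2 := Run.measure_expWidth_le hr hS hH hcx (a := (3 * H + 1) / δ) (by positivity)
    calc Pr (N ∪ (B₁ ∪ B₂)) ≤ Pr N + (Pr B₁ + Pr B₂) :=
          (measure_union_le _ _).trans (add_le_add le_rfl (measure_union_le _ _))
      _ ≤ 0 + (ENNReal.ofReal (s / δ)⁻¹ + ENNReal.ofReal ((3 * H + 1) / δ)⁻¹) :=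
          add_le_add h0.le (add_le_add h1 h2)
      _ = ENNReal.ofReal δ := by
          rw [zero_add, ← ENNReal.ofReal_add (by positivity) (by positivity)]
          congr 1
          rw [hs]
          field_simp
  -- The exceptional set, in particular its null part `N`, need not be measurable; its measurable
  -- hull has the same measure.
  refine ⟨(toMeasurable Pr (N ∪ (B₁ ∪ B₂)))ᶜ, (measurableSet_toMeasurable _ _).compl, ?_, ?_⟩
  · rw [probReal_compl_eq_one_sub (measurableSet_toMeasurable _ _)]
    have h : Pr.real (toMeasurable Pr (N ∪ (B₁ ∪ B₂))) ≤ δ := by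
      rw [measureReal_def, measure_toMeasurable]
      exact ENNReal.toReal_le_of_le_ofReal hδ.le hbad
    linarith
  · intro ω hω
    have hω' : ω ∉ N ∪ (B₁ ∪ B₂) := fun h => hω (subset_toMeasurable _ _ h)
    simp only [Set.mem_union, not_or] at hω'
    obtain ⟨hN, hB₁, hB₂⟩ := hω'
    have hgood := not_not.1 hN
    have hctx := fun k hk => (hgood k hk).1
    have hπ := fun k hk => (hgood k hk).2.1
    refine ⟨fun k hk => ⟨hS.policyCost_ne_top (hctx k hk) (hπ k hk) hH,
      hS.optimalCost_ne_top (hctx k hk) (hπ k hk) hH⟩, ?_⟩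
    have hRHS : 0 ≤ 32 * cq * cx * (2 * cΘ + 3 * cw) * (1 + H * cx ^ 2) *
        (√d * (p + q : ℝ) * Real.log (d * K * H * cx / δ) ^ (3 / 2 : ℝ) * √(K * H)) := by
      have := rpow_three_halves_nonneg (Real.log (d * K * H * cx / δ))
      positivity
    -- Without episodes or without actions the regret is at most zero. Otherwise `cx ≥ 1`, and the
    -- logarithm is at least `log 2`.
    rcases Nat.eq_zero_or_pos K with rfl | hK
    · simp [Run.regret]
    rcases Nat.lt_or_ge H 2 with hH2 | hH2
    · obtain rfl : H = 1 := by omega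
      exact (Run.regret_nonpos_of_one hS hctx hπ).trans hRHS
    have hcx1 := hS.one_le hd hH2 hcx
    have hobs := fun k hk => (hgood k hk).2.2.2
    have h := Run.regret_le hS hd hn hH2 hK hcq hcx1 hcΘ hcw hδ hδ1 hctx hπ
      (fun k hk => (hgood k hk).2.2.1) hobs
      (fun k hk => Run.Θstar_mem_confidenceSet hS hd hn hH hcx1 hcΘ hcw hδ hδ1 hobs hk.le (by
        by_contra hlt
        exact hB₁ ⟨k, hk.le, by rw [← mul_div_assoc]; exact not_lt.1 hlt⟩))
      (by
        by_contra hlt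
        exact hB₂ ⟨K, le_rfl, not_lt.1 hlt⟩)
    simpa only [Nat.cast_add] using h
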